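/- **Theorem.** Let $n\ge 1$, let $\gamma:S^n\to\mathbb R_{>0}$ be of class $C^2$ and a convex integrand, i.e. its homogeneous extension $\bar\gamma(r\nu)=r\gamma(\nu)$ ($r\ge0$, $\nu\in S^n$) is a convex function on $\mathbb R^{n+1}$, and let $W=\partial\bigcap_{\nu\in S^n}\{x\in\mathbb R^{n+1}:\langle x,\nu\rangle\le\gamma(\nu)\}$ be its Wulff shape. Let $X:M\to\mathbb R^{n+1}$ be a closed, stable, piecewise-$C^2$ weakly immersed hypersurface with constant anisotropic mean curvature (CAMC) for $\gamma$ whose $r$-th anisotropic mean curvature $H_r$ is integrable over $M$ with respect to $dA$ for $r=1,\dots,n$. Then $X(M)$ is $W$ up to translation and homothety: there are $c\in\mathbb R^{n+1}$ and $\lambda\in\mathbb R\setminus\{0\}$ with $X(M)=c+\lambda W$, and $\lambda>0$ if the enclosed volume $V(X)$ defined below is positive. The notions are the following. *Weak immersion.* $M=\bigcup_{i=1}^kM_i$ is a compact connected oriented $n$-dimensional $C^\infty$ manifold without boundary; each $M_i$ is a compact connected $n$-dimensional submanifold with piecewise-$C^\infty$ boundary, that is, the closure of its interior $M_i^o$,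 with $\partial M_i$ contained, near each of its points, in a finite union of smooth hypersurfaces; and $M_i\cap M_j=\partial M_i\cap\partial M_j$ for $i\ne j$. The map $X$ is continuous, $X|_{M_i}$ is of class $C^2$, $X|_{M_i^o}$ is an immersion, and the unit normal of $X|_{M_i^o}$ for which $(\nu,\partial_1X,\dots,\partial_nX)$ is positively oriented extends to a $C^1$ map $\nu_i:M_i\to S^n$. At the points where a map $Y:M\to\mathbb R^{n+1}$ is differentiable with injective differential, $\nu$ denotes the unit normal of $Y$ so oriented; $dA$ is the $n$-dimensional volume measure on $M$ induced by $Y$ (with density $\sqrt{\det\langle\partial_iY,\partial_jY\rangle}$ in charts). For continuous $Y$ that are $C^1$ on each $M_i$, put $\mathcal F_\gamma(Y)=\int_M\gamma(\nu)\,dA$ and $V(Y)=\frac1{n+1}\int_M\langle Y,\nu\rangle\,dA$. *Anisotropic curvatures.* Let $\xi(\nu)=D\gamma|_\nu+\gamma(\nu)\nu$, where $D\gamma$ is the gradient of $\gamma$ on $S^n$. The anisotropic principal curvatures $k_1,\dots,k_n$ of $X$ at a point of $M_i^o$ are the eigenvalues of the endomorphism $S$ of the tangent space with $dX\circ S=-d(\xi\circ\nu)$,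 and $\binom nr H_r$ is the $r$-th elementary symmetric function of $k_1,\dots,k_n$. *CAMC.* $H_1$ is constant on $\bigcup_iM_i^o$, and for $i\ne j$ and $\zeta\in\partial M_i\cap\partial M_j$ the vector $\xi(\nu_i(\zeta))-\xi(\nu_j(\zeta))$ is orthogonal to $\nu_i(\zeta)$ and to $\nu_j(\zeta)$, i.e. tangent to both sheets. *Stability.* A variation of $X$ is a family $Y_\varepsilon:M\to\mathbb R^{n+1}$, $|\varepsilon|<\varepsilon_0$, with $Y_0=X$, smooth in $\varepsilon$ with all $\varepsilon$-derivatives of class $C^1$ in $(\varepsilon,p)$ on each $M_i$, such that there are unit fields on each $M_i$, continuous in $(\varepsilon,p)$, normal to $Y_\varepsilon$ on $M_i^o$, and equal to $\nu_i$ for $\varepsilon=0$. $X$ is stable if for each variation with $V(Y_\varepsilon)=V(X)$ for all $\varepsilon$ the second variation of the energy is nonnegative: whenever $\mathcal F_\gamma(Y_\varepsilon)=\mathcal F_\gamma(X)+a\varepsilon+b\varepsilon^2+o(\varepsilon^2)$ as $\varepsilon\to0$, then $b\ge0$. -/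

import Mathlib

open Set Filter Topology MeasureTheory Metric
open scoped Manifold ContDiff ENNReal RealInnerProductSpace

noncomputable section

namespace AnisoSurface

/-- Euclidean space `ℝᵐ`. -/
abbrev E (m : ℕ) : Type := EuclideanSpace ℝ (Fin m)

/-- The unit sphere `Sⁿ ⊂ ℝⁿ⁺¹`. -/
abbrev S (n : ℕ) : Type := sphere (0 : E (n + 1)) 1

/-! ### The integrand, its Wulff shape and its Cahn–Hoffman map -/

/-- The extension of `γ : Sⁿ → ℝ` to `ℝⁿ⁺¹ ∖ {0}` that is constant on rays
(with the value `0` at the origin). -/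
def radialExt {n : ℕ} (γ : S n → ℝ) (x : E (n + 1)) : ℝ :=
  open Classical in
  if hx : x ≠ 0 then γ ⟨‖x‖⁻¹ • x, by
    simp [norm_smul, inv_mul_cancel₀ (norm_ne_zero_iff.mpr hx)]⟩ else 0

/-- The extension of `γ` that is positively homogeneous of degree one:
`r ν ↦ r γ(ν)` for `r ≥ 0`, `ν ∈ Sⁿ`. -/
def homogExt {n : ℕ} (γ : S n → ℝ) (x : E (n + 1)) : ℝ := ‖x‖ * radialExt γ x

/-- `γ` is a convex integrand: its homogeneous extension is a convex function. -/
def IsConvexIntegrand {n : ℕ} (γ : S n → ℝ) : Prop := ConvexOn ℝ univ (homogExt γ)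

/-- The Wulff shape of `γ`: the boundary of `⋂_ν {x | ⟪x, ν⟫ ≤ γ(ν)}`. -/
def wulffShape {n : ℕ} (γ : S n → ℝ) : Set (E (n + 1)) :=
  frontier {x | ∀ ν : S n, ⟪x, (ν : E (n + 1))⟫ ≤ γ ν}

/-- The Cahn–Hoffman map `ξ(ν) = Dγ|_ν + γ(ν) ν`. The gradient `Dγ` on the sphere is the gradient
in `ℝⁿ⁺¹` of the extension of `γ` that is constant on rays. -/
def cahnHoffman {n : ℕ} (γ : S n → ℝ) (ν : E (n + 1)) : E (n + 1) :=
  gradient (radialExt γ) ν + radialExt γ ν • ν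

/-! ### Linear algebra of a map `L : ℝⁿ → ℝⁿ⁺¹` -/

/-- The vector product `L e₁ × ⋯ × L eₙ`, that is, the vector `N` with
`⟪N, v⟫ = det (v, L e₁, …, L eₙ)` for all `v`. -/
def crossVec {n : ℕ} (L : E n →L[ℝ] E (n + 1)) : E (n + 1) :=
  WithLp.toLp 2 fun k : Fin (n + 1) =>
    Matrix.det (Matrix.of
      (Fin.cons (Pi.single k (1 : ℝ)) (fun j : Fin n => (L (EuclideanSpace.single j 1)).ofLp)
        : Fin (n + 1) → Fin (n + 1) → ℝ))

/-- For injective `L`, the unit vector `ν` orthogonal to the image of `L` for which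
`(ν, L e₁, …, L eₙ)` is a positively oriented basis (and `0` if `L` is not injective). -/
def unitNormal {n : ℕ} (L : E n →L[ℝ] E (n + 1)) : E (n + 1) := ‖crossVec L‖⁻¹ • crossVec L

/-- The volume density `√det(g_{ij})`, `g_{ij} = ⟪L e_i, L e_j⟫`. -/
def volDensity {n : ℕ} (L : E n →L[ℝ] E (n + 1)) : ℝ :=
  Real.sqrt ((ContinuousLinearMap.adjoint L ∘L L).det)

/-- The left inverse `(Lᵀ L)⁻¹ Lᵀ` of an injective `L`. -/
def leftInv {n : ℕ} (L : E n →L[ℝ] E (n + 1)) : E (n + 1) →L[ℝ] E n :=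
  (ContinuousLinearMap.adjoint L ∘L L).inverse ∘L ContinuousLinearMap.adjoint L

section Manifold

variable {n : ℕ} {M : Type*} [TopologicalSpace M] [ChartedSpace (E n) M]

/-- The atlas of `M` is oriented: all changes of charts have positive Jacobian determinant. The
orientation of `M` is the one given by its charts. -/
def IsOrientedAtlas (n : ℕ) (M : Type*) [TopologicalSpace M] [ChartedSpace (E n) M] : Prop :=
  ∀ e ∈ atlas (E n) M, ∀ e' ∈ atlas (E n) M, ∀ x ∈ (e.symm.trans e').source,
    0 < (fderiv ℝ (e.symm.trans e') x).det

/-- The differential of `X : M → ℝⁿ⁺¹` at `p`; the tangent space at `p` is identified with `ℝⁿ`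
through the preferred chart at `p`. -/
def diff (X : M → E (n + 1)) (p : M) : E n →L[ℝ] E (n + 1) :=
  mfderiv (𝓡 n) 𝓘(ℝ, E (n + 1)) X p

/-- The unit normal field of `X`, compatible with the orientations of `M` and of `ℝⁿ⁺¹`
(meaningful at the regular points of `X`). -/
def normalField (X : M → E (n + 1)) (p : M) : E (n + 1) := unitNormal (diff X p)

/-- A compact manifold is covered by a sequence of charts. -/
theorem exists_chart_cover [CompactSpace M] [Nonempty M] :
    ∃ c : ℕ → M, (⋃ j, (chartAt (E n) (c j)).source) = univ := by
  obtain ⟨t, ht⟩ := isCompact_univ.elim_nhds_subcover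
    (fun p : M => (chartAt (E n) p).source) (fun p _ => chart_source_mem_nhds (E n) p)
  have hne : t.Nonempty := by
    obtain ⟨p⟩ := ‹Nonempty M›
    have := ht.2 (mem_univ p)
    simp only [mem_iUnion] at this
    obtain ⟨q, hq, _⟩ := this
    exact ⟨q, hq⟩
  obtain ⟨c, hc⟩ := (t.countable_toSet).exists_eq_range (by exact_mod_cast hne)
  refine ⟨c, eq_univ_of_forall fun p => ?_⟩
  have := ht.2 (mem_univ p)
  simp only [mem_iUnion] at this
  obtain ⟨q, hq, hp⟩ := this
  have hq' : q ∈ range c := hc ▸ hq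
  obtain ⟨j, rfl⟩ := hq'
  exact mem_iUnion.mpr ⟨j, hp⟩

variable [CompactSpace M] [Nonempty M] [MeasurableSpace M]

/-- A sequence of charts that covers `M`. -/
def chartSeq (n : ℕ) (M : Type*) [TopologicalSpace M] [ChartedSpace (E n) M] [CompactSpace M]
    [Nonempty M] (j : ℕ) : OpenPartialHomeomorph M (E n) :=
  chartAt (E n) ((exists_chart_cover (n := n) (M := M)).choose j)

/-- The `n`-dimensional volume measure `dA` on `M` that is induced by `X : M → ℝⁿ⁺¹`: in each chart
it has the density `√det(g_{ij})` with respect to Lebesgue measure. The pieces of `M` that the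
disjointed charts cut out are measured one by one and added up; by the change of variables formula
the result does not depend on the sequence of charts. -/
def areaMeasure (X : M → E (n + 1)) : Measure M :=
  Measure.sum fun j : ℕ =>
    (((volume : Measure (E n)).withDensity fun u =>
        ENNReal.ofReal (volDensity (fderiv ℝ (X ∘ (chartSeq n M j).symm) u))).restrict
      (chartSeq n M j '' disjointed (fun i => (chartSeq n M i).source) j)).map
      (chartSeq n M j).symm

/-- The anisotropic energy `∫_M γ(ν) dA`. -/
def energy (γ : S n → ℝ) (X : M → E (n + 1)) : ℝ :=
  ∫ p, homogExt γ (normalField X p) ∂(areaMeasure X)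

/-- The (algebraic) `(n+1)`-dimensional volume `1/(n+1) ∫_M ⟪X, ν⟫ dA` enclosed by `X`. -/
def enclosedVolume (X : M → E (n + 1)) : ℝ :=
  (1 / ((n : ℝ) + 1)) * ∫ p, ⟪X p, normalField X p⟫ ∂(areaMeasure X)

end Manifold

section Manifold

variable {n : ℕ} {M : Type*} [TopologicalSpace M] [ChartedSpace (E n) M]

/-! ### Anisotropic curvatures -/

/-- The anisotropic shape operator `S = -dξ̃` at `p`, `ξ̃ = ξ ∘ ν`. At a regular point, `dξ̃` takes
its values in `ν^⊥`, the image of `dX`, so `S` is the endomorphism with `dX ∘ S = -dξ̃`. -/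
def shapeOp (γ : S n → ℝ) (X : M → E (n + 1)) (p : M) : E n →ₗ[ℝ] E n :=
  -((leftInv (diff X p) ∘L diff (fun q => cahnHoffman γ (normalField X q)) p :
      E n →L[ℝ] E n) : E n →ₗ[ℝ] E n)

/-- The anisotropic principal curvatures: the (complex) eigenvalues of the anisotropic shape
operator, with multiplicities. -/
def principalCurvatures (γ : S n → ℝ) (X : M → E (n + 1)) (p : M) : Multiset ℂ :=
  ((shapeOp γ X p).charpoly.map (algebraMap ℝ ℂ)).roots

/-- The `r`-th anisotropic mean curvature `H_r = σ_r / (n choose r)`, where `σ_r` is the `r`-th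
elementary symmetric function of the anisotropic principal curvatures (a real number). -/
def meanCurvature (γ : S n → ℝ) (X : M → E (n + 1)) (r : ℕ) (p : M) : ℝ :=
  ((principalCurvatures γ X p).esymm r).re / (n.choose r : ℝ)

/-! ### Piecewise-`C²` weakly immersed hypersurfaces -/

/-- `D` is a domain in `M` with piecewise smooth boundary: it is the closure of its interior, and
near each boundary point the boundary lies in a finite union of smooth hypersurfaces `{h = 0}`,
`dh ≠ 0`. -/
structure HasPiecewiseSmoothBoundary (D : Set M) : Prop where
  closure_interior : closure (interior D) = D
  boundary : ∀ p ∈ frontier D, ∃ U : Set M, IsOpen U ∧ p ∈ U ∧ ∃ (m : ℕ) (h : Fin m → M → ℝ),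
    (∀ j, ContMDiffOn (𝓡 n) 𝓘(ℝ, ℝ) ∞ (h j) U) ∧
    (∀ j, ∀ q ∈ U, mfderiv (𝓡 n) 𝓘(ℝ, ℝ) (h j) q ≠ 0) ∧
    ∀ q ∈ U ∩ frontier D, ∃ j, h j q = 0

/-- `M = ⋃ Mᵢ`, where each `Mᵢ` is a compact connected `n`-dimensional submanifold with piecewise
smooth boundary and `Mᵢ ∩ Mⱼ = ∂Mᵢ ∩ ∂Mⱼ` for `i ≠ j`. -/
structure IsDecomposition {k : ℕ} (P : Fin k → Set M) : Prop where
  iUnion_eq : (⋃ i, P i) = univ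
  isCompact : ∀ i, IsCompact (P i)
  isConnected : ∀ i, IsConnected (P i)
  piecewiseSmooth : ∀ i, HasPiecewiseSmoothBoundary (n := n) (P i)
  inter_eq : ∀ i j, i ≠ j → P i ∩ P j = frontier (P i) ∩ frontier (P j)

/-- `X : M = ⋃ Mᵢ → ℝⁿ⁺¹` is a piecewise-`C²` weak immersion, and `ν i : Mᵢ → Sⁿ` are the `C¹`
extensions of its unit normal to the pieces `Mᵢ`. -/
structure IsWeakImmersion {k : ℕ} (P : Fin k → Set M) (X : M → E (n + 1))
    (ν : Fin k → M → E (n + 1)) : Prop where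
  continuous : Continuous X
  contMDiffOn : ∀ i, ContMDiffOn (𝓡 n) 𝓘(ℝ, E (n + 1)) 2 X (P i)
  immersion : ∀ i, ∀ p ∈ interior (P i), Function.Injective (diff X p)
  normal_contMDiffOn : ∀ i, ContMDiffOn (𝓡 n) 𝓘(ℝ, E (n + 1)) 1 (ν i) (P i)
  normal_unit : ∀ i, ∀ p ∈ P i, ‖ν i p‖ = 1
  normal_eq : ∀ i, ∀ p ∈ interior (P i), ν i p = normalField X p

/-- `X` has constant anisotropic mean curvature: the anisotropic mean curvature `H₁` is constant on
the regular part, and along the edges `ξ̃ᵢ - ξ̃ⱼ` is tangent to both sheets (the tangent space of the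
`i`-th sheet at `ζ` being `νᵢ(ζ)^⊥`). -/
def IsCAMC {k : ℕ} (γ : S n → ℝ) (P : Fin k → Set M) (X : M → E (n + 1))
    (ν : Fin k → M → E (n + 1)) : Prop :=
  (∃ Λ : ℝ, ∀ i, ∀ p ∈ interior (P i), meanCurvature γ X 1 p = Λ) ∧
  ∀ i j, i ≠ j → ∀ ζ ∈ frontier (P i) ∩ frontier (P j),
    ⟪cahnHoffman γ (ν i ζ) - cahnHoffman γ (ν j ζ), ν i ζ⟫ = 0 ∧
    ⟪cahnHoffman γ (ν i ζ) - cahnHoffman γ (ν j ζ), ν j ζ⟫ = 0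

/-! ### Stability -/

/-- `Y ε`, `|ε| < ε₀`, is a variation of `X`: it starts at `X`, it is smooth in `ε` with all
`ε`-derivatives of class `C¹` on each piece `Mᵢ`, and each `Y ε` has on each `Mᵢ` a unit normal
field, continuous in `(ε, p)` up to the boundary, that starts at `νᵢ`. (On a compact subset of the
interior of `Mᵢ`, where `X` is an immersion, so is `Y ε` for all small `ε`.) -/
structure IsVariation {k : ℕ} (P : Fin k → Set M) (X : M → E (n + 1))
    (ν : Fin k → M → E (n + 1)) (ε₀ : ℝ) (Y : ℝ → M → E (n + 1)) : Prop where
  pos : 0 < ε₀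
  start : Y 0 = X
  smooth : ∀ (m : ℕ) (i : Fin k),
    ContMDiffOn (𝓘(ℝ, ℝ).prod (𝓡 n)) 𝓘(ℝ, E (n + 1)) 1
      (fun q : ℝ × M => iteratedDeriv m (fun ε => Y ε q.2) q.1) (Ioo (-ε₀) ε₀ ×ˢ P i)
  normal : ∃ N : ℝ → Fin k → M → E (n + 1),
    (∀ i, ContinuousOn (fun q : ℝ × M => N q.1 i q.2) (Ioo (-ε₀) ε₀ ×ˢ P i)) ∧
    (∀ ε ∈ Ioo (-ε₀) ε₀, ∀ i, ∀ p ∈ P i, ‖N ε i p‖ = 1) ∧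
    (∀ ε ∈ Ioo (-ε₀) ε₀, ∀ i, ∀ p ∈ interior (P i), ∀ v, ⟪diff (Y ε) p v, N ε i p⟫ = 0) ∧
    ∀ i, ∀ p ∈ P i, N 0 i p = ν i p

/-- The second variation of `f` at `0` is nonnegative: if `f(ε) = f(0) + a ε + b ε² + o(ε²)` then
`b ≥ 0`. If `f` is twice differentiable at `0`, this says that `f''(0) ≥ 0`. -/
def SecondVariationNonneg (f : ℝ → ℝ) : Prop :=
  ∀ a b : ℝ, (fun ε : ℝ => f ε - (f 0 + a * ε + b * ε ^ 2)) =o[𝓝 0] (fun ε : ℝ => ε ^ 2) → 0 ≤ b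

/-- `X` is stable: the second variation of the energy is nonnegative for every variation of `X` that
preserves the enclosed volume. -/
def IsStable [CompactSpace M] [Nonempty M] [MeasurableSpace M] {k : ℕ} (γ : S n → ℝ)
    (P : Fin k → Set M) (X : M → E (n + 1)) (ν : Fin k → M → E (n + 1)) : Prop :=
  ∀ (ε₀ : ℝ) (Y : ℝ → M → E (n + 1)), IsVariation P X ν ε₀ Y →
    (∀ ε ∈ Ioo (-ε₀) ε₀, enclosedVolume (Y ε) = enclosedVolume X) →
    SecondVariationNonneg fun ε => energy γ (Y ε)

end Manifold

end AnisoSurface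

end

open Set Filter Topology MeasureTheory Metric
open scoped Manifold ContDiff ENNReal RealInnerProductSpace

noncomputable section

namespace AnisoSurface

/-! ### Jacobian determinants of compactly supported Lipschitz maps of a vector space -/

section Flat

variable {V : Type*} [NormedAddCommGroup V] [NormedSpace ℝ V]

/-! Let `ξ` be the Cahn–Hoffman field of the surface: the gradient of `homogExt γ` at the unit
normal. Along an edge, the CAMC condition says that the value of `ξ` on one sheet supports the
convex function `homogExt γ` at the normal of the other sheet. A differentiable convex function has
only one supporting vector at a point, so the two values agree (`exists_cahnField`), and `ξ` is a
continuous, piecewise C¹, hence locally Lipschitz field on all of `M`.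

Since `dξ = -dX ∘ S`, the surface `X + sξ` has the area vector `crossVec (dX + s dξ) = det (1 - sS)
• crossVec dX`. The normal line does not change, the enclosed volume is a polynomial in `s`, and the
energy is one up to `o(s²)`. The error term comes from points near the edges, where the principal
curvatures may be unbounded and `det (1 - sS)` may become negative (`isLittleO_energy_sub`).

The coefficients are tied together by a Minkowski formula, `∫ ⟪Y, crossCoeff 1 DY DZ⟫ = n ∫ ⟪Z,
crossVec DY⟫` for locally Lipschitz `Y` and `Z` (`integral_crossCoeff_one`). It involves no boundary
terms at the edges, because it is derived from one fact about Lipschitz maps: the Jacobian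
determinant of a compactly supported Lipschitz map of `ℝⁿ⁺¹` integrates to zero
(`integral_det_fderiv_eq_zero`). With `H₁ = Λ` it gives `V(X + sξ) = V(X) ((1 - Λs)ⁿ⁺¹ + O(s³))`.
Rescaling `X + sξ` back to its initial volume is an admissible variation, and the coefficient of
`s²` in its energy is `-½ ∫ γ(ν) ∑ (kᵢ - Λ)² dA` (`second_variation`,
`PrincipalData.second_nonpos`).

Stability therefore forces all `kᵢ = Λ`. The Hessian of `homogExt γ` is only semidefinite, so `S`
need not be self-adjoint for any inner product; but `Λ ≠ 0`, and with a nonzero common eigenvalue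
`S` is still `Λ` times the identity (`exists_real_eigenvalues`). Hence `dξ = -Λ dX`, and `ξ + ΛX` is
constant (`cahnField_add_smul_eq`).

It remains that `ξ` covers the whole Wulff shape (`range_cahnField_eq_wulffShape`). If a point `w`
of it were missed, the central projection of `ξ` from `w` to a hyperplane would be a Lipschitz map
whose Jacobian has a strict sign and yet integrates to zero. -/

theorem norm_fderiv_le_of_lip {W : Type*} [NormedAddCommGroup W] [NormedSpace ℝ W] {f : V → W}
    {K : NNReal} (hf : LipschitzWith K f) (x : V) : ‖fderiv ℝ f x‖ ≤ K :=
  norm_fderiv_le_of_lipschitz ℝ hf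

variable [FiniteDimensional ℝ V]

theorem abs_det_le_of_bounded {C : ℝ} : ∃ D : ℝ, ∀ T : V →L[ℝ] V, ‖T‖ ≤ C → ‖T.det‖ ≤ D := by
  obtain ⟨D, hD⟩ := (isCompact_closedBall (0 : V →L[ℝ] V) C).exists_bound_of_continuousOn
    (ContinuousLinearMap.continuous_det (𝕜 := ℝ) (E := V)).continuousOn
  exact ⟨D, fun T hT => hD T (by simpa using hT)⟩

/-- The leading coefficient `det T` of the polynomial `det (1 + s T)` is a fixed linear combination
of its values at suitable small `s`. -/
theorem exists_det_eq_sum [Nontrivial V] {δ : ℝ} (hδ : 0 < δ) :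
    ∃ (s : Fin (Module.finrank ℝ V + 1) → ℝ) (w : Fin (Module.finrank ℝ V + 1) → ℝ),
      (∀ i, 0 ≤ s i ∧ s i < δ) ∧ (∑ i, w i = 0) ∧
      ∀ T : V →L[ℝ] V, T.det = ∑ i, w i * (1 + s i • T).det := by
  set m := Module.finrank ℝ V with hm
  have hmpos : 0 < m := Module.finrank_pos
  set s : Fin (m + 1) → ℝ := fun i => δ * (i / (m + 1 : ℝ)) with hs
  have hinj : Function.Injective s := by
    intro i j hij
    have h1 : (m + 1 : ℝ) ≠ 0 := by positivity
    have : (i : ℝ) = j := by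
      have h2 := mul_left_cancel₀ hδ.ne' hij
      field_simp at h2
      exact h2
    exact Fin.ext (by exact_mod_cast this)
  set w : Fin (m + 1) → ℝ := fun i => (∏ j ∈ Finset.univ.erase i, (s i - s j))⁻¹ with hw
  have key : ∀ p : Polynomial ℝ, p.natDegree ≤ m → p.coeff m = ∑ i, w i * p.eval (s i) := by
    intro p hp
    have := Lagrange.coeff_eq_sum (s := (Finset.univ : Finset (Fin (m + 1)))) (v := s)
      hinj.injOn (P := p) (by
        refine lt_of_le_of_lt Polynomial.degree_le_natDegree ?_
        simp only [Finset.card_univ, Fintype.card_fin]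
        exact_mod_cast Nat.lt_succ_of_le hp)
    simp only [Finset.card_univ, Fintype.card_fin, Nat.add_sub_cancel] at this
    rw [this]
    refine Finset.sum_congr rfl fun i _ => ?_
    rw [hw, div_eq_mul_inv, mul_comm]
  refine ⟨s, w, ?_, ?_, ?_⟩
  · intro i
    have hi : (i : ℝ) < m + 1 := by exact_mod_cast i.2
    have h0 : (0 : ℝ) ≤ i / (m + 1 : ℝ) := by positivity
    have h1 : (i : ℝ) / (m + 1 : ℝ) < 1 := by rw [div_lt_one (by positivity)]; exact hi
    exact ⟨mul_nonneg hδ.le h0, by nlinarith⟩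
  -- The constant polynomial 1 has no term of degree `m`, because `m > 0`.
  · have := key 1 (by simp)
    rw [Polynomial.coeff_one, if_neg hmpos.ne'] at this
    simpa using this.symm
  · intro T
    let b := Module.finBasis ℝ V
    set A := LinearMap.toMatrix b b (T : V →ₗ[ℝ] V)
    set p : Polynomial ℝ := Matrix.det ((Polynomial.X : Polynomial ℝ) • A.map Polynomial.C +
      (1 : Matrix (Fin m) (Fin m) ℝ).map Polynomial.C)
    have hdeg : p.natDegree ≤ m := by
      have := Polynomial.natDegree_det_X_add_C_le A (1 : Matrix (Fin m) (Fin m) ℝ)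
      rwa [Fintype.card_fin] at this
    have hcoef : p.coeff m = A.det := by
      have := Polynomial.coeff_det_X_add_C_card A (1 : Matrix (Fin m) (Fin m) ℝ)
      rwa [Fintype.card_fin] at this
    have heval : ∀ r : ℝ, p.eval r = (1 + r • T).det := by
      intro r
      have h1 : p.eval r = (r • A + 1).det := by
        rw [← Polynomial.coe_evalRingHom, RingHom.map_det]
        congr 1
        ext i j
        rw [RingHom.mapMatrix_apply, Matrix.map_apply, Matrix.add_apply, Matrix.smul_apply,
          Matrix.map_apply, Matrix.map_apply, Matrix.add_apply, Matrix.smul_apply]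
        rw [Polynomial.coe_evalRingHom, Polynomial.eval_add, Polynomial.eval_C, smul_eq_mul,
          Polynomial.eval_mul, Polynomial.eval_X, Polynomial.eval_C, smul_eq_mul]
      rw [h1, ContinuousLinearMap.det, ← LinearMap.det_toMatrix b]
      congr 1
      rw [add_comm]
      simp [A, ContinuousLinearMap.one_def]
    have hdet : T.det = A.det := by
      rw [ContinuousLinearMap.det, ← LinearMap.det_toMatrix b]
    rw [hdet, ← hcoef, key p hdeg]
    simp only [heval]

/-- Along the segment `1 + tT`, `0 ≤ t ≤ 1`, all maps are invertible by the Neumann series, so the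
determinant keeps the sign that it has at `t = 0`. -/
theorem det_one_add_pos [Nontrivial V] {T : V →L[ℝ] V} (hT : ‖T‖ < 1) : 0 < (1 + T).det := by
  have hne : ∀ t ∈ Icc (0 : ℝ) 1, (1 + t • T).det ≠ 0 := by
    intro t ht h0
    have hlt : ‖-(t • T)‖ < 1 := by
      rw [norm_neg, norm_smul, Real.norm_of_nonneg ht.1]
      exact lt_of_le_of_lt (mul_le_of_le_one_left (norm_nonneg _) ht.2) hT
    obtain ⟨u, hu⟩ := isUnit_one_sub_of_norm_lt_one hlt
    rw [sub_neg_eq_add] at hu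
    have h1 : (1 + t • T).det * ((↑u⁻¹ : V →L[ℝ] V)).det = 1 := by
      rw [← hu, ContinuousLinearMap.det, ContinuousLinearMap.det, ← LinearMap.det_comp]
      have : (u : V →L[ℝ] V) * (↑u⁻¹ : V →L[ℝ] V) = 1 := u.mul_inv
      have h2 : ((u : V →L[ℝ] V) : V →ₗ[ℝ] V) ∘ₗ ((↑u⁻¹ : V →L[ℝ] V) : V →ₗ[ℝ] V) = LinearMap.id := by
        ext x
        exact congrArg (fun f : V →L[ℝ] V => f x) this
      rw [h2, LinearMap.det_id]
    rw [h0, zero_mul] at h1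
    exact zero_ne_one h1
  by_contra hneg
  have hc : ContinuousOn (fun t : ℝ => (1 + t • T).det) (Icc 0 1) := by
    have := ContinuousLinearMap.continuous_det (𝕜 := ℝ) (E := V)
    exact (this.comp (by fun_prop : Continuous fun t : ℝ => (1 : V →L[ℝ] V) + t • T)).continuousOn
  have := intermediate_value_Icc' zero_le_one hc
  have hmem : (0 : ℝ) ∈ Icc (1 + (1 : ℝ) • T).det (1 + (0 : ℝ) • T).det := by
    refine ⟨by simpa using hneg, ?_⟩
    have : (1 + (0 : ℝ) • T).det = 1 := by
      rw [zero_smul, add_zero]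
      exact LinearMap.det_id
    rw [this]
    exact zero_le_one
  obtain ⟨t, ht, h0⟩ := this hmem
  exact hne t ht h0

variable [MeasurableSpace V] [BorelSpace V] (μ : Measure V) [μ.IsAddHaarMeasure]

/-- Haar measure has the same null sets as the Hausdorff measure of top dimension, and Lipschitz
maps control the latter. -/
theorem addHaar_image_eq_zero_of_lipschitzWith {f : V → V} {K : NNReal} (hf : LipschitzWith K f)
    {s : Set V} (hs : μ s = 0) : μ (f '' s) = 0 := by
  have h1 : Measure.hausdorffMeasure (Module.finrank ℝ V : ℝ) s = 0 :=
    Measure.absolutelyContinuous_isAddHaarMeasure _ μ hs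
  have h2 := hf.hausdorffMeasure_image_le (d := (Module.finrank ℝ V : ℝ)) (by positivity) s
  rw [h1, mul_zero, nonpos_iff_eq_zero] at h2
  exact Measure.absolutelyContinuous_isAddHaarMeasure μ _ h2

/-- The map `x + s η(x)` is a contraction away from the identity, hence a bijection; it fixes every
point outside the ball and so maps the ball onto itself. Its Jacobian is positive, and the change of
variables formula computes the volume of the image. What matters later is that the value does not
depend on `s`. -/
theorem integral_det_one_add_smul [Nontrivial V] {η : V → V} {K : NNReal} (hη : LipschitzWith K η)
    {R : ℝ} (hsupp : ∀ x ∉ closedBall (0 : V) R, η x = 0) {s : ℝ} (hs0 : 0 ≤ s) (hs : s * K < 1) :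
    ∫ x in closedBall (0 : V) R, (1 + s • fderiv ℝ η x).det ∂μ = μ.real (closedBall (0 : V) R) := by
  lift s to NNReal using hs0
  set B := closedBall (0 : V) R
  set ψ : V → V := fun x => x + (s : ℝ) • η x with hψ
  have happ : ApproximatesLinearOn ψ ((ContinuousLinearEquiv.refl ℝ V : V ≃L[ℝ] V) : V →L[ℝ] V)
      univ (s * K) := by
    rw [ApproximatesLinearOn.approximatesLinearOn_iff_lipschitzOnWith, lipschitzOnWith_univ]
    have : (ψ - ⇑((ContinuousLinearEquiv.refl ℝ V : V ≃L[ℝ] V) : V →L[ℝ] V)) = fun x => (s : ℝ) • η x := by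
      ext x; simp [hψ]
    rw [this]
    refine LipschitzWith.of_dist_le_mul fun x y => ?_
    rw [dist_smul₀, Real.norm_of_nonneg s.coe_nonneg]
    push_cast
    rw [mul_assoc]
    exact mul_le_mul_of_nonneg_left (hη.dist_le_mul x y) s.coe_nonneg
  have hc : s * K < ‖((ContinuousLinearEquiv.refl ℝ V).symm : V →L[ℝ] V)‖₊⁻¹ := by
    have h1 : ‖((ContinuousLinearEquiv.refl ℝ V).symm : V →L[ℝ] V)‖₊ = 1 := by
      rw [← NNReal.coe_inj]
      exact ContinuousLinearMap.norm_id
    rw [h1, inv_one, ← NNReal.coe_lt_coe]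
    push_cast
    exact hs
  have hinj : Function.Injective ψ := injOn_univ.1 (happ.injOn (Or.inr hc))
  have hsurj : Function.Surjective ψ := happ.surjective (Or.inr hc)
  have hid : ∀ x ∉ B, ψ x = x := fun x hx => by simp [hψ, hsupp x hx]
  have himg : ψ '' B = B := by
    ext y
    constructor
    · rintro ⟨x, hx, rfl⟩
      by_contra hy
      have := hinj (hid _ hy)
      exact hy (this.symm ▸ hx)
    · intro hy
      obtain ⟨x, rfl⟩ := hsurj y
      refine ⟨x, ?_, rfl⟩
      by_contra hx
      rw [hid x hx] at hy
      exact hx hy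
  have hψlip : LipschitzWith (1 + s * K) ψ := by
    refine LipschitzWith.id.add (LipschitzWith.of_dist_le_mul fun x y => ?_)
    rw [dist_smul₀, Real.norm_of_nonneg s.coe_nonneg]
    push_cast
    rw [mul_assoc]
    exact mul_le_mul_of_nonneg_left (hη.dist_le_mul x y) s.coe_nonneg
  have hae : ∀ᵐ x ∂μ, DifferentiableAt ℝ η x := hη.ae_differentiableAt
  set A := {x : V | DifferentiableAt ℝ η x}
  have hA : MeasurableSet A := measurableSet_of_differentiableAt ℝ η
  have hBm : MeasurableSet B := measurableSet_closedBall
  have hder : ∀ x ∈ B ∩ A, HasFDerivWithinAt ψ (1 + (s : ℝ) • fderiv ℝ η x) (B ∩ A) x := by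
    intro x hx
    have h1 : HasFDerivAt η (fderiv ℝ η x) x := hx.2.hasFDerivAt
    exact ((hasFDerivAt_id x).add (h1.const_smul s)).hasFDerivWithinAt
  have hcov := lintegral_abs_det_fderiv_eq_addHaar_image μ (hBm.inter hA) hder hinj.injOn
  have hnull : μ (B \ A) = 0 := measure_mono_null (fun x hx => hx.2) hae
  -- By Rademacher's theorem the points of non-differentiability are null, and so is their image
  -- under the Lipschitz map `ψ`.
  have hvol : μ (ψ '' (B ∩ A)) = μ B := by
    apply le_antisymm
    · calc μ (ψ '' (B ∩ A)) ≤ μ (ψ '' B) := measure_mono (image_mono inter_subset_left)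
        _ = μ B := by rw [himg]
    · calc μ B = μ (ψ '' (B ∩ A) ∪ ψ '' (B \ A)) := by
            rw [← image_union, inter_union_sdiff, himg]
        _ ≤ μ (ψ '' (B ∩ A)) + μ (ψ '' (B \ A)) := measure_union_le _ _
        _ = μ (ψ '' (B ∩ A)) := by
          rw [addHaar_image_eq_zero_of_lipschitzWith μ hψlip hnull, add_zero]
  have hpos : ∀ x, 0 < (1 + (s : ℝ) • fderiv ℝ η x).det := by
    intro x
    apply det_one_add_pos
    rw [norm_smul, Real.norm_of_nonneg s.coe_nonneg]
    exact lt_of_le_of_lt (mul_le_mul_of_nonneg_left (norm_fderiv_le_of_lip hη x) s.coe_nonneg) hs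
  have hmeas : Measurable fun x => (1 + (s : ℝ) • fderiv ℝ η x).det :=
    (ContinuousLinearMap.continuous_det (𝕜 := ℝ) (E := V)).measurable.comp
      (((measurable_fderiv ℝ η).const_smul s).const_add 1)
  rw [integral_eq_lintegral_of_nonneg_ae (Eventually.of_forall fun x => (hpos x).le)
    hmeas.aestronglyMeasurable, Measure.real]
  congr 1
  rw [← hvol, ← hcov]
  have hBA : μ.restrict B = μ.restrict (B ∩ A) := by
    apply Measure.restrict_congr_set
    exact (ae_eq_set.2 ⟨by rwa [sdiff_self_inter], measure_mono_null (fun x hx => (hx.2 hx.1.1).elim) (measure_empty (μ := μ))⟩)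
  rw [hBA]
  refine lintegral_congr fun x => ?_
  rw [abs_of_pos (hpos x)]

/-- The Jacobian determinant of a compactly supported Lipschitz map integrates to zero. -/
theorem integral_det_fderiv_eq_zero [Nontrivial V] {η : V → V} {K : NNReal}
    (hη : LipschitzWith K η) (hc : HasCompactSupport η) :
    ∫ x, (fderiv ℝ η x).det ∂μ = 0 := by
  obtain ⟨R, hR⟩ := hc.isCompact.isBounded.subset_closedBall (0 : V)
  have hsupp : ∀ x ∉ closedBall (0 : V) R, η x = 0 := fun x hx =>
    image_eq_zero_of_notMem_tsupport fun h => hx (hR h)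
  have hout : ∀ x ∉ closedBall (0 : V) R, (fderiv ℝ η x).det = 0 := by
    intro x hx
    have : fderiv ℝ η x = 0 := by
      by_contra h
      exact hx (hR (support_fderiv_subset ℝ h))
    rw [this, ContinuousLinearMap.det, ContinuousLinearMap.toLinearMap_zero, LinearMap.det_zero,
      zero_pow Module.finrank_pos.ne']
  rw [← setIntegral_eq_integral_of_forall_compl_eq_zero hout]
  have hδ : 0 < ((K : ℝ) + 1)⁻¹ := by positivity
  -- At every node the integral of `det (1 + s Dη)` over the ball is the volume of the ball, and the
  -- weights sum to zero. Nodes below `1 / (K + 1)` satisfy `sK < 1`.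
  obtain ⟨s, w, hs, hw, hdet⟩ := exists_det_eq_sum (V := V) hδ
  rw [funext fun x => hdet (fderiv ℝ η x), integral_finsetSum]
  · have : ∀ i, ∫ x in closedBall (0 : V) R, w i * (1 + s i • fderiv ℝ η x).det ∂μ =
        w i * μ.real (closedBall (0 : V) R) := by
      intro i
      rw [integral_const_mul, integral_det_one_add_smul μ hη hsupp (hs i).1]
      have h1 := (hs i).2
      have h0 := (hs i).1
      have : s i * (K + 1) < 1 := by
        rwa [← lt_div_iff₀ (by positivity), one_div]
      nlinarith
    simp_rw [this, ← Finset.sum_mul, hw, zero_mul]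
  · intro i _
    apply Integrable.const_mul
    obtain ⟨D, hD⟩ := abs_det_le_of_bounded (V := V) (C := 1 + |s i| * K)
    refine Measure.integrableOn_of_bounded (M := D) (measure_closedBall_lt_top).ne
      ?_ (Eventually.of_forall fun x => hD _ ?_)
    · exact ((ContinuousLinearMap.continuous_det (𝕜 := ℝ) (E := V)).measurable.comp
        (((measurable_fderiv ℝ η).const_smul (s i)).const_add 1)).aestronglyMeasurable
    · refine (norm_add_le _ _).trans (add_le_add ?_ ?_)
      · exact (ContinuousLinearMap.norm_id_le (𝕜 := ℝ) (E := V))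
      · rw [norm_smul, Real.norm_eq_abs]
        exact mul_le_mul_of_nonneg_left (norm_fderiv_le_of_lip hη x) (abs_nonneg _)

end Flat

/-! ### The vector product and its expansion along a pencil `L + s M` -/

section CrossProduct

variable {n : ℕ}

theorem eq_zero_of_forall_sum_pow_smul_eq_zero {W : Type*} [NormedAddCommGroup W]
    [InnerProductSpace ℝ W] {N : ℕ} {a : ℕ → W}
    (h : ∀ s : ℝ, ∑ r ∈ Finset.range N, s ^ r • a r = 0) {r : ℕ} (hr : r < N) : a r = 0 := by
  have key : ∀ v : W, ⟪v, a r⟫ = 0 := by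
    intro v
    set p : Polynomial ℝ := ∑ r ∈ Finset.range N, Polynomial.C ⟪v, a r⟫ * Polynomial.X ^ r
    have hp : p = 0 := by
      apply Polynomial.funext
      intro s
      have h1 := congrArg (fun w => ⟪v, w⟫) (h s)
      simp only [inner_sum, inner_smul_right, inner_zero_right] at h1
      simp only [p, Polynomial.eval_finsetSum, Polynomial.eval_mul, Polynomial.eval_C,
        Polynomial.eval_pow, Polynomial.eval_X, Polynomial.eval_zero]
      rw [← h1]
      exact Finset.sum_congr rfl fun _ _ => mul_comm _ _
    have hc : p.coeff r = ⟪v, a r⟫ := by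
      simp only [p, Polynomial.finsetSum_coeff, Polynomial.coeff_C_mul_X_pow]
      rw [Finset.sum_ite_eq (Finset.range N) r, if_pos (Finset.mem_range.2 hr)]
    rw [← hc, hp, Polynomial.coeff_zero]
  exact inner_self_eq_zero.1 (key (a r))

/-- The vector product of `n` vectors in `ℝⁿ⁺¹`. -/
def crossAlt (n : ℕ) : E (n + 1) [⋀^Fin n]→ₗ[ℝ] E (n + 1) :=
  ∑ k : Fin (n + 1), (LinearMap.toSpanSingleton ℝ (E (n + 1)) (EuclideanSpace.single k 1)).compAlternatingMap
    (((Matrix.detRowAlternating (n := Fin (n + 1)) (R := ℝ)).curryLeft (Pi.single k 1)).compLinearMap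
      (WithLp.linearEquiv 2 ℝ (Fin (n + 1) → ℝ)).toLinearMap)

theorem crossAlt_apply (w : Fin n → E (n + 1)) (k : Fin (n + 1)) :
    crossAlt n w k = Matrix.det (Matrix.of (Fin.cons (Pi.single k (1 : ℝ)) (fun j => (w j).ofLp) :
      Fin (n + 1) → Fin (n + 1) → ℝ)) := by
  have h : ∀ t : Finset (Fin (n + 1)), ∀ f : Fin (n + 1) → E (n + 1) [⋀^Fin n]→ₗ[ℝ] E (n + 1),
      (∑ i ∈ t, f i) w k = ∑ i ∈ t, f i w k := by
    intro t f
    induction t using Finset.induction_on with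
    | empty => simp
    | insert i t hi ih => simp [Finset.sum_insert hi, ih]
  rw [crossAlt, h, Finset.sum_eq_single k]
  · simp only [LinearMap.compAlternatingMap_apply, LinearMap.toSpanSingleton_apply, PiLp.smul_apply,
      PiLp.single_apply, if_true, smul_eq_mul, mul_one]
    rfl
  · intro b _ hb
    simp [PiLp.single_apply, hb.symm]
  · simp

theorem crossVec_eq (L : E n →L[ℝ] E (n + 1)) :
    crossVec L = crossAlt n fun j => L (EuclideanSpace.single j 1) := by
  ext k
  rw [crossAlt_apply]
  rfl

theorem inner_crossAlt (v : E (n + 1)) (w : Fin n → E (n + 1)) :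
    ⟪v, crossAlt n w⟫ = Matrix.det (Matrix.of (Fin.cons v.ofLp (fun j => (w j).ofLp) :
      Fin (n + 1) → Fin (n + 1) → ℝ)) := by
  rw [PiLp.inner_apply, Matrix.det_succ_row_zero]
  refine Finset.sum_congr rfl fun k _ => ?_
  rw [crossAlt_apply, Matrix.det_succ_row_zero]
  rw [Finset.sum_eq_single k]
  · simp only [Matrix.of_apply, Fin.cons_zero, Pi.single_eq_same, mul_one]
    have : ∀ u : Fin (n + 1) → ℝ, (Matrix.of (Fin.cons u (fun j => (w j).ofLp) :
        Fin (n + 1) → Fin (n + 1) → ℝ)).submatrix Fin.succ k.succAbove =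
        (Matrix.of fun j => (w j).ofLp).submatrix id k.succAbove := by
      intro u; ext i j; simp
    rw [this, this]
    simp only [RCLike.inner_apply, conj_trivial]
    ring
  · intro b _ hb
    simp [Pi.single_apply, hb]
  · simp

theorem continuous_crossAlt : Continuous (crossAlt n) := by
  have : (crossAlt n : (Fin n → E (n + 1)) → E (n + 1)) =
      fun w => WithLp.toLp 2 fun k => Matrix.det (Matrix.of
        (Fin.cons (Pi.single k (1 : ℝ)) (fun j => (w j).ofLp) : Fin (n + 1) → Fin (n + 1) → ℝ)) := by
    funext w; ext k; exact crossAlt_apply w k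
  rw [this]
  refine (PiLp.continuous_toLp 2 _).comp (continuous_pi fun k => Continuous.matrix_det ?_)
  refine continuous_pi fun i => ?_
  refine Fin.cases ?_ (fun j => ?_) i
  · exact continuous_const
  · simp only [Matrix.of_apply, Fin.cons_succ]
    exact (PiLp.continuous_ofLp 2 _).comp (continuous_apply j)

theorem inner_crossVec (v : E (n + 1)) (L : E n →L[ℝ] E (n + 1)) :
    ⟪v, crossVec L⟫ = Matrix.det (Matrix.of (Fin.cons v.ofLp
      (fun j => (L (EuclideanSpace.single j 1)).ofLp) : Fin (n + 1) → Fin (n + 1) → ℝ)) := by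
  rw [crossVec_eq, inner_crossAlt]

theorem inner_crossVec_apply (L : E n →L[ℝ] E (n + 1)) (u : E n) : ⟪L u, crossVec L⟫ = 0 := by
  have h : ∀ j : Fin n, ⟪L (EuclideanSpace.single j 1), crossVec L⟫ = 0 := by
    intro j
    rw [inner_crossVec]
    apply Matrix.det_zero_of_row_eq (i := 0) (j := j.succ) (Fin.succ_ne_zero j).symm
    ext k; simp
  have hu : u = ∑ j, u j • EuclideanSpace.single j (1 : ℝ) := by
    ext i; simp [Pi.single_apply]
  rw [hu, map_sum, sum_inner]
  refine Finset.sum_eq_zero fun j _ => ?_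
  rw [map_smul, inner_smul_left, h, mul_zero]

/-- Paired with a fixed `v`, the vector product is an alternating form of top degree on `ℝⁿ`, and
such a form is multiplied by `det T` under pullback by `T`. -/
theorem crossVec_comp (L : E n →L[ℝ] E (n + 1)) (T : E n →L[ℝ] E n) :
    crossVec (L ∘L T) = T.det • crossVec L := by
  refine ext_inner_left ℝ fun v => ?_
  set f : E n [⋀^Fin n]→ₗ[ℝ] ℝ :=
    ((innerₗ (E (n + 1)) v).compAlternatingMap (crossAlt n)).compLinearMap (L : E n →ₗ[ℝ] E (n + 1))
  set e := (EuclideanSpace.basisFun (Fin n) ℝ).toBasis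
  have he : ∀ j, e j = EuclideanSpace.single j (1 : ℝ) := fun j => by simp [e]
  have h1 : ⟪v, crossVec (L ∘L T)⟫ = f (fun j => T (e j)) := by
    rw [crossVec_eq]; simp only [he]; rfl
  have h2 : ⟪v, crossVec L⟫ = f e := by
    rw [crossVec_eq]
    have : (e : Fin n → E n) = fun j => EuclideanSpace.single j (1 : ℝ) := funext he
    rw [this]; rfl
  rw [inner_smul_right, h1, h2, AlternatingMap.eq_smul_basis_det e f]
  have h3 : e.det (fun j => T (e j)) = T.det := by
    have := Module.Basis.det_comp e (T : E n →ₗ[ℝ] E n) e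
    rw [Module.Basis.det_self, mul_one] at this
    exact this
  simp only [AlternatingMap.smul_apply, smul_eq_mul, h3, Module.Basis.det_self, mul_one]
  ring

theorem unitNormal_comp (L : E n →L[ℝ] E (n + 1)) {T : E n →L[ℝ] E n} (hT : 0 < T.det) :
    unitNormal (L ∘L T) = unitNormal L := by
  rw [unitNormal, unitNormal, crossVec_comp, norm_smul, Real.norm_of_nonneg hT.le, smul_smul,
    mul_inv]
  congr 1
  field_simp

theorem norm_smul_unitNormal (L : E n →L[ℝ] E (n + 1)) : ‖crossVec L‖ • unitNormal L = crossVec L := by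
  rcases eq_or_ne (crossVec L) 0 with h | h
  · simp [h]
  · rw [unitNormal, smul_smul, mul_inv_cancel₀ (norm_ne_zero_iff.2 h), one_smul]

theorem det_adjoint_comp (L : E n →L[ℝ] E (n + 1)) :
    (ContinuousLinearMap.adjoint L ∘L L).det = Matrix.det (Matrix.of fun i j : Fin n =>
      ⟪L (EuclideanSpace.single i 1), L (EuclideanSpace.single j 1)⟫) := by
  rw [ContinuousLinearMap.det, ← LinearMap.det_toMatrix (EuclideanSpace.basisFun (Fin n) ℝ).toBasis]
  congr 1
  ext i j
  rw [LinearMap.toMatrix_apply]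
  simp only [OrthonormalBasis.coe_toBasis, EuclideanSpace.basisFun_apply,
    OrthonormalBasis.coe_toBasis_repr_apply, EuclideanSpace.basisFun_repr, Matrix.of_apply]
  rw [← ContinuousLinearMap.adjoint_inner_right, EuclideanSpace.inner_single_left]
  simp

/-- The matrix `A` with rows `N, L e₁, …, L eₙ` has determinant `⟪N, crossVec L⟫`. As `N` is a unit
vector orthogonal to the other rows, `A Aᵀ` consists of a block 1 and the Gram matrix. -/
theorem inner_crossVec_sq {L : E n →L[ℝ] E (n + 1)} {N : E (n + 1)} (hN : ‖N‖ = 1)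
    (hNL : ∀ u, ⟪N, L u⟫ = 0) :
    ⟪N, crossVec L⟫ ^ 2 = (ContinuousLinearMap.adjoint L ∘L L).det := by
  set A := Matrix.of (Fin.cons N.ofLp (fun j => (L (EuclideanSpace.single j 1)).ofLp) :
    Fin (n + 1) → Fin (n + 1) → ℝ) with hA
  have hin : ∀ x y : E (n + 1), x.ofLp ⬝ᵥ y.ofLp = ⟪x, y⟫ := by
    intro x y
    rw [PiLp.inner_apply]
    refine Finset.sum_congr rfl fun k _ => ?_
    simp [mul_comm]
  have hsq : A.det ^ 2 = (A * A.transpose).det := by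
    rw [Matrix.det_mul, Matrix.det_transpose, sq]
  rw [inner_crossVec, det_adjoint_comp, ← hA, hsq, Matrix.det_succ_row_zero,
    Finset.sum_eq_single 0]
  · have h00 : (A * A.transpose) 0 0 = 1 := by
      rw [Matrix.mul_apply']
      exact (hin N N).trans (by rw [real_inner_self_eq_norm_sq, hN, one_pow])
    rw [h00]
    simp only [Fin.val_zero, pow_zero, one_mul]
    congr 1
    ext i j
    rw [Matrix.submatrix_apply, Matrix.mul_apply', Fin.zero_succAbove]
    exact hin (L (EuclideanSpace.single i 1)) (L (EuclideanSpace.single j 1))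
  · intro j _ hj
    obtain ⟨i, rfl⟩ := Fin.exists_succ_eq.2 hj
    have : (A * A.transpose) 0 i.succ = 0 := by
      rw [Matrix.mul_apply']
      exact (hin N (L (EuclideanSpace.single i 1))).trans (hNL _)
    rw [this]; ring
  · simp

theorem exists_unit_normal (L : E n →L[ℝ] E (n + 1)) : ∃ N : E (n + 1), ‖N‖ = 1 ∧ ∀ u, ⟪N, L u⟫ = 0 := by
  have hlt : Module.finrank ℝ (LinearMap.range (L : E n →ₗ[ℝ] E (n + 1))) < Module.finrank ℝ (E (n + 1)) := by
    refine lt_of_le_of_lt (LinearMap.finrank_range_le _) ?_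
    simp
  have hne : (LinearMap.range (L : E n →ₗ[ℝ] E (n + 1)))ᗮ ≠ ⊥ := by
    intro h
    rw [Submodule.orthogonal_eq_bot_iff] at h
    rw [h, finrank_top] at hlt
    exact lt_irrefl _ hlt
  obtain ⟨v, hv, hv0⟩ := Submodule.exists_mem_ne_zero_of_ne_bot hne
  refine ⟨‖v‖⁻¹ • v, norm_smul_inv_norm hv0, fun u => ?_⟩
  rw [inner_smul_left, real_inner_comm, hv (L u) ⟨u, rfl⟩, mul_zero]

theorem volDensity_eq (L : E n →L[ℝ] E (n + 1)) : volDensity L = ‖crossVec L‖ := by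
  rw [volDensity]
  obtain ⟨N, hN, hNL⟩ := exists_unit_normal L
  have h1 := inner_crossVec_sq hN hNL
  rcases eq_or_ne (crossVec L) 0 with h | h
  · rw [← h1, h]; simp
  · have h2 := inner_crossVec_sq (N := ‖crossVec L‖⁻¹ • crossVec L) (norm_smul_inv_norm h)
      (fun u => by rw [inner_smul_left, real_inner_comm, inner_crossVec_apply, mul_zero])
    rw [← h2, inner_smul_left, real_inner_self_eq_norm_sq, Real.sqrt_sq_eq_abs]
    have h3 : ‖crossVec L‖ ≠ 0 := norm_ne_zero_iff.2 h
    simp only [conj_trivial]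
    rw [sq, inv_mul_cancel_left₀ h3, abs_norm]

theorem crossVec_ne_zero {L : E n →L[ℝ] E (n + 1)} (hL : Function.Injective L) : crossVec L ≠ 0 := by
  intro h
  have h0 : volDensity L = 0 := by rw [volDensity_eq, h, norm_zero]
  obtain ⟨N, hN, hNL⟩ := exists_unit_normal L
  have h1 : (ContinuousLinearMap.adjoint L ∘L L).det = 0 := by
    rw [← inner_crossVec_sq hN hNL, h]; simp
  obtain ⟨u, hu, hu0⟩ := Submodule.exists_mem_ne_zero_of_ne_bot
    (LinearMap.bot_lt_ker_of_det_eq_zero h1).ne'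
  have h2 : ⟪L u, L u⟫ = 0 := by
    rw [← ContinuousLinearMap.adjoint_inner_right]
    have : ContinuousLinearMap.adjoint L (L u) = 0 := hu
    rw [this, inner_zero_right]
  exact hu0 (hL (by rw [inner_self_eq_zero.1 h2, map_zero]))

theorem norm_unitNormal {L : E n →L[ℝ] E (n + 1)} (hL : Function.Injective L) : ‖unitNormal L‖ = 1 :=
  norm_smul_inv_norm (crossVec_ne_zero hL)

theorem inner_unitNormal_apply (L : E n →L[ℝ] E (n + 1)) (u : E n) : ⟪unitNormal L, L u⟫ = 0 := by
  rw [unitNormal, inner_smul_left, real_inner_comm, inner_crossVec_apply, mul_zero]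

/-- The coefficients of `crossVec (L + s M)` as a polynomial in `s`. -/
def crossCoeff (r : ℕ) (L M : E n →L[ℝ] E (n + 1)) : E (n + 1) :=
  ∑ t ∈ Finset.powersetCard r (Finset.univ : Finset (Fin n)),
    crossAlt n (t.piecewise (fun j => M (EuclideanSpace.single j 1))
      (fun j => L (EuclideanSpace.single j 1)))

theorem crossVec_add_smul (L M : E n →L[ℝ] E (n + 1)) (s : ℝ) :
    crossVec (L + s • M) = ∑ r ∈ Finset.range (n + 1), s ^ r • crossCoeff r L M := by
  rw [crossVec_eq]
  have h1 : (fun j => (L + s • M) (EuclideanSpace.single j (1 : ℝ))) =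
      (fun j => s • M (EuclideanSpace.single j 1)) + fun j => L (EuclideanSpace.single j 1) := by
    ext j; simp [add_comm]
  rw [h1, AlternatingMap.map_add_univ, ← Finset.powerset_univ, Finset.sum_powerset, Finset.card_univ, Fintype.card_fin]
  refine Finset.sum_congr rfl fun r _ => ?_
  rw [crossCoeff, Finset.smul_sum]
  refine Finset.sum_congr rfl fun t ht => ?_
  have := (crossAlt n).toMultilinearMap.map_piecewise_smul (fun _ => s)
    (t.piecewise (fun j => M (EuclideanSpace.single j 1))
      (fun j => L (EuclideanSpace.single j 1))) t
  rw [Finset.prod_const, (Finset.mem_powersetCard.1 ht).2] at this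
  rw [← AlternatingMap.coe_multilinearMap, ← this]
  congr 1
  ext j : 1
  by_cases hj : j ∈ t <;> simp [hj]

theorem crossCoeff_zero (L M : E n →L[ℝ] E (n + 1)) : crossCoeff 0 L M = crossVec L := by
  rw [crossCoeff, crossVec_eq]; simp

theorem continuous_crossCoeff (r : ℕ) :
    Continuous fun q : (E n →L[ℝ] E (n + 1)) × (E n →L[ℝ] E (n + 1)) => crossCoeff r q.1 q.2 := by
  refine continuous_finsetSum _ fun t _ => continuous_crossAlt.comp (continuous_pi fun j => ?_)
  by_cases hj : j ∈ t
  · simp only [Finset.piecewise_eq_of_mem _ _ _ hj]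
    exact continuous_snd.clm_apply continuous_const
  · simp only [Finset.piecewise_eq_of_notMem _ _ _ hj]
    exact continuous_fst.clm_apply continuous_const

theorem continuous_crossVec : Continuous (crossVec : (E n →L[ℝ] E (n + 1)) → E (n + 1)) := by
  have := (continuous_crossCoeff (n := n) 0).comp (continuous_id.prodMk continuous_const :
    Continuous fun L : E n →L[ℝ] E (n + 1) => (L, (0 : E n →L[ℝ] E (n + 1))))
  simpa only [Function.comp_def, crossCoeff_zero, id] using this

theorem crossCoeff_one (L M : E n →L[ℝ] E (n + 1)) :
    crossCoeff 1 L M = ∑ j, crossAlt n (Function.update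
      (fun j => L (EuclideanSpace.single j 1)) j (M (EuclideanSpace.single j 1))) := by
  rw [crossCoeff, Finset.powersetCard_one, Finset.sum_map]
  refine Finset.sum_congr rfl fun j _ => ?_
  simp [Finset.piecewise_singleton]

theorem crossCoeff_one_add (L M M' : E n →L[ℝ] E (n + 1)) :
    crossCoeff 1 L (M + M') = crossCoeff 1 L M + crossCoeff 1 L M' := by
  simp only [crossCoeff_one, ← Finset.sum_add_distrib, add_apply,
    AlternatingMap.map_update_add]

theorem crossCoeff_one_zero (L : E n →L[ℝ] E (n + 1)) : crossCoeff 1 L 0 = 0 := by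
  have := crossCoeff_one_add L 0 0
  rw [add_zero] at this
  simpa using this

theorem crossCoeff_one_sum {ι : Type*} (t : Finset ι) (L : E n →L[ℝ] E (n + 1))
    (M : ι → E n →L[ℝ] E (n + 1)) : crossCoeff 1 L (∑ i ∈ t, M i) = ∑ i ∈ t, crossCoeff 1 L (M i) := by
  classical
  induction t using Finset.induction_on with
  | empty => simp [crossCoeff_one_zero]
  | insert i t hi ih => rw [Finset.sum_insert hi, Finset.sum_insert hi, crossCoeff_one_add, ih]

theorem crossCoeff_smul_smul (r : ℕ) (a b : ℝ) (L M : E n →L[ℝ] E (n + 1)) :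
    crossCoeff r (a • L) (b • M) = (a ^ (n - r) * b ^ r) • crossCoeff r L M := by
  rw [crossCoeff, crossCoeff, Finset.smul_sum]
  refine Finset.sum_congr rfl fun t ht => ?_
  have hcard := (Finset.mem_powersetCard.1 ht).2
  have h1 : t.piecewise (fun j => (b • M) (EuclideanSpace.single j (1 : ℝ)))
      (fun j => (a • L) (EuclideanSpace.single j 1)) = fun j => (t.piecewise (fun _ => b) (fun _ => a) j) •
      t.piecewise (fun j => M (EuclideanSpace.single j 1)) (fun j => L (EuclideanSpace.single j 1)) j := by
    ext j : 1
    by_cases hj : j ∈ t <;> simp [hj]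
  rw [h1, AlternatingMap.map_smul_univ]
  congr 1
  rw [Finset.prod_piecewise, Finset.prod_const, Finset.prod_const, Finset.univ_inter, hcard, mul_comm,
    Finset.card_univ_sdiff, Fintype.card_fin, hcard]

theorem crossVec_smul (a : ℝ) (L : E n →L[ℝ] E (n + 1)) : crossVec (a • L) = a ^ n • crossVec L := by
  have := crossCoeff_smul_smul 0 a 0 L 0
  simpa [crossCoeff_zero] using this

/-- Comparison of the coefficients of `s` in `crossVec_comp`, applied to `L + s M`. -/
theorem crossCoeff_comp (r : ℕ) (L M : E n →L[ℝ] E (n + 1)) (T : E n →L[ℝ] E n) (hr : r ≤ n) :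
    crossCoeff r (L ∘L T) (M ∘L T) = T.det • crossCoeff r L M := by
  rw [← sub_eq_zero]
  refine eq_zero_of_forall_sum_pow_smul_eq_zero (N := n + 1)
    (a := fun r => crossCoeff r (L ∘L T) (M ∘L T) - T.det • crossCoeff r L M) (fun s => ?_)
    (Nat.lt_succ_of_le hr)
  simp only [smul_sub, Finset.sum_sub_distrib]
  rw [← crossVec_add_smul, sub_eq_zero]
  have : L ∘L T + s • M ∘L T = (L + s • M) ∘L T := by ext; simp
  rw [this, crossVec_comp, crossVec_add_smul, Finset.smul_sum]
  exact Finset.sum_congr rfl fun _ _ => smul_comm _ _ _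

theorem hasDerivAt_crossVec (L M : E n →L[ℝ] E (n + 1)) (s : ℝ) :
    HasDerivAt (fun s : ℝ => crossVec (L + s • M))
      (∑ r ∈ Finset.range (n + 1), ((r : ℝ) * s ^ (r - 1)) • crossCoeff r L M) s := by
  simp only [crossVec_add_smul]
  exact HasDerivAt.fun_sum fun r _ => (hasDerivAt_pow r s).smul_const _

/-- Both sides are the derivative at `s` of `s ↦ crossVec (L + s M)`. This lets the Minkowski
formula for the whole family `X + sξ` be read off coefficient by coefficient. -/
theorem crossCoeff_one_add_smul (L M : E n →L[ℝ] E (n + 1)) (hn : 1 ≤ n) (s : ℝ) :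
    crossCoeff 1 (L + s • M) M =
      ∑ r ∈ Finset.range (n + 1), ((r : ℝ) * s ^ (r - 1)) • crossCoeff r L M := by
  have h1 := hasDerivAt_crossVec (L + s • M) M 0
  have h2 : HasDerivAt (fun t : ℝ => crossVec (L + s • M + t • M))
      (∑ r ∈ Finset.range (n + 1), ((r : ℝ) * s ^ (r - 1)) • crossCoeff r L M) 0 := by
    have h3 := hasDerivAt_crossVec L M (s + 0)
    have h4 := HasDerivAt.comp_const_add s 0 h3
    simp only [add_zero] at h4
    refine h4.congr_of_eventuallyEq (Eventually.of_forall fun t => ?_)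
    show crossVec (L + s • M + t • M) = crossVec (L + (s + t) • M)
    have h5 : (s + t) • M = s • M + t • M := by
      ext v : 1; simp only [add_apply, smul_apply]; exact Module.add_smul s t (M v)
    rw [h5, add_assoc]
  rw [← h1.unique h2, Finset.sum_eq_single 1]
  · simp
  · intro r _ hr
    rcases Nat.eq_zero_or_pos r with rfl | hpos
    · simp
    · rw [zero_pow (by omega), mul_zero, zero_smul]
  · intro h; exact absurd (Finset.mem_range.2 (by omega)) h

end CrossProduct

/-! ### Products and compactly supported maps in the locally Lipschitz class -/

section LocallyLipschitz

variable {V W : Type*} [NormedAddCommGroup V] [NormedSpace ℝ V] [NormedAddCommGroup W]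
  [NormedSpace ℝ W]

theorem LocallyLipschitzOn.smul_vec {s : Set V} {f : V → ℝ} {g : V → W} (hf : LocallyLipschitzOn s f)
    (hg : LocallyLipschitzOn s g) : LocallyLipschitzOn s fun x => f x • g x := by
  intro x hx
  obtain ⟨Kf, t, ht, hft⟩ := hf hx
  obtain ⟨Kg, u, hu, hgu⟩ := hg hx
  have hfc : ∀ᶠ y in 𝓝[s] x, ‖f y‖ ≤ ‖f x‖ + 1 := by
    have := ((hf.continuousOn x hx).norm.eventually (gt_mem_nhds (lt_add_one ‖f x‖)))
    exact this.mono fun y hy => le_of_lt hy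
  have hgc : ∀ᶠ y in 𝓝[s] x, ‖g y‖ ≤ ‖g x‖ + 1 := by
    have := ((hg.continuousOn x hx).norm.eventually (gt_mem_nhds (lt_add_one ‖g x‖)))
    exact this.mono fun y hy => le_of_lt hy
  set A : NNReal := ⟨‖f x‖ + 1, by positivity⟩
  set B : NNReal := ⟨‖g x‖ + 1, by positivity⟩
  refine ⟨A * Kg + B * Kf, _, inter_mem (inter_mem ht hu) (inter_mem hfc hgc), ?_⟩
  refine LipschitzOnWith.of_dist_le_mul fun y hy z hz => ?_
  have e : f y • g y - f z • g z = f y • (g y - g z) + (f y - f z) • g z := by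
    rw [smul_sub, sub_smul]; abel
  have h1 := hft.dist_le_mul y hy.1.1 z hz.1.1
  have h2 := hgu.dist_le_mul y hy.1.2 z hz.1.2
  have h3 : ‖f y‖ ≤ A := hy.2.1
  have h4 : ‖g z‖ ≤ B := hz.2.2
  rw [dist_eq_norm] at h1 h2
  rw [dist_eq_norm, e]
  refine (norm_add_le _ _).trans ?_
  rw [norm_smul, norm_smul]
  push_cast
  calc ‖f y‖ * ‖g y - g z‖ + ‖f y - f z‖ * ‖g z‖
      ≤ A * (Kg * dist y z) + (Kf * dist y z) * B := by
        gcongr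
    _ = (A * Kg + B * Kf) * dist y z := by ring

theorem LocallyLipschitz.smul_vec {f : V → ℝ} {g : V → W} (hf : LocallyLipschitz f)
    (hg : LocallyLipschitz g) : LocallyLipschitz fun x => f x • g x := by
  rw [← locallyLipschitzOn_univ] at *
  exact LocallyLipschitzOn.smul_vec hf hg

/-- On a ball slightly larger than the support, compactness gives a Lipschitz constant. A point of
the support and a point outside the larger ball are more than 1 apart, so the supremum of the map
bounds their difference quotient. -/
theorem LocallyLipschitz.exists_lipschitzWith [FiniteDimensional ℝ V] {f : V → W}
    (hf : LocallyLipschitz f) (hc : HasCompactSupport f) : ∃ K, LipschitzWith K f := by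
  obtain ⟨R, hR⟩ := hc.isCompact.isBounded.subset_closedBall (0 : V)
  have hcpt : IsCompact (closedBall (0 : V) (R + 1)) := isCompact_closedBall 0 (R + 1)
  obtain ⟨K, hK⟩ := (locallyLipschitzOn_univ.2 hf |>.mono (subset_univ _)).exists_lipschitzOnWith_of_compact hcpt
  obtain ⟨C, hC⟩ := hcpt.exists_bound_of_continuousOn hf.continuous.continuousOn
  have hz : ∀ x, R < ‖x‖ → f x = 0 := fun x hx =>
    image_eq_zero_of_notMem_tsupport fun h => by
      have := hR h
      rw [mem_closedBall_zero_iff] at this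
      linarith
  refine ⟨K + ‖C‖₊, LipschitzWith.of_dist_le_mul fun x y => ?_⟩
  push_cast
  have hd : 0 ≤ dist x y := dist_nonneg
  have hK0 : 0 ≤ (K : ℝ) := K.2
  have key : ∀ x y : V, ‖x‖ ≤ R → R + 1 < ‖y‖ → dist (f x) (f y) ≤ (K + ‖C‖) * dist x y := by
    intro x y hx hy
    rw [hz y (by linarith), dist_zero_right]
    have h1 : ‖f x‖ ≤ C := hC x (mem_closedBall_zero_iff.2 (by linarith))
    have h2 : 1 ≤ dist x y := by
      rw [dist_comm, dist_eq_norm]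
      have := norm_sub_norm_le y x
      linarith
    have h3 : C ≤ ‖C‖ := le_abs_self C
    have h4 : 0 ≤ ‖C‖ := norm_nonneg C
    nlinarith
  by_cases hx : ‖x‖ ≤ R + 1
  · by_cases hy : ‖y‖ ≤ R + 1
    · refine (hK.dist_le_mul x (mem_closedBall_zero_iff.2 hx) y (mem_closedBall_zero_iff.2 hy)).trans ?_
      have : 0 ≤ ‖C‖ * dist x y := by positivity
      linarith
    · by_cases hx' : ‖x‖ ≤ R
      · exact key x y hx' (not_le.1 hy)
      · rw [hz x (not_le.1 hx'), hz y (by linarith), dist_self]; positivity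
  · by_cases hy : ‖y‖ ≤ R
    · rw [dist_comm (f x), dist_comm x]
      exact key y x hy (not_le.1 hx)
    · rw [hz x (by linarith), hz y (not_le.1 hy), dist_self]; positivity

end LocallyLipschitz

/-! ### The Minkowski formula for compactly supported Lipschitz maps on `ℝⁿ` -/

section FlatParts

variable {n : ℕ}

/-- The isomorphism `ℝ × ℝⁿ ≃ ℝⁿ⁺¹`. -/
def consEquiv (n : ℕ) : (ℝ × E n) ≃ₗ[ℝ] E (n + 1) where
  toFun q := WithLp.toLp 2 (Fin.cons q.1 q.2.ofLp : Fin (n + 1) → ℝ)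
  invFun z := (z 0, WithLp.toLp 2 fun j : Fin n => z j.succ)
  left_inv q := by ext <;> simp
  right_inv z := by
    ext i
    refine Fin.cases ?_ (fun j => ?_) i <;> simp
  map_add' q q' := by
    ext i
    refine Fin.cases ?_ (fun j => ?_) i <;> simp
  map_smul' c q := by
    ext i
    refine Fin.cases ?_ (fun j => ?_) i <;> simp

/-- The Jacobian of `(τ, y) ↦ τ v + L y`, in the form in which it appears for the map on `ℝ × ℝⁿ`
that proves the Minkowski formula. -/
theorem det_consEquiv_symm_comp (v : E (n + 1)) (L : E n →L[ℝ] E (n + 1)) :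
    ((consEquiv n).symm.toLinearMap ∘ₗ
      (LinearMap.coprod (LinearMap.toSpanSingleton ℝ (E (n + 1)) v) (L : E n →ₗ[ℝ] E (n + 1)))).det =
      ⟪v, crossVec L⟫ := by
  set k := LinearMap.coprod (LinearMap.toSpanSingleton ℝ (E (n + 1)) v) (L : E n →ₗ[ℝ] E (n + 1))
  have h1 : (consEquiv n).symm.toLinearMap ∘ₗ k = (consEquiv n).symm.toLinearMap ∘ₗ
      (k ∘ₗ (consEquiv n).symm.toLinearMap) ∘ₗ (consEquiv n).symm.symm.toLinearMap := by
    ext q <;> simp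
  rw [h1, LinearMap.det_conj, inner_crossVec,
    ← LinearMap.det_toMatrix (EuclideanSpace.basisFun (Fin (n + 1)) ℝ).toBasis,
    ← Matrix.det_transpose]
  congr 1
  ext i j
  rw [Matrix.transpose_apply, LinearMap.toMatrix_apply]
  simp only [OrthonormalBasis.coe_toBasis, EuclideanSpace.basisFun_apply,
    OrthonormalBasis.coe_toBasis_repr_apply, EuclideanSpace.basisFun_repr, Matrix.of_apply,
    LinearMap.comp_apply, LinearEquiv.coe_coe]
  refine Fin.cases ?_ (fun i => ?_) i
  · have : (consEquiv n).symm (EuclideanSpace.single 0 (1 : ℝ)) = (1, 0) := by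
      rw [LinearEquiv.symm_apply_eq]
      ext i
      refine Fin.cases ?_ (fun j => ?_) i <;> simp [consEquiv]
    rw [this]
    simp [k]
  · have : (consEquiv n).symm (EuclideanSpace.single i.succ (1 : ℝ)) =
        (0, EuclideanSpace.single i 1) := by
      rw [LinearEquiv.symm_apply_eq]
      ext j
      refine Fin.cases ?_ (fun j => ?_) j <;> simp [consEquiv, Pi.single_apply]
    rw [this]
    simp [k]

/-- Integrals of products of coefficients vanish termwise. -/
theorem exists_bump : ∃ a : ℝ → ℝ, ContDiff ℝ ∞ a ∧ HasCompactSupport a ∧ (∀ t, 0 ≤ a t) ∧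
    ∃ t, 0 < a t ∧ deriv a t ≠ 0 := by
  let f : ContDiffBump (0 : ℝ) := ⟨1, 2, one_pos, one_lt_two⟩
  refine ⟨f, f.contDiff, f.hasCompactSupport, fun t => f.nonneg, ?_⟩
  -- At a zero the nonnegative function `f` has a minimum. If `f'` also vanished wherever `f > 0`,
  -- then `f` would be constant, but it takes both values 1 and 0.
  by_contra! h
  have hd : Differentiable ℝ f := (f.contDiff (n := 1)).differentiable (by norm_num)
  have hz : ∀ t, deriv f t = 0 := by
    intro t
    rcases (f.nonneg (x := t)).eq_or_lt with h0 | h0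
    · have hmin : IsLocalMin f t := Eventually.of_forall fun y => by
        rw [← h0]; exact f.nonneg
      exact hmin.deriv_eq_zero
    · exact h t h0
  have := is_const_of_deriv_eq_zero hd hz 0 3
  rw [f.one_of_mem_closedBall (mem_closedBall_self zero_le_one),
    f.zero_of_le_dist (by rw [dist_zero_right]; norm_num [f])] at this
  exact one_ne_zero this

theorem bounded_crossCoeff (r : ℕ) (C : ℝ) : ∃ D : ℝ, ∀ L M : E n →L[ℝ] E (n + 1),
    ‖L‖ ≤ C → ‖M‖ ≤ C → ‖crossCoeff r L M‖ ≤ D := by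
  obtain ⟨D, hD⟩ := ((isCompact_closedBall (0 : E n →L[ℝ] E (n + 1)) C).prod
    (isCompact_closedBall (0 : E n →L[ℝ] E (n + 1)) C)).exists_bound_of_continuousOn
    (continuous_crossCoeff (n := n) r).continuousOn
  exact ⟨D, fun L M hL hM => hD (L, M) ⟨by simpa using hL, by simpa using hM⟩⟩

theorem measurable_crossCoeff_fderiv (r : ℕ) (Y Z : E n → E (n + 1)) :
    Measurable fun x => crossCoeff r (fderiv ℝ Y x) (fderiv ℝ Z x) :=
  (continuous_crossCoeff r).measurable.comp ((measurable_fderiv ℝ Y).prodMk (measurable_fderiv ℝ Z))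

theorem integrable_inner_crossCoeff {Y Z U : E n → E (n + 1)} {K K' : NNReal} (hY : LipschitzWith K Y)
    (hZ : LipschitzWith K' Z) (hU : Continuous U) (hUc : HasCompactSupport U) (r : ℕ) :
    Integrable fun x => ⟪U x, crossCoeff r (fderiv ℝ Y x) (fderiv ℝ Z x)⟫ := by
  obtain ⟨D, hD⟩ := bounded_crossCoeff (n := n) r (max K K')
  obtain ⟨C, hC⟩ := hU.bounded_above_of_compact_support hUc
  have h0 : ∀ x ∉ tsupport U, ⟪U x, crossCoeff r (fderiv ℝ Y x) (fderiv ℝ Z x)⟫ = 0 := fun x hx => by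
    rw [image_eq_zero_of_notMem_tsupport hx, inner_zero_left]
  rw [← integrableOn_iff_integrable_of_support_subset (s := tsupport U)
    (fun x hx => by by_contra h; exact hx (h0 x h))]
  refine Measure.integrableOn_of_bounded (M := C * D) hUc.isCompact.measure_lt_top.ne
    (hU.measurable.inner (measurable_crossCoeff_fderiv r Y Z)).aestronglyMeasurable
    (Eventually.of_forall fun x => ?_)
  refine (norm_inner_le_norm _ _).trans (mul_le_mul (hC x) (hD _ _ ?_ ?_) (norm_nonneg _)
    ((norm_nonneg _).trans (hC x)))
  · exact (norm_fderiv_le_of_lip hY x).trans (le_max_left _ _)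
  · exact (norm_fderiv_le_of_lip hZ x).trans (le_max_right _ _)

/-- Integration by parts for compactly supported Lipschitz maps `ℝⁿ → ℝⁿ⁺¹`. -/
theorem integral_inner_crossCoeff_one (hn : 1 ≤ n) {Y Z : E n → E (n + 1)} {K K' : NNReal}
    (hY : LipschitzWith K Y) (hZ : LipschitzWith K' Z) (hYc : HasCompactSupport Y)
    (hZc : HasCompactSupport Z) :
    ∫ x, ⟪Y x, crossCoeff 1 (fderiv ℝ Y x) (fderiv ℝ Z x)⟫ =
      n * ∫ x, ⟪Z x, crossVec (fderiv ℝ Y x)⟫ := by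
  obtain ⟨a, ha, hac, ha0, t₀, ht₀, ht₀'⟩ := exists_bump
  set b := deriv a with hb
  have hbs : ContDiff ℝ ∞ b := (contDiff_infty_iff_deriv.1 ha).2
  have hbc : HasCompactSupport b := hac.deriv
  have hb's : ContDiff ℝ ∞ (deriv b) := (contDiff_infty_iff_deriv.1 hbs).2
  have had : ∀ t, HasDerivAt a (b t) t := fun t =>
    ((ha.differentiable (by simp)) t).hasDerivAt
  have hbd : ∀ t, HasDerivAt b (deriv b t) t := fun t =>
    ((hbs.differentiable (by simp)) t).hasDerivAt
  set I : ℕ → ℝ := fun r => ∫ x, ⟪Y x, crossCoeff r (fderiv ℝ Y x) (fderiv ℝ Z x)⟫ with hI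
  set J : ℕ → ℝ := fun r => ∫ x, ⟪Z x, crossCoeff r (fderiv ℝ Y x) (fderiv ℝ Z x)⟫ with hJ
  set α : ℕ → ℝ := fun r => ∫ t, b t * (a t ^ (n - r) * b t ^ r) with hα
  set β : ℕ → ℝ := fun r => ∫ t, deriv b t * (a t ^ (n - r) * b t ^ r) with hβ
  have hYI : ∀ r, Integrable fun x => ⟪Y x, crossCoeff r (fderiv ℝ Y x) (fderiv ℝ Z x)⟫ :=
    integrable_inner_crossCoeff hY hZ hY.continuous hYc
  have hZI : ∀ r, Integrable fun x => ⟪Z x, crossCoeff r (fderiv ℝ Y x) (fderiv ℝ Z x)⟫ :=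
    integrable_inner_crossCoeff hY hZ hZ.continuous hZc
  have hαI : ∀ r, Integrable fun t => b t * (a t ^ (n - r) * b t ^ r) := fun r =>
    (hbs.continuous.mul ((ha.continuous.pow _).mul (hbs.continuous.pow _))).integrable_of_hasCompactSupport
      hbc.mul_right
  have hβI : ∀ r, Integrable fun t => deriv b t * (a t ^ (n - r) * b t ^ r) := fun r =>
    (hb's.continuous.mul ((ha.continuous.pow _).mul
      (hbs.continuous.pow _))).integrable_of_hasCompactSupport hbc.deriv.mul_right
  -- The integral of the Jacobian of `η(t, x) = a(t) Y(x) + s a'(t) Z(x)` on `ℝ × ℝⁿ` is zero. By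
  -- Fubini's theorem each power of `s` contributes integrals over `t` (`α`, `β`) times integrals
  -- over `x` (`I`, `J`).
  have key : ∀ s : ℝ, ∑ r ∈ Finset.range (n + 1), s ^ r * (α r * I r) +
      ∑ r ∈ Finset.range (n + 1), s ^ (r + 1) * (β r * J r) = 0 := by
    intro s
    set η : ℝ × E n → E (n + 1) := fun q => a q.1 • Y q.2 + (s * b q.1) • Z q.2 with hη
    have haL : LocallyLipschitz fun q : ℝ × E n => a q.1 :=
      ((ha.of_le (by exact_mod_cast le_top) : ContDiff ℝ 1 a).locallyLipschitz).comp
        LipschitzWith.prod_fst.locallyLipschitz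
    have hbL : LocallyLipschitz fun q : ℝ × E n => s * b q.1 :=
      (((contDiff_const.mul hbs).of_le (by exact_mod_cast le_top) :
        ContDiff ℝ 1 fun t => s * b t).locallyLipschitz).comp LipschitzWith.prod_fst.locallyLipschitz
    have hηL : LocallyLipschitz η :=
      (LocallyLipschitz.smul_vec haL (hY.comp LipschitzWith.prod_snd).locallyLipschitz).add
        (LocallyLipschitz.smul_vec hbL (hZ.comp LipschitzWith.prod_snd).locallyLipschitz)
    have hηc : HasCompactSupport η := by
      refine HasCompactSupport.intro (K := tsupport a ×ˢ (tsupport Y ∪ tsupport Z))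
        (hac.isCompact.prod (hYc.isCompact.union hZc.isCompact)) fun q hq => ?_
      by_cases h1 : q.1 ∈ tsupport a
      · have h2 : q.2 ∉ tsupport Y ∪ tsupport Z := fun h => hq ⟨h1, h⟩
        rw [mem_union, not_or] at h2
        simp [hη, image_eq_zero_of_notMem_tsupport h2.1, image_eq_zero_of_notMem_tsupport h2.2]
      · have h3 : b q.1 = 0 := image_eq_zero_of_notMem_tsupport fun h =>
          h1 (tsupport_deriv_subset h)
        simp [hη, image_eq_zero_of_notMem_tsupport h1, h3]
    set Θ : E (n + 1) →L[ℝ] ℝ × E n := LinearMap.toContinuousLinearMap (consEquiv n).symm.toLinearMap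
    have hΘη : LocallyLipschitz fun q => Θ (η q) := Θ.lipschitz.locallyLipschitz.comp hηL
    have hΘc : HasCompactSupport fun q => Θ (η q) := hηc.comp_left (g := Θ) (map_zero Θ)
    obtain ⟨K₁, hK₁⟩ := LocallyLipschitz.exists_lipschitzWith hΘη hΘc
    haveI : (volume : Measure (ℝ × E n)).IsAddHaarMeasure :=
      inferInstanceAs (Measure.IsAddHaarMeasure ((volume : Measure ℝ).prod (volume : Measure (E n))))
    have hzero := integral_det_fderiv_eq_zero (volume : Measure (ℝ × E n)) hK₁ hΘc
    have hdY : ∀ᵐ q : ℝ × E n, DifferentiableAt ℝ Y q.2 :=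
      (Measure.quasiMeasurePreserving_snd (μ := (volume : Measure ℝ))
        (ν := (volume : Measure (E n)))).ae hY.ae_differentiableAt
    have hdZ : ∀ᵐ q : ℝ × E n, DifferentiableAt ℝ Z q.2 :=
      (Measure.quasiMeasurePreserving_snd (μ := (volume : Measure ℝ))
        (ν := (volume : Measure (E n)))).ae hZ.ae_differentiableAt
    have hdet : ∀ᵐ q : ℝ × E n, (fderiv ℝ (fun q => Θ (η q)) q).det =
        ∑ r ∈ Finset.range (n + 1), (s ^ r * ((b q.1 * (a q.1 ^ (n - r) * b q.1 ^ r)) *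
          ⟪Y q.2, crossCoeff r (fderiv ℝ Y q.2) (fderiv ℝ Z q.2)⟫)) +
        ∑ r ∈ Finset.range (n + 1), (s ^ (r + 1) * ((deriv b q.1 * (a q.1 ^ (n - r) * b q.1 ^ r)) *
          ⟪Z q.2, crossCoeff r (fderiv ℝ Y q.2) (fderiv ℝ Z q.2)⟫)) := by
      filter_upwards [hdY, hdZ] with q hq1 hq2
      obtain ⟨t, x⟩ := q
      simp only at hq1 hq2
      set L := fderiv ℝ Y x with hL
      set M := fderiv ℝ Z x with hM
      set v := b t • Y x + (s * deriv b t) • Z x with hv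
      have h1 : HasFDerivAt (fun q : ℝ × E n => a q.1)
          (b t • ContinuousLinearMap.fst ℝ ℝ (E n)) (t, x) := by
        exact (had t).comp_hasFDerivAt (t, x) hasFDerivAt_fst
      have h2 : HasFDerivAt (fun q : ℝ × E n => s * b q.1)
          ((s * deriv b t) • ContinuousLinearMap.fst ℝ ℝ (E n)) (t, x) := by
        have h20 : HasFDerivAt (fun q : ℝ × E n => b q.1)
            (deriv b t • ContinuousLinearMap.fst ℝ ℝ (E n)) (t, x) :=
          HasDerivAt.comp_hasFDerivAt (h₂ := b) (t, x) (hbd t)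
            (hasFDerivAt_fst : HasFDerivAt (Prod.fst : ℝ × E n → ℝ) _ (t, x))
        rw [← smul_smul]
        exact h20.const_mul s
      have h3 : HasFDerivAt (fun q : ℝ × E n => Y q.2)
          (L ∘L ContinuousLinearMap.snd ℝ ℝ (E n)) (t, x) :=
        hq1.hasFDerivAt.comp (t, x) hasFDerivAt_snd
      have h4 : HasFDerivAt (fun q : ℝ × E n => Z q.2)
          (M ∘L ContinuousLinearMap.snd ℝ ℝ (E n)) (t, x) :=
        hq2.hasFDerivAt.comp (t, x) hasFDerivAt_snd
      have h5 := (h1.smul h3).add (h2.smul h4)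
      have h50 : HasFDerivAt η _ (t, x) := h5
      have h51 : HasFDerivAt (fun q => Θ (η q)) _ (t, x) := Θ.hasFDerivAt.comp (t, x) h50
      have h6 : ∀ τ y, fderiv ℝ (fun q => Θ (η q)) (t, x) (τ, y) =
          Θ (τ • v + (a t • L + s • (b t • M)) y) := by
        intro τ y
        rw [h51.fderiv, ContinuousLinearMap.comp_apply]
        congr 1
        simp [hv, smul_smul, smul_add]
        module
      have h7 : ((fderiv ℝ (fun q => Θ (η q)) (t, x) : ℝ × E n →L[ℝ] ℝ × E n) :
          ℝ × E n →ₗ[ℝ] ℝ × E n) =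
          (consEquiv n).symm.toLinearMap ∘ₗ (LinearMap.coprod (LinearMap.toSpanSingleton ℝ (E (n + 1)) v)
            ((a t • L + s • (b t • M) : E n →L[ℝ] E (n + 1)) : E n →ₗ[ℝ] E (n + 1))) :=
        LinearMap.ext fun q => h6 q.1 q.2
      rw [ContinuousLinearMap.det]
      rw [h7, det_consEquiv_symm_comp, crossVec_add_smul, inner_sum, ← Finset.sum_add_distrib]
      refine Finset.sum_congr rfl fun r _ => ?_
      rw [inner_smul_right, crossCoeff_smul_smul, inner_smul_right, hv, inner_add_left,
        inner_smul_left, inner_smul_left]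
      simp only [conj_trivial]
      ring
    rw [integral_congr_ae hdet] at hzero
    have hint1 : ∀ r, Integrable fun q : ℝ × E n => (s ^ r * ((b q.1 * (a q.1 ^ (n - r) * b q.1 ^ r)) *
          ⟪Y q.2, crossCoeff r (fderiv ℝ Y q.2) (fderiv ℝ Z q.2)⟫)) := fun r =>
      ((hαI r).mul_prod (hYI r)).const_mul _
    have hint2 : ∀ r, Integrable fun q : ℝ × E n =>
        (s ^ (r + 1) * ((deriv b q.1 * (a q.1 ^ (n - r) * b q.1 ^ r)) *
          ⟪Z q.2, crossCoeff r (fderiv ℝ Y q.2) (fderiv ℝ Z q.2)⟫)) := fun r =>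
      ((hβI r).mul_prod (hZI r)).const_mul _
    rw [integral_add (integrable_finsetSum _ fun r _ => hint1 r)
      (integrable_finsetSum _ fun r _ => hint2 r), integral_finsetSum _ fun r _ => hint1 r,
      integral_finsetSum _ fun r _ => hint2 r] at hzero
    rw [← hzero]
    congr 1 <;> refine Finset.sum_congr rfl fun r _ => ?_
    · rw [integral_const_mul]
      congr 1
      exact (integral_prod_mul (fun t => b t * (a t ^ (n - r) * b t ^ r))
        fun x => ⟪Y x, crossCoeff r (fderiv ℝ Y x) (fderiv ℝ Z x)⟫).symm
    · rw [integral_const_mul]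
      congr 1
      exact (integral_prod_mul (fun t => deriv b t * (a t ^ (n - r) * b t ^ r))
        fun x => ⟪Z x, crossCoeff r (fderiv ℝ Y x) (fderiv ℝ Z x)⟫).symm
  -- The coefficient of `s¹` reads `α₁ I₁ + β₀ J₀ = 0`.
  have hc := eq_zero_of_forall_sum_pow_smul_eq_zero (W := ℝ) (N := n + 2)
    (a := fun r => (if r < n + 1 then α r * I r else 0) +
      (if r = 0 then 0 else β (r - 1) * J (r - 1))) (r := 1) (fun s => by
      refine Eq.trans ?_ (key s)
      simp only [smul_add, Finset.sum_add_distrib]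
      congr 1
      · rw [Finset.sum_range_succ, if_neg (lt_irrefl _), smul_zero, add_zero]
        refine Finset.sum_congr rfl fun r hr => ?_
        rw [if_pos (Finset.mem_range.1 hr), smul_eq_mul]
      · rw [Finset.sum_range_succ', if_pos rfl, smul_zero, add_zero]
        refine Finset.sum_congr rfl fun r hr => ?_
        rw [if_neg (Nat.succ_ne_zero r), smul_eq_mul, Nat.add_sub_cancel]) (by omega)
  rw [if_pos (by omega), if_neg one_ne_zero] at hc
  have hα1 : α 1 = ∫ t, a t ^ (n - 1) * b t ^ 2 := by
    rw [hα]
    exact integral_congr_ae (Eventually.of_forall fun t => by ring)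
  -- Integration by parts on the line: `∫ aⁿ a'' = -n ∫ aⁿ⁻¹ (a')²`. Together with `α₁ > 0` this
  -- turns the relation into `I₁ = n J₀`.
  have hβ0 : β 0 = -(n * α 1) := by
    have hpow : ∀ t, HasDerivAt (fun t => a t ^ n) (n * a t ^ (n - 1) * b t) t := fun t => (had t).pow n
    have h1 := integral_mul_deriv_eq_deriv_mul_of_integrable (u := fun t => a t ^ n) (v := b)
      (u' := fun t => n * a t ^ (n - 1) * b t) (v' := deriv b) (fun t _ => hpow t) (fun t _ => hbd t)
      (by simpa [Pi.mul_def, mul_comm] using hβI 0)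
      (by
        refine Continuous.integrable_of_hasCompactSupport ?_ hbc.mul_left
        exact (((continuous_const.mul (ha.continuous.pow _)).mul hbs.continuous).mul hbs.continuous))
      (by
        refine Continuous.integrable_of_hasCompactSupport ?_ hbc.mul_left
        exact ((ha.continuous.pow _).mul hbs.continuous))
    have h2 : β 0 = ∫ t, a t ^ n * deriv b t := by
      rw [hβ]
      exact integral_congr_ae (Eventually.of_forall fun t => by simp [mul_comm])
    rw [h2, h1, hα1, ← integral_const_mul]
    congr 1
    exact integral_congr_ae (Eventually.of_forall fun t => by ring)
  have hαpos : 0 < α 1 := by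
    rw [hα1]
    refine (integral_pos_iff_support_of_nonneg (fun t => mul_nonneg (pow_nonneg (ha0 t) _) (sq_nonneg _)) ?_).2 ?_
    · have := hαI 1
      refine this.congr (Eventually.of_forall fun t => by ring)
    · refine IsOpen.measure_pos _ ?_ ⟨t₀, ?_⟩
      · exact ((ha.continuous.pow _).mul (hbs.continuous.pow _)).isOpen_support
      · exact (mul_pos (pow_pos ht₀ _) (by positivity)).ne'
  have hfin : α 1 * (I 1 - n * J 0) = 0 := by
    rw [hβ0] at hc
    linarith
  have h0 : I 1 = n * J 0 := by
    rcases mul_eq_zero.1 hfin with h | h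
    · exact absurd h hαpos.ne'
    · linarith
  rw [hI, hJ] at h0
  simpa only [crossCoeff_zero] using h0

end FlatParts

/-! ### Products of a semidefinite and a symmetric matrix; anisotropic principal curvatures -/

section Spectral

variable {n : ℕ}

-- Write `A = Cᵀ C`. Then `Cᵀ (C W)` and the symmetric matrix `Q = C W Cᵀ` have the same
-- characteristic determinant and trace, so the eigenvalues are real. If they all equal `c ≠ 0`,
-- then `Q = c • 1`, which makes `C` invertible and gives `A W = c • 1`. For `c = 0` this fails: `A
-- W` can be a nonzero nilpotent matrix.
open Matrix in
theorem exists_real_eigenvalues {A W : Matrix (Fin n) (Fin n) ℝ} (hA : A.PosSemidef)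
    (hW : Wᵀ = W) : ∃ k : Fin n → ℝ, (∀ ε : ℝ, (1 - ε • (A * W)).det = ∏ i, (1 - ε * k i)) ∧
      (A * W).trace = ∑ i, k i ∧ ∀ c ≠ 0, (∀ i, k i = c) → A * W = c • 1 := by
  obtain ⟨C, rfl⟩ : ∃ C : Matrix (Fin n) (Fin n) ℝ, A = Cᵀ * C := by
    open scoped MatrixOrder in
    obtain ⟨C, hC⟩ := CStarAlgebra.nonneg_iff_eq_star_mul_self.1 (Matrix.nonneg_iff_posSemidef.2 hA)
    exact ⟨C, hC⟩
  set Q := C * W * Cᵀ with hQdef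
  have hQ : Q.IsHermitian := by
    rw [Matrix.IsHermitian, Matrix.conjTranspose_eq_transpose_of_trivial]
    simp [Q, Matrix.transpose_mul, hW, Matrix.mul_assoc]
  have hdiag : ∀ c, (∀ i, hQ.eigenvalues i = c) → Q = c • 1 := by
    intro c hc
    have h := hQ.spectral_theorem
    have h2 : Matrix.diagonal (RCLike.ofReal ∘ hQ.eigenvalues) = (c • 1 : Matrix (Fin n) (Fin n) ℝ) := by
      ext i j
      by_cases hij : i = j <;> simp [Matrix.diagonal_apply, hij, hc, Matrix.one_apply]
    rw [h2, Unitary.conjStarAlgAut_apply, Matrix.mul_smul, Matrix.mul_one, Matrix.smul_mul] at h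
    rw [h]
    congr 1
    exact Unitary.coe_mul_star_self _
  refine ⟨hQ.eigenvalues, fun ε => ?_, ?_, fun c hc0 hc => ?_⟩
  · have h1 : (1 - ε • (Cᵀ * C * W)).det = (1 - ε • Q).det := by
      have := Matrix.det_one_sub_mul_comm Cᵀ (ε • (C * W))
      simp only [Matrix.mul_smul, Matrix.smul_mul] at this
      rw [Matrix.mul_assoc, this]
    rw [h1]
    rcases eq_or_ne ε 0 with rfl | hε
    · simp
    · have h2 := congrArg (Polynomial.eval ε⁻¹) hQ.charpoly_eq
      rw [Matrix.eval_charpoly, Polynomial.eval_prod] at h2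
      have h3 : 1 - ε • Q = ε • (Matrix.scalar (Fin n) ε⁻¹ - Q) := by
        rw [smul_sub]
        congr 1
        ext i j
        by_cases hij : i = j <;> simp [Matrix.scalar_apply, hij, hε, Matrix.one_apply, Matrix.diagonal_apply]
      rw [h3, Matrix.det_smul, h2, Fintype.card_fin]
      simp only [Polynomial.eval_sub, Polynomial.eval_X, Polynomial.eval_C]
      have : ∏ i : Fin n, (1 - ε * hQ.eigenvalues i) = ∏ i : Fin n, ε * (ε⁻¹ - hQ.eigenvalues i) := by
        refine Finset.prod_congr rfl fun i _ => ?_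
        rw [mul_sub, mul_inv_cancel₀ hε]
      rw [this, Finset.prod_mul_distrib, Finset.prod_const, Finset.card_univ, Fintype.card_fin]
      rfl
  · have h1 : (Cᵀ * C * W).trace = Q.trace := by
      rw [Matrix.mul_assoc, Matrix.trace_mul_comm]
    rw [h1, hQ.trace_eq_sum_eigenvalues]
    rfl
  · have hQc := hdiag c hc
    have h1 : (C * W) * (c⁻¹ • Cᵀ) = 1 := by
      rw [Matrix.mul_smul, ← hQdef, hQc, smul_smul, inv_mul_cancel₀ hc0, one_smul]
    have h2 : (c⁻¹ • Cᵀ) * (C * W) = 1 := mul_eq_one_comm.1 h1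
    rw [Matrix.smul_mul, ← Matrix.mul_assoc] at h2
    rw [← h2, smul_smul, mul_inv_cancel₀ hc0, one_smul]

theorem leftInv_apply {L : E n →L[ℝ] E (n + 1)} (hL : Function.Injective L) (u : E n) :
    leftInv L (L u) = u := by
  set g : E n →L[ℝ] E n := ContinuousLinearMap.adjoint L ∘L L
  have hg : Function.Injective (g : E n →ₗ[ℝ] E n) := by
    rw [injective_iff_map_eq_zero]
    intro v hv
    have : ⟪L v, L v⟫ = 0 := by
      rw [← ContinuousLinearMap.adjoint_inner_right]
      have h : ContinuousLinearMap.adjoint L (L v) = 0 := hv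
      rw [h, inner_zero_right]
    exact hL (by rw [inner_self_eq_zero.1 this, map_zero])
  set ge : E n ≃L[ℝ] E n := (LinearEquiv.ofInjectiveEndo (g : E n →ₗ[ℝ] E n) hg).toContinuousLinearEquiv
  have hge : (ge : E n →L[ℝ] E n) = g := by ext; rfl
  have : leftInv L (L u) = g.inverse (g u) := rfl
  rw [this, ← hge, ContinuousLinearMap.inverse_equiv]
  exact ge.symm_apply_apply u

/-- If `A` is symmetric and positive semidefinite, and `B` is the differential of a unit normal field
along an immersion with differential `L`, then `-A ∘ B = L ∘ S` where `S` has real eigenvalues. -/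
theorem exists_principal {L : E n →L[ℝ] E (n + 1)} (hL : Function.Injective L) {N : E (n + 1)}
    (hN : ‖N‖ = 1) (hNL : ∀ u, ⟪N, L u⟫ = 0) {A : E (n + 1) →L[ℝ] E (n + 1)}
    (hAs : ∀ x y, ⟪A x, y⟫ = ⟪x, A y⟫) (hAp : ∀ x, 0 ≤ ⟪A x, x⟫) (hAN : A N = 0)
    {B : E n →L[ℝ] E (n + 1)} (hBN : ∀ v, ⟪N, B v⟫ = 0) (hB : ∀ u v, ⟪L u, B v⟫ = ⟪L v, B u⟫) :
    ∃ (T : E n →L[ℝ] E n) (k : Fin n → ℝ), A ∘L B = -(L ∘L T) ∧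
      (∀ ε : ℝ, (1 - ε • T).det = ∏ i, (1 - ε * k i)) ∧
      LinearMap.trace ℝ (E n) (T : E n →ₗ[ℝ] E n) = ∑ i, k i ∧
      ∀ c ≠ 0, (∀ i, k i = c) → T = c • 1 := by
  set R := LinearMap.range (L : E n →ₗ[ℝ] E (n + 1)) with hR
  have hrank : Module.finrank ℝ R = n := by
    rw [LinearMap.finrank_range_of_inj hL, finrank_euclideanSpace_fin]
  have hperp : ∀ w : E (n + 1), ⟪N, w⟫ = 0 → w ∈ R := by
    have hN0 : N ≠ 0 := fun h => by rw [h, norm_zero] at hN; exact zero_ne_one hN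
    have hle : R ≤ (ℝ ∙ N)ᗮ := by
      rintro _ ⟨u, rfl⟩
      rw [Submodule.mem_orthogonal_singleton_iff_inner_right]
      exact hNL u
    have heq : R = (ℝ ∙ N)ᗮ := by
      apply Submodule.eq_of_le_of_finrank_eq hle
      haveI : Fact (Module.finrank ℝ (E (n + 1)) = n + 1) := ⟨finrank_euclideanSpace_fin⟩
      rw [hrank, Submodule.finrank_orthogonal_span_singleton (n := n) hN0]
    intro w hw
    rw [heq, Submodule.mem_orthogonal_singleton_iff_inner_right]
    exact hw
  let b : OrthonormalBasis (Fin n) ℝ R := (stdOrthonormalBasis ℝ R).reindex (finCongr hrank)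
  have hexp : ∀ w ∈ R, w = ∑ i, ⟪(b i : E (n + 1)), w⟫ • (b i : E (n + 1)) := by
    intro w hw
    have := b.sum_repr' ⟨w, hw⟩
    have h2 := congrArg (fun x : R => (x : E (n + 1))) this
    simp only [Submodule.coe_sum, Submodule.coe_smul, Submodule.coe_inner] at h2
    exact h2.symm
  let Le : E n ≃ₗ[ℝ] R := LinearEquiv.ofInjective (L : E n →ₗ[ℝ] E (n + 1)) hL
  let t : Module.Basis (Fin n) ℝ (E n) := b.toBasis.map Le.symm
  have ht : ∀ i, L (t i) = b i := by
    intro i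
    have : Le (t i) = b i := by simp [t]
    exact congrArg (fun x : R => (x : E (n + 1))) this
  -- The orthonormal basis `b` of the image of `L` is pulled back to the basis `t` of the domain.
  -- The image of `L` is all of `N^⊥` and contains the range of `B`, so `-A ∘ B` has the matrix `A'
  -- W'`; the symmetry of `W'` is that of the second fundamental form.
  set A' : Matrix (Fin n) (Fin n) ℝ := Matrix.of fun i l => ⟪A (b i), (b l : E (n + 1))⟫ with hA'
  set W' : Matrix (Fin n) (Fin n) ℝ := Matrix.of fun l j => -⟪(b l : E (n + 1)), B (t j)⟫ with hW'
  have hA'p : A'.PosSemidef := by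
    refine Matrix.PosSemidef.of_dotProduct_mulVec_nonneg ?_ fun x => ?_
    · ext i j
      simp only [Matrix.conjTranspose_apply, hA', Matrix.of_apply, star_trivial]
      rw [hAs, real_inner_comm]
    · have h := hAp (∑ i, x i • (b i : E (n + 1)))
      rw [map_sum, sum_inner] at h
      refine h.trans_eq ?_
      simp only [dotProduct, Matrix.mulVec, star_trivial, hA', Matrix.of_apply]
      refine Finset.sum_congr rfl fun i _ => ?_
      rw [map_smul, inner_smul_left, inner_sum]
      simp only [conj_trivial]
      congr 1
      refine Finset.sum_congr rfl fun j _ => ?_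
      rw [inner_smul_right, mul_comm]
  have hW's : W'.transpose = W' := by
    ext i j
    simp only [Matrix.transpose_apply, hW', Matrix.of_apply]
    rw [← ht, ← ht, hB]
  obtain ⟨k, hk1, hk2, hk3⟩ := exists_real_eigenvalues hA'p hW's
  set Tl : E n →ₗ[ℝ] E n := Matrix.toLin t t (A' * W') with hTl
  set T : E n →L[ℝ] E n := LinearMap.toContinuousLinearMap Tl with hT
  have hTcoe : (T : E n →ₗ[ℝ] E n) = Tl := rfl
  have hmain : ∀ j, A (B (t j)) = -L (T (t j)) := by
    intro j
    have h1 : T (t j) = ∑ i, (A' * W') i j • t i := Matrix.toLin_self t t _ j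
    rw [h1, map_sum]
    have h2 : A (B (t j)) ∈ R := hperp _ (by rw [← hAs, hAN, inner_zero_left])
    rw [hexp _ h2, ← Finset.sum_neg_distrib]
    refine Finset.sum_congr rfl fun i _ => ?_
    rw [map_smul, ht, ← neg_smul]
    congr 1
    rw [← hAs, hexp _ (hperp _ (hBN (t j))), inner_sum, Matrix.mul_apply, ← Finset.sum_neg_distrib]
    refine Finset.sum_congr rfl fun l _ => ?_
    simp only [hA', hW', Matrix.of_apply]
    rw [inner_smul_right]
    ring
  refine ⟨T, k, ?_, fun ε => ?_, ?_, fun c hc0 hc => ?_⟩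
  · have : ((A ∘L B : E n →L[ℝ] E (n + 1)) : E n →ₗ[ℝ] E (n + 1)) =
        ((-(L ∘L T) : E n →L[ℝ] E (n + 1)) : E n →ₗ[ℝ] E (n + 1)) :=
      t.ext fun j => by simpa using hmain j
    exact ContinuousLinearMap.coe_injective this
  · rw [← hk1 ε, ContinuousLinearMap.det, ← LinearMap.det_toMatrix t]
    congr 1
    have : ((1 - ε • T : E n →L[ℝ] E n) : E n →ₗ[ℝ] E n) = LinearMap.id - ε • Tl := rfl
    rw [this, map_sub, map_smul, LinearMap.toMatrix_id, hTl, LinearMap.toMatrix_toLin]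
  · rw [← hk2, hTcoe, LinearMap.trace_eq_matrix_trace ℝ t, hTl, LinearMap.toMatrix_toLin]
  · have h1 := hk3 c hc0 hc
    have : (T : E n →ₗ[ℝ] E n) = ((c • 1 : E n →L[ℝ] E n) : E n →ₗ[ℝ] E n) := by
      rw [hTcoe, hTl, h1, map_smul, Matrix.toLin_one]
      rfl
    exact ContinuousLinearMap.coe_injective this

/-- The complex roots of the characteristic polynomial sum to the trace, which is real. -/
theorem meanCurvature_one {M : Type*} [TopologicalSpace M] [ChartedSpace (E n) M] (γ : S n → ℝ)
    (X : M → E (n + 1)) (p : M) :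
    meanCurvature γ X 1 p = LinearMap.trace ℝ (E n) (shapeOp γ X p) / n := by
  rw [meanCurvature, principalCurvatures, Nat.choose_one_right]
  congr 1
  set T := shapeOp γ X p
  let b := Module.finBasis ℝ (E n)
  have h1 : T.charpoly = (LinearMap.toMatrix b b T).charpoly := (LinearMap.charpoly_toMatrix T b).symm
  rw [h1, ← Matrix.charpoly_map, Multiset.esymm, Multiset.powersetCard_one]
  simp only [Multiset.map_map, Function.comp_def, Multiset.prod_singleton, Multiset.map_id']
  have h2 := Matrix.trace_eq_sum_roots_charpoly ((LinearMap.toMatrix b b T).map (algebraMap ℝ ℂ))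
  rw [← h2, LinearMap.trace_eq_matrix_trace ℝ b]
  simp [Matrix.trace]

end Spectral

/-! ### The integrand: homogeneous extension, supporting vectors and the Wulff shape -/

section Integrand

variable {n : ℕ} {γ : S n → ℝ}

/-- The gradient of the homogeneous extension of `γ`. -/
def homogGrad (γ : S n → ℝ) (x : E (n + 1)) : E (n + 1) := gradient (homogExt γ) x

theorem radialExt_coe (ν : S n) : radialExt γ (ν : E (n + 1)) = γ ν := by
  have h1 : ‖(ν : E (n + 1))‖ = 1 := norm_eq_of_mem_sphere ν
  have h0 : (ν : E (n + 1)) ≠ 0 := fun h => by rw [h, norm_zero] at h1; exact zero_ne_one h1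
  rw [radialExt, dif_pos h0]
  congr 1
  ext1
  simp [h1]

theorem homogExt_coe (ν : S n) : homogExt γ (ν : E (n + 1)) = γ ν := by
  rw [homogExt, radialExt_coe, norm_eq_of_mem_sphere ν, one_mul]

theorem homogExt_zero : homogExt γ 0 = 0 := by simp [homogExt]

theorem radialExt_smul {t : ℝ} (ht : 0 < t) (x : E (n + 1)) : radialExt γ (t • x) = radialExt γ x := by
  rcases eq_or_ne x 0 with rfl | hx
  · simp
  · rw [radialExt, radialExt, dif_pos hx, dif_pos (smul_ne_zero ht.ne' hx)]
    congr 1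
    ext1
    show ‖t • x‖⁻¹ • t • x = ‖x‖⁻¹ • x
    rw [norm_smul, Real.norm_of_nonneg ht.le, smul_smul, mul_inv]
    congr 1
    field_simp

theorem homogExt_smul {t : ℝ} (ht : 0 ≤ t) (x : E (n + 1)) : homogExt γ (t • x) = t * homogExt γ x := by
  rcases ht.eq_or_lt with rfl | ht
  · simp [homogExt_zero]
  · rw [homogExt, radialExt_smul ht, norm_smul, Real.norm_of_nonneg ht.le, mul_assoc, homogExt]

theorem homogExt_pos (hpos : ∀ ν, 0 < γ ν) {x : E (n + 1)} (hx : x ≠ 0) : 0 < homogExt γ x := by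
  rw [homogExt, radialExt, dif_pos hx]
  exact mul_pos (norm_pos_iff.2 hx) (hpos _)

theorem contDiffAt_radialExt (hC2 : ContMDiff (𝓡 n) 𝓘(ℝ, ℝ) 2 γ) {x : E (n + 1)} (hx : x ≠ 0) :
    ContDiffAt ℝ 2 (radialExt γ) x := by
  let U : TopologicalSpace.Opens (E (n + 1)) := ⟨{0}ᶜ, isOpen_compl_singleton⟩
  have hf : ContMDiff 𝓘(ℝ, E (n + 1)) 𝓘(ℝ, E (n + 1)) 2 fun y : U => ‖(y : E (n + 1))‖⁻¹ • (y : E (n + 1)) := by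
    intro y
    refine (contMDiffAt_subtype_iff (U := U) (f := fun y : E (n + 1) => ‖y‖⁻¹ • y)).2 ?_
    rw [contMDiffAt_iff_contDiffAt]
    have hy : (y : E (n + 1)) ≠ 0 := y.2
    exact ((contDiffAt_norm ℝ hy).inv (norm_ne_zero_iff.2 hy)).smul contDiffAt_id
  have hs : ∀ y : U, ‖(y : E (n + 1))‖⁻¹ • (y : E (n + 1)) ∈ sphere (0 : E (n + 1)) 1 := by
    intro y
    have hy : (y : E (n + 1)) ≠ 0 := y.2
    rw [mem_sphere_zero_iff_norm]
    exact norm_smul_inv_norm hy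
  haveI : Fact (Module.finrank ℝ (E (n + 1)) = n + 1) := ⟨finrank_euclideanSpace_fin⟩
  have hg := hC2.comp (ContMDiff.codRestrict_sphere (n := n) hf hs)
  have h1 := hg ⟨x, hx⟩
  rw [← contMDiffAt_iff_contDiffAt]
  refine (contMDiffAt_subtype_iff (U := U) (x := ⟨x, hx⟩) (f := radialExt γ)).1 ?_
  refine h1.congr_of_eventuallyEq (Eventually.of_forall fun y => ?_)
  have hy : (y : E (n + 1)) ≠ 0 := y.2
  exact dif_pos hy

theorem contDiffAt_homogExt (hC2 : ContMDiff (𝓡 n) 𝓘(ℝ, ℝ) 2 γ) {x : E (n + 1)} (hx : x ≠ 0) :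
    ContDiffAt ℝ 2 (homogExt γ) x :=
  (contDiffAt_norm ℝ hx).mul (contDiffAt_radialExt hC2 hx)

theorem differentiableAt_homogExt (hC2 : ContMDiff (𝓡 n) 𝓘(ℝ, ℝ) 2 γ) {x : E (n + 1)} (hx : x ≠ 0) :
    DifferentiableAt ℝ (homogExt γ) x :=
  (contDiffAt_homogExt hC2 hx).differentiableAt (by norm_num)

theorem fderiv_homogExt_apply (x v : E (n + 1)) :
    fderiv ℝ (homogExt γ) x v = ⟪homogGrad γ x, v⟫ := by
  have h := InnerProductSpace.toDual_symm_apply (𝕜 := ℝ) (E := E (n + 1)) (x := v)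
    (y := fderiv ℝ (homogExt γ) x)
  exact h.symm

theorem hasDerivAt_homogExt_line (hC2 : ContMDiff (𝓡 n) 𝓘(ℝ, ℝ) 2 γ) {x : E (n + 1)} (hx : x ≠ 0)
    (v : E (n + 1)) : HasDerivAt (fun t : ℝ => homogExt γ (x + t • v)) ⟪homogGrad γ x, v⟫ 0 := by
  have h := (differentiableAt_homogExt hC2 hx).hasFDerivAt
  have hl : HasDerivAt (fun t : ℝ => x + t • v) v 0 := by
    simpa using ((hasDerivAt_id (0 : ℝ)).smul_const v).const_add x
  rw [← fderiv_homogExt_apply]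
  have h' : HasFDerivAt (homogExt γ) (fderiv ℝ (homogExt γ) x) (x + (0 : ℝ) • v) := by
    rw [zero_smul, add_zero]; exact h
  exact h'.comp_hasDerivAt 0 hl

/-- Euler's relation for a function that is homogeneous of degree one. -/
theorem inner_homogGrad_self (hC2 : ContMDiff (𝓡 n) 𝓘(ℝ, ℝ) 2 γ) {x : E (n + 1)} (hx : x ≠ 0) :
    ⟪homogGrad γ x, x⟫ = homogExt γ x := by
  have h1 := hasDerivAt_homogExt_line hC2 hx x
  have h2 : HasDerivAt (fun t : ℝ => homogExt γ (x + t • x)) (homogExt γ x) 0 := by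
    have h3 : HasDerivAt (fun t : ℝ => (1 + t) * homogExt γ x) (homogExt γ x) 0 := by
      simpa using ((hasDerivAt_id (0 : ℝ)).const_add 1).mul_const (homogExt γ x)
    refine h3.congr_of_eventuallyEq ?_
    filter_upwards [lt_mem_nhds (show (-1 : ℝ) < 0 by norm_num)] with t ht
    rw [← homogExt_smul (by linarith), add_smul, one_smul]
  exact h1.unique h2

theorem homogExt_add_le (hconv : IsConvexIntegrand γ) (x y : E (n + 1)) :
    homogExt γ (x + y) ≤ homogExt γ x + homogExt γ y := by
  have h := hconv.2 (mem_univ x) (mem_univ y) (by norm_num : (0 : ℝ) ≤ 1 / 2)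
    (by norm_num : (0 : ℝ) ≤ 1 / 2) (by norm_num)
  rw [← smul_add, homogExt_smul (by norm_num)] at h
  simp only [smul_eq_mul] at h
  linarith

/-- A convex function that is homogeneous of degree one is subadditive; this bounds the difference
quotients at `x` in the direction `y`. The gradient thus supports the function globally. -/
theorem inner_homogGrad_le (hC2 : ContMDiff (𝓡 n) 𝓘(ℝ, ℝ) 2 γ) (hconv : IsConvexIntegrand γ)
    {x : E (n + 1)} (hx : x ≠ 0) (y : E (n + 1)) : ⟪homogGrad γ x, y⟫ ≤ homogExt γ y := by
  have h := (hasDerivAt_homogExt_line hC2 hx y).tendsto_slope_zero_right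
  refine le_of_tendsto h ?_
  filter_upwards [self_mem_nhdsWithin] with t ht
  have ht0 : (0 : ℝ) < t := ht
  have h1 := homogExt_add_le hconv x (t • y)
  rw [homogExt_smul ht0.le] at h1
  simp only [zero_add, zero_smul, add_zero, smul_eq_mul]
  rw [inv_mul_le_iff₀ ht0]
  linarith

/-- The function `homogExt γ - ⟪w, ·⟫` is nonnegative and vanishes at `y`, so its derivative
vanishes there. Uniqueness of the supporting vector needs only differentiability, not strict
convexity. It glues `ξ` across the edges and gives the strict inequalities in the covering argument.
-/
theorem eq_homogGrad_of_inner_eq (hC2 : ContMDiff (𝓡 n) 𝓘(ℝ, ℝ) 2 γ) {w y : E (n + 1)}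
    (hw : ∀ z, ⟪w, z⟫ ≤ homogExt γ z) (hy : y ≠ 0) (h : ⟪w, y⟫ = homogExt γ y) :
    homogGrad γ y = w := by
  have hmin : IsLocalMin (fun z => homogExt γ z - ⟪w, z⟫) y := Eventually.of_forall fun z => by
    simp only [h, sub_self]
    exact sub_nonneg.2 (hw z)
  have hd := hmin.hasFDerivAt_eq_zero ((differentiableAt_homogExt hC2 hy).hasFDerivAt.sub
    (innerSL ℝ w).hasFDerivAt)
  refine ext_inner_right ℝ fun v => ?_
  have h2 := congrArg (fun f : E (n + 1) →L[ℝ] ℝ => f v) hd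
  simp only [sub_apply, zero_apply, innerSL_apply_apply] at h2
  rw [fderiv_homogExt_apply] at h2
  linarith

theorem homogGrad_smul (hC2 : ContMDiff (𝓡 n) 𝓘(ℝ, ℝ) 2 γ) (hconv : IsConvexIntegrand γ)
    {x : E (n + 1)} (hx : x ≠ 0) {t : ℝ} (ht : 0 < t) : homogGrad γ (t • x) = homogGrad γ x := by
  refine eq_homogGrad_of_inner_eq hC2 (inner_homogGrad_le hC2 hconv hx) (smul_ne_zero ht.ne' hx) ?_
  rw [inner_smul_right, inner_homogGrad_self hC2 hx, homogExt_smul ht.le]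

theorem contDiffAt_homogGrad (hC2 : ContMDiff (𝓡 n) 𝓘(ℝ, ℝ) 2 γ) {x : E (n + 1)} (hx : x ≠ 0) :
    ContDiffAt ℝ 1 (homogGrad γ) x := by
  have h1 : ContDiffAt ℝ 1 (fderiv ℝ (homogExt γ)) x :=
    (contDiffAt_homogExt hC2 hx).fderiv_right (by norm_num)
  exact ((InnerProductSpace.toDual ℝ (E (n + 1))).symm.toContinuousLinearEquiv.contDiff.contDiffAt).comp x h1

theorem hasFDerivAt_homogGrad (hC2 : ContMDiff (𝓡 n) 𝓘(ℝ, ℝ) 2 γ) {x : E (n + 1)} (hx : x ≠ 0) :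
    HasFDerivAt (homogGrad γ) (fderiv ℝ (homogGrad γ) x) x :=
  ((contDiffAt_homogGrad hC2 hx).differentiableAt (by norm_num)).hasFDerivAt

theorem fderiv_homogGrad_symm (hC2 : ContMDiff (𝓡 n) 𝓘(ℝ, ℝ) 2 γ) {x : E (n + 1)} (hx : x ≠ 0)
    (u v : E (n + 1)) :
    ⟪fderiv ℝ (homogGrad γ) x u, v⟫ = ⟪u, fderiv ℝ (homogGrad γ) x v⟫ := by
  have key : ∀ u v, fderiv ℝ (fderiv ℝ (homogExt γ)) x u v = ⟪fderiv ℝ (homogGrad γ) x u, v⟫ := by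
    intro u v
    have h1 : HasFDerivAt (fun y => fderiv ℝ (homogExt γ) y v)
        ((innerSL ℝ).flip v ∘L fderiv ℝ (homogGrad γ) x) x := by
      have h2 := ((innerSL ℝ).flip v).hasFDerivAt.comp x (hasFDerivAt_homogGrad hC2 hx)
      refine h2.congr_of_eventuallyEq (Eventually.of_forall fun y => ?_)
      show fderiv ℝ (homogExt γ) y v = (innerSL ℝ).flip v (homogGrad γ y)
      rw [fderiv_homogExt_apply, ContinuousLinearMap.flip_apply, innerSL_apply_apply]
    have h3 : DifferentiableAt ℝ (fderiv ℝ (homogExt γ)) x :=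
      ((contDiffAt_homogExt hC2 hx).fderiv_right (m := 1) (by norm_num)).differentiableAt (by norm_num)
    have h4 := (h3.hasFDerivAt.clm_apply (hasFDerivAt_const v x)).unique h1
    have h5 := congrArg (fun f : E (n + 1) →L[ℝ] ℝ => f u) h4
    simp only [add_apply, ContinuousLinearMap.comp_apply, ContinuousLinearMap.flip_apply,
      zero_apply, map_zero, zero_add, innerSL_apply_apply] at h5
    exact h5
  have hs := (contDiffAt_homogExt hC2 hx).isSymmSndFDerivAt (by simp)
  rw [← key, hs u v, key, real_inner_comm]

/-- Monotonicity of the gradient, from the support inequalities at `x` and at `x + t u`. -/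
theorem fderiv_homogGrad_nonneg (hC2 : ContMDiff (𝓡 n) 𝓘(ℝ, ℝ) 2 γ) (hconv : IsConvexIntegrand γ)
    {x : E (n + 1)} (hx : x ≠ 0) (u : E (n + 1)) : 0 ≤ ⟪fderiv ℝ (homogGrad γ) x u, u⟫ := by
  have hl : HasDerivAt (fun t : ℝ => x + t • u) u 0 := by
    simpa using ((hasDerivAt_id (0 : ℝ)).smul_const u).const_add x
  have h1 : HasDerivAt (fun t : ℝ => homogGrad γ (x + t • u)) (fderiv ℝ (homogGrad γ) x u) 0 := by
    refine HasFDerivAt.comp_hasDerivAt (0 : ℝ) ?_ hl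
    rw [zero_smul, add_zero]
    exact hasFDerivAt_homogGrad hC2 hx
  have h2 : HasDerivAt (fun t : ℝ => ⟪homogGrad γ (x + t • u), u⟫)
      ⟪fderiv ℝ (homogGrad γ) x u, u⟫ 0 := by
    simpa using h1.inner ℝ (hasDerivAt_const (0 : ℝ) u)
  refine ge_of_tendsto h2.tendsto_slope_zero_right ?_
  have hne : ∀ᶠ t : ℝ in 𝓝[>] 0, x + t • u ≠ 0 := by
    have : Tendsto (fun t : ℝ => x + t • u) (𝓝[>] 0) (𝓝 x) := by
      have := hl.continuousAt.tendsto.mono_left (nhdsWithin_le_nhds (s := Ioi 0))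
      simpa using this
    exact this.eventually_ne hx
  filter_upwards [self_mem_nhdsWithin, hne] with t ht hxt
  have ht0 : (0 : ℝ) < t := ht
  simp only [zero_add, zero_smul, add_zero, smul_eq_mul]
  refine mul_nonneg (inv_nonneg.2 ht0.le) ?_
  have e1 := inner_homogGrad_le hC2 hconv hx (x + t • u)
  have e2 := inner_homogGrad_le hC2 hconv hxt x
  rw [← inner_homogGrad_self hC2 hxt] at e1
  rw [← inner_homogGrad_self hC2 hx] at e2
  rw [inner_add_right, inner_add_right, inner_smul_right, inner_smul_right] at e1
  nlinarith

theorem fderiv_homogGrad_self (hC2 : ContMDiff (𝓡 n) 𝓘(ℝ, ℝ) 2 γ) (hconv : IsConvexIntegrand γ)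
    {x : E (n + 1)} (hx : x ≠ 0) : fderiv ℝ (homogGrad γ) x x = 0 := by
  have hl : HasDerivAt (fun t : ℝ => x + t • x) x 0 := by
    simpa using ((hasDerivAt_id (0 : ℝ)).smul_const x).const_add x
  have h1 : HasDerivAt (fun t : ℝ => homogGrad γ (x + t • x)) (fderiv ℝ (homogGrad γ) x x) 0 := by
    refine HasFDerivAt.comp_hasDerivAt (0 : ℝ) ?_ hl
    rw [zero_smul, add_zero]
    exact hasFDerivAt_homogGrad hC2 hx
  have h2 : HasDerivAt (fun t : ℝ => homogGrad γ (x + t • x)) 0 0 := by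
    refine (hasDerivAt_const (0 : ℝ) (homogGrad γ x)).congr_of_eventuallyEq ?_
    filter_upwards [lt_mem_nhds (show (-1 : ℝ) < 0 by norm_num)] with t ht
    rw [← homogGrad_smul hC2 hconv hx (show 0 < 1 + t by linarith), add_smul, one_smul]
  exact h1.unique h2

/-- Product rule for `‖x‖ * radialExt γ x` at a unit vector, where the differential of the norm is
`⟪x, ·⟫`. -/
theorem cahnHoffman_eq (hC2 : ContMDiff (𝓡 n) 𝓘(ℝ, ℝ) 2 γ) {x : E (n + 1)} (hx : ‖x‖ = 1) :
    cahnHoffman γ x = homogGrad γ x := by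
  have hx0 : x ≠ 0 := fun h => by rw [h, norm_zero] at hx; exact zero_ne_one hx
  have hr : DifferentiableAt ℝ (radialExt γ) x :=
    (contDiffAt_radialExt hC2 hx0).differentiableAt (by norm_num)
  have hnorm : HasFDerivAt (fun y : E (n + 1) => ‖y‖) (innerSL ℝ x) x := by
    have h1 : HasFDerivAt (fun y : E (n + 1) => ‖y‖ ^ 2) (2 • innerSL ℝ x) x :=
      (hasStrictFDerivAt_norm_sq x).hasFDerivAt
    have h2 := h1.sqrt (by rw [hx]; norm_num)
    simp only [Real.sqrt_sq (norm_nonneg _), hx] at h2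
    have h3 : (1 / (2 * √(1 ^ 2))) • 2 • innerSL ℝ x = innerSL ℝ x := by
      ext v
      simp
    rwa [h3] at h2
  have h := hnorm.mul hr.hasFDerivAt
  refine ext_inner_right ℝ fun v => ?_
  have h3 : fderiv ℝ (homogExt γ) x v = ‖x‖ * fderiv ℝ (radialExt γ) x v + radialExt γ x * ⟪x, v⟫ := by
    have := h.fderiv
    have h4 : fderiv ℝ (homogExt γ) x = _ := this
    rw [h4]; simp
  rw [← fderiv_homogExt_apply, h3, hx, one_mul, cahnHoffman, inner_add_left, inner_smul_left, gradient,
    InnerProductSpace.toDual_symm_apply]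
  simp

theorem continuous_homogExt (hconv : IsConvexIntegrand γ) : Continuous (homogExt γ) :=
  continuousOn_univ.1 (hconv.continuousOn isOpen_univ)

theorem wulff_bound {w : E (n + 1)} (hw : ∀ ν : S n, ⟪w, (ν : E (n + 1))⟫ ≤ γ ν) (z : E (n + 1)) :
    ⟪w, z⟫ ≤ homogExt γ z := by
  rcases eq_or_ne z 0 with rfl | hz
  · rw [inner_zero_right, homogExt_zero]
  · let ν : S n := ⟨‖z‖⁻¹ • z, mem_sphere_zero_iff_norm.2 (norm_smul_inv_norm hz)⟩
    have hzν : z = ‖z‖ • (ν : E (n + 1)) := by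
      rw [smul_smul, mul_inv_cancel₀ (norm_ne_zero_iff.2 hz), one_smul]
    rw [hzν, homogExt_smul (norm_nonneg z), homogExt_coe, inner_smul_right]
    exact mul_le_mul_of_nonneg_left (hw ν) (norm_nonneg z)

theorem isClosed_wulffBody (γ : S n → ℝ) :
    IsClosed {x : E (n + 1) | ∀ ν : S n, ⟪x, (ν : E (n + 1))⟫ ≤ γ ν} := by
  simp only [ofPred_forall]
  exact isClosed_iInter fun ν => isClosed_le (continuous_id.inner continuous_const) continuous_const

/-- The constraint with index `x` is an equality at this point, so any displacement in the direction
`x` leaves the body. -/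
theorem homogGrad_mem_wulffShape (hC2 : ContMDiff (𝓡 n) 𝓘(ℝ, ℝ) 2 γ) (hconv : IsConvexIntegrand γ)
    {x : E (n + 1)} (hx : ‖x‖ = 1) : homogGrad γ x ∈ wulffShape γ := by
  have hx0 : x ≠ 0 := fun h => by rw [h, norm_zero] at hx; exact zero_ne_one hx
  rw [wulffShape, (isClosed_wulffBody γ).frontier_eq]
  refine ⟨fun ν => ?_, fun hint => ?_⟩
  · rw [← homogExt_coe (γ := γ) ν]
    exact inner_homogGrad_le hC2 hconv hx0 _
  · rw [mem_interior_iff_mem_nhds] at hint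
    have hl : Tendsto (fun t : ℝ => homogGrad γ x + t • x) (𝓝[>] 0) (𝓝 (homogGrad γ x)) := by
      have : Continuous fun t : ℝ => homogGrad γ x + t • x := by fun_prop
      have := (this.tendsto 0).mono_left (nhdsWithin_le_nhds (s := Ioi 0))
      simpa using this
    obtain ⟨t, ht, ht0⟩ := (Filter.Eventually.and (hl.eventually hint) self_mem_nhdsWithin).exists
    have h1 := ht ⟨x, mem_sphere_zero_iff_norm.2 hx⟩
    have h2 := homogExt_coe (γ := γ) ⟨x, mem_sphere_zero_iff_norm.2 hx⟩
    simp only at h1 h2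
    rw [← h2, inner_add_left, inner_homogGrad_self hC2 hx0, inner_smul_left, real_inner_self_eq_norm_sq,
      hx] at h1
    have ht0' : (0 : ℝ) < t := ht0
    simp only [conj_trivial, one_pow, mul_one] at h1
    linarith

/-- If all constraints were strict at `w`, compactness of the sphere would give a uniform slack, and
a ball of that radius around `w` would lie in the body. -/
theorem exists_normal_of_mem_wulffShape (hC2 : ContMDiff (𝓡 n) 𝓘(ℝ, ℝ) 2 γ) {w : E (n + 1)}
    (hw : w ∈ wulffShape γ) : (∀ z, ⟪w, z⟫ ≤ homogExt γ z) ∧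
      ∃ x : E (n + 1), ‖x‖ = 1 ∧ ⟪w, x⟫ = homogExt γ x := by
  rw [wulffShape, (isClosed_wulffBody γ).frontier_eq] at hw
  refine ⟨wulff_bound hw.1, ?_⟩
  by_contra! hne
  have hlt : ∀ ν : S n, 0 < γ ν - ⟪w, (ν : E (n + 1))⟫ := by
    intro ν
    have h1 := hw.1 ν
    have h2 := hne ν (norm_eq_of_mem_sphere ν)
    rw [homogExt_coe] at h2
    exact sub_pos.2 (lt_of_le_of_ne h1 h2)
  have hcont : Continuous fun ν : S n => γ ν - ⟪w, (ν : E (n + 1))⟫ :=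
    hC2.continuous.sub (continuous_const.inner continuous_subtype_val)
  have hne' : Nonempty (S n) := ⟨⟨EuclideanSpace.single 0 1, by simp⟩⟩
  obtain ⟨ν₀, -, hν₀⟩ := isCompact_univ.exists_isMinOn (univ_nonempty (α := S n)) hcont.continuousOn
  apply hw.2
  rw [mem_interior]
  refine ⟨ball w (γ ν₀ - ⟪w, (ν₀ : E (n + 1))⟫), fun y hy ν => ?_, isOpen_ball, mem_ball_self (hlt ν₀)⟩
  have h1 : γ ν₀ - ⟪w, (ν₀ : E (n + 1))⟫ ≤ γ ν - ⟪w, (ν : E (n + 1))⟫ := hν₀ (mem_univ ν)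
  have h2 : ⟪y - w, (ν : E (n + 1))⟫ ≤ ‖y - w‖ * ‖(ν : E (n + 1))‖ := real_inner_le_norm _ _
  rw [norm_eq_of_mem_sphere ν, mul_one, inner_sub_left] at h2
  rw [mem_ball_iff_norm] at hy
  linarith

end Integrand

/-! ### Continuous maps that are differentiable off finitely many hypersurfaces -/

section Transversal

variable {V F : Type*} [NormedAddCommGroup V] [NormedSpace ℝ V]
  [NormedAddCommGroup F] [NormedSpace ℝ F]

/-- A real vector space is not a finite union of proper subspaces. -/
theorem exists_forall_apply_ne_zero {ι : Type*} [Finite ι] (l : ι → V →L[ℝ] ℝ) (hl : ∀ j, l j ≠ 0) :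
    ∃ w, ∀ j, l j w ≠ 0 := by
  classical
  haveI := Fintype.ofFinite ι
  have h := Subspace.biUnion_ne_univ_of_top_notMem (k := ℝ) (E := V)
    (s := Finset.univ.image fun j => LinearMap.ker (l j : V →ₗ[ℝ] ℝ)) (by
      simp only [Finset.mem_image, Finset.mem_univ, true_and, not_exists]
      intro j hj
      refine hl j (ContinuousLinearMap.ext fun v => ?_)
      have : v ∈ LinearMap.ker (l j : V →ₗ[ℝ] ℝ) := hj ▸ Submodule.mem_top
      exact this)
  obtain ⟨w, hw⟩ := (ne_univ_iff_exists_notMem _).mp h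
  refine ⟨w, fun j hj => hw ?_⟩
  simp only [mem_iUnion]
  exact ⟨_, Finset.mem_image_of_mem _ (Finset.mem_univ j), hj⟩

/-- A whole cone of directions around `w` is transversal to all hypersurfaces at all points near
`p`. The room in the direction is what allows arbitrary nearby points to be joined by transversal
segments. -/
theorem exists_transversal {ι : Type*} [Finite ι] (h : ι → V → ℝ) (p : V)
    (hd : ∀ j, ContDiffAt ℝ 1 (h j) p) (hne : ∀ j, fderiv ℝ (h j) p ≠ 0) :
    ∃ (w : V) (τ r : ℝ), 0 < τ ∧ 0 < r ∧ ∀ j, ∀ x ∈ ball p r, DifferentiableAt ℝ (h j) x ∧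
      ∀ e, ‖e‖ ≤ τ → fderiv ℝ (h j) x (w + e) ≠ 0 := by
  obtain ⟨w, hw⟩ := exists_forall_apply_ne_zero _ hne
  have key : ∀ᶠ q : V × V in 𝓝 p ×ˢ 𝓝 0, ∀ j, DifferentiableAt ℝ (h j) q.1 ∧
      fderiv ℝ (h j) q.1 (w + q.2) ≠ 0 := by
    rw [← nhds_prod_eq, eventually_all]
    intro j
    have h1 : ∀ᶠ x in 𝓝 p, ContDiffAt ℝ 1 (h j) x := (hd j).eventually (by simp)
    have h2 : ContinuousAt (fun q : V × V => fderiv ℝ (h j) q.1 (w + q.2)) (p, 0) := by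
      have h3 : ContinuousAt (fderiv ℝ (h j)) p := (hd j).continuousAt_fderiv (by simp)
      have h4 : ContinuousAt (fun q : V × V => fderiv ℝ (h j) q.1) (p, 0) :=
        ContinuousAt.comp (f := Prod.fst) (x := ((p, 0) : V × V)) h3 continuousAt_fst
      exact h4.clm_apply (by fun_prop)
    have h3 : ∀ᶠ q : V × V in 𝓝 (p, 0), ContDiffAt ℝ 1 (h j) q.1 :=
      (continuousAt_fst (p := ((p, 0) : V × V))).eventually h1
    filter_upwards [h3, h2.eventually_ne (by simpa using hw j)] with q hq hq'
    exact ⟨hq.differentiableAt (by simp), hq'⟩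
  obtain ⟨U, hU, W, hW, hUW⟩ := Filter.eventually_prod_iff.mp key
  obtain ⟨r, hr, hrU⟩ := Metric.eventually_nhds_iff_ball.mp hU
  obtain ⟨τ, hτ, hτW⟩ := Metric.eventually_nhds_iff_ball.mp hW
  refine ⟨w, τ / 2, r, half_pos hτ, hr, fun j x hx => ⟨?_, fun e he => ?_⟩⟩
  · exact (hUW (hrU x hx) (hτW 0 (mem_ball_self hτ)) j).1
  · exact (hUW (hrU x hx) (hτW e (by rw [mem_ball_zero_iff]; linarith)) j).2

/-- A function on a ball whose derivative along a line does not vanish has at most one zero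
on it. -/
theorem line_zero_unique {g : V → ℝ} {p w x : V} {r : ℝ}
    (hg : ∀ y ∈ ball p r, DifferentiableAt ℝ g y ∧ fderiv ℝ g y w ≠ 0) {s t : ℝ}
    (hs : x + s • w ∈ ball p r) (ht : x + t • w ∈ ball p r) (hs0 : g (x + s • w) = 0)
    (ht0 : g (x + t • w) = 0) : s = t := by
  wlog hst : s ≤ t generalizing s t
  · exact (this ht hs ht0 hs0 (le_of_not_ge hst)).symm
  rcases hst.eq_or_lt with h | h
  · exact h
  exfalso
  have hseg : ∀ u ∈ Icc s t, x + u • w ∈ ball p r := by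
    intro u hu
    have hc := (convex_ball p r).segment_subset hs ht
    have hu' : u ∈ segment ℝ s t := by rwa [segment_eq_Icc hst]
    obtain ⟨a, b, ha, hb, hab, rfl⟩ := hu'
    refine hc ⟨a, b, ha, hb, hab, ?_⟩
    have : x = (a + b) • x := by rw [hab, one_smul]
    conv_rhs => rw [this]
    simp only [smul_eq_mul]
    module
  have hder : ∀ u ∈ Icc s t,
      HasDerivAt (fun u : ℝ => g (x + u • w)) (fderiv ℝ g (x + u • w) w) u := by
    intro u hu
    have h1 := (hg _ (hseg u hu)).1.hasFDerivAt
    have hl : HasDerivAt (fun t : ℝ => x + t • w) w u := by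
      simpa using ((hasDerivAt_id u).smul_const w).const_add x
    exact h1.comp_hasDerivAt u hl
  obtain ⟨c, hc, hc0⟩ := exists_hasDerivAt_eq_zero h
    (fun u hu => (hder u hu).continuousAt.continuousWithinAt) (by simp only [hs0, ht0])
    (fun u hu => hder u (Ioo_subset_Icc_self hu))
  exact (hg _ (hseg c (Ioo_subset_Icc_self hc))).2 hc0

/-- Each line parallel to `w` meets the zero set at most once inside the ball, so the translates by
`w / (k + 1)` are pairwise disjoint. Infinitely many disjoint translates by bounded vectors force
measure zero. -/
theorem addHaar_zeros_eq_zero [FiniteDimensional ℝ V] [MeasurableSpace V] [BorelSpace V]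
    (μ : Measure V) [μ.IsAddHaarMeasure] {g : V → ℝ} {p w : V} {r : ℝ}
    (hg : ∀ y ∈ ball p r, DifferentiableAt ℝ g y ∧ fderiv ℝ g y w ≠ 0) :
    μ (ball p r ∩ g ⁻¹' {0}) = 0 := by
  have hgc : ContinuousOn g (ball p r) :=
    fun y hy => (hg y hy).1.continuousAt.continuousWithinAt
  refine Measure.addHaar_eq_zero_of_disjoint_translates μ (fun k : ℕ => (1 / ((k : ℝ) + 1)) • w)
    ?_ ?_ ?_
  · refine (isBounded_closedBall (x := (0 : V)) (r := ‖w‖)).subset ?_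
    rintro _ ⟨k, rfl⟩
    rw [mem_closedBall_zero_iff, norm_smul, Real.norm_eq_abs, abs_of_nonneg (by positivity)]
    have : (1 / ((k : ℝ) + 1)) ≤ 1 := by
      rw [div_le_one (by positivity)]; linarith [(Nat.cast_nonneg k : (0 : ℝ) ≤ k)]
    exact mul_le_of_le_one_left (norm_nonneg w) this
  · intro k l hkl
    simp only [Function.onFun, image_add_left, singleton_add, disjoint_left, mem_preimage,
      mem_inter_iff, mem_singleton_iff]
    rintro y ⟨hk, hk0⟩ ⟨hl, hl0⟩
    rw [show ∀ a : ℝ, -(a • w) + y = y + (-a) • w from fun a => by module] at hk hk0 hl hl0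
    have := line_zero_unique hg hk hl hk0 hl0
    rw [neg_inj, one_div, one_div, inv_inj, add_left_inj, Nat.cast_inj] at this
    exact hkl this
  · have h1 := hgc.isOpen_inter_preimage isOpen_ball (isOpen_compl_singleton (x := (0 : ℝ)))
    have h2 : ball p r ∩ g ⁻¹' {0} = ball p r \ (ball p r ∩ g ⁻¹' {0}ᶜ) := by
      ext y; simp only [mem_inter_iff, mem_preimage, mem_singleton_iff, Set.mem_sdiff, mem_compl_iff]
      tauto
    rw [h2]
    exact isOpen_ball.measurableSet.diff h1.measurableSet

/-- The segment meets the hypersurfaces in a countable set of parameters, and the fundamental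
theorem of calculus tolerates a countable exceptional set for a continuous function. -/
theorem norm_sub_le_of_line [CompleteSpace F] {ι : Type*} [Finite ι] {h : ι → V → ℝ} {f : V → F}
    {p w x : V} {r C : ℝ}
    (hg : ∀ j, ∀ y ∈ ball p r, DifferentiableAt ℝ (h j) y ∧ fderiv ℝ (h j) y w ≠ 0)
    (hf : ContinuousOn f (ball p r))
    (hf' : ∀ y ∈ ball p r, (∀ j, h j y ≠ 0) → DifferentiableAt ℝ f y ∧ ‖fderiv ℝ f y‖ ≤ C)
    (hx : x ∈ ball p r) (hw : x + w ∈ ball p r) : ‖f (x + w) - f x‖ ≤ C * ‖w‖ := by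
  have hseg : ∀ u ∈ Icc (0 : ℝ) 1, x + u • w ∈ ball p r := by
    intro u hu
    exact (convex_ball p r).add_smul_mem hx hw hu
  set s : Set ℝ := {u | ∃ j, x + u • w ∈ ball p r ∧ h j (x + u • w) = 0} with hs
  have hsc : s.Countable := by
    have : s = ⋃ j, {u | x + u • w ∈ ball p r ∧ h j (x + u • w) = 0} := by
      ext u; simp [hs]
    rw [this]
    refine countable_iUnion fun j => Set.Subsingleton.countable ?_
    rintro a ⟨ha, ha0⟩ b ⟨hb, hb0⟩
    exact line_zero_unique (hg j) ha hb ha0 hb0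
  have hl : ∀ u : ℝ, HasDerivAt (fun t : ℝ => x + t • w) w u := fun u => by
    simpa using ((hasDerivAt_id u).smul_const w).const_add x
  have hder : ∀ u ∈ Icc (0 : ℝ) 1, u ∉ s →
      HasDerivAt (fun t : ℝ => f (x + t • w)) (fderiv ℝ f (x + u • w) w) u := by
    intro u hu hus
    have h1 := (hf' _ (hseg u hu) fun j hj => hus ⟨j, hseg u hu, hj⟩).1.hasFDerivAt
    exact h1.comp_hasDerivAt u (hl u)
  have hbd : ∀ᵐ u, u ∈ uIoc (0 : ℝ) 1 → ‖deriv (fun t : ℝ => f (x + t • w)) u‖ ≤ C * ‖w‖ := by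
    have : ∀ᵐ u, u ∉ s := hsc.ae_notMem volume
    filter_upwards [this] with u hu hI
    rw [uIoc_of_le zero_le_one] at hI
    have hI' : u ∈ Icc (0 : ℝ) 1 := Ioc_subset_Icc_self hI
    rw [(hder u hI' hu).deriv]
    refine (ContinuousLinearMap.le_opNorm _ _).trans ?_
    gcongr
    exact (hf' _ (hseg u hI') fun j hj => hu ⟨j, hseg u hI', hj⟩).2
  have hint : IntervalIntegrable (deriv fun t : ℝ => f (x + t • w)) volume 0 1 := by
    have hK : IntervalIntegrable (fun _ : ℝ => C * ‖w‖) volume 0 1 := intervalIntegrable_const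
    refine hK.mono_fun (aestronglyMeasurable_deriv _ _) ?_
    rw [EventuallyLE, ae_restrict_iff' measurableSet_uIoc]
    filter_upwards [hbd] with u hu hI
    exact (hu hI).trans (le_abs_self _)
  have hcont : ContinuousOn (fun t : ℝ => f (x + t • w)) (uIcc (0 : ℝ) 1) := by
    rw [uIcc_of_le zero_le_one]
    exact hf.comp (by fun_prop) hseg
  have hFTC := integral_eq_of_hasDerivAt_off_countable (fun t : ℝ => f (x + t • w))
    (deriv fun t : ℝ => f (x + t • w)) hsc hcont (by
      intro u hu
      simp only [zero_le_one, inf_of_le_left, sup_of_le_right] at hu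
      have := hder u (Ioo_subset_Icc_self hu.1) hu.2
      rw [this.deriv]; exact this) hint
  have := intervalIntegral.norm_integral_le_of_norm_le_const_ae hbd
  rw [hFTC] at this
  simpa using this

/-- The segment from `x` to `x + v` may run inside a hypersurface. The detour first adds `s w + v`
and then subtracts `s w`; with `s = ‖v‖ / τ` the first step has direction `w + v / s`, which lies in
the transversal cone. The length of the detour is a fixed multiple of `‖v‖`, and the smaller radius
keeps it in the ball. -/
theorem norm_sub_le_of_transversal [CompleteSpace F] {ι : Type*} [Finite ι] {h : ι → V → ℝ} {p w : V}
    {τ r : ℝ} (hτ : 0 < τ) (hr : 0 < r)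
    (hg : ∀ j, ∀ x ∈ ball p r, DifferentiableAt ℝ (h j) x ∧
      ∀ e, ‖e‖ ≤ τ → fderiv ℝ (h j) x (w + e) ≠ 0) :
    ∃ r' > 0, r' ≤ r ∧ ∃ K : ℝ, 0 ≤ K ∧ ∀ (f : V → F) (C : ℝ), ContinuousOn f (ball p r) →
      (∀ y ∈ ball p r, (∀ j, h j y ≠ 0) → DifferentiableAt ℝ f y ∧ ‖fderiv ℝ f y‖ ≤ C) →
      ∀ x ∈ ball p r', ∀ y ∈ ball p r', ‖f y - f x‖ ≤ C * (K * ‖y - x‖) := by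
  set A : ℝ := ‖w‖ / τ + 1 with hA
  have hA0 : 0 < A := by positivity
  refine ⟨r / (1 + 2 * A), by positivity, div_le_self hr.le (by linarith),
    2 * (‖w‖ / τ) + 1, by positivity, ?_⟩
  intro f C hf hf' x hx y hy
  rcases eq_or_ne y x with rfl | hne
  · simp
  have hrr : r / (1 + 2 * A) ≤ r := div_le_self hr.le (by linarith)
  obtain ⟨v, rfl⟩ : ∃ v, y = x + v := ⟨y - x, by abel⟩
  have hv0 : v ≠ 0 := fun h => hne (by simp [h])
  have hvpos : 0 < ‖v‖ := norm_pos_iff.mpr hv0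
  simp only [add_sub_cancel_left]
  set s : ℝ := ‖v‖ / τ with hs
  have hspos : 0 < s := by positivity
  have hvr : ‖v‖ < 2 * (r / (1 + 2 * A)) := by
    have h1 : v = (x + v - p) - (x - p) := by abel
    rw [h1]
    have h2 := norm_sub_le (x + v - p) (x - p)
    rw [mem_ball, dist_eq_norm] at hx hy
    linarith
  have hz : x + (s • w + v) ∈ ball p r := by
    rw [mem_ball, dist_eq_norm] at hx ⊢
    have h1 : ‖s • w + v‖ ≤ A * ‖v‖ := by
      refine (norm_add_le _ _).trans ?_
      rw [norm_smul, Real.norm_eq_abs, abs_of_pos hspos, hs, hA]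
      apply le_of_eq; ring
    have h2 : A * ‖v‖ < A * (2 * (r / (1 + 2 * A))) := by gcongr
    have h3 : r / (1 + 2 * A) + A * (2 * (r / (1 + 2 * A))) = r := by
      field_simp
    calc ‖x + (s • w + v) - p‖ = ‖(x - p) + (s • w + v)‖ := by congr 1; abel
      _ ≤ ‖x - p‖ + ‖s • w + v‖ := norm_add_le _ _
      _ < r := by linarith
  have step : ∀ (a : ℝ) (e z : V), a ≠ 0 → ‖e‖ ≤ τ → z ∈ ball p r →
      z + a • (w + e) ∈ ball p r → ‖f (z + a • (w + e)) - f z‖ ≤ C * ‖a • (w + e)‖ := by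
    intro a e z ha he hz hz'
    refine norm_sub_le_of_line (fun j y hy => ⟨(hg j y hy).1, ?_⟩) hf hf' hz hz'
    rw [map_smul]
    exact smul_ne_zero ha ((hg j y hy).2 e he)
  -- The bound has content only if some point lies off the hypersurfaces; otherwise the line through
  -- `p` in the direction `w` would meet one of the finitely many hypersurfaces more than once.
  have hC0 : 0 ≤ C := by
    obtain ⟨y, hy⟩ : ∃ y ∈ ball p r, ∀ j, h j y ≠ 0 := by
      by_contra! hcon
      have hinf : (Ioo (0 : ℝ) (r / (‖w‖ + 1))).Infinite := Ioo_infinite (by positivity)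
      have hfin : (Ioo (0 : ℝ) (r / (‖w‖ + 1))).Finite := by
        have hsub : Ioo (0 : ℝ) (r / (‖w‖ + 1)) ⊆
            ⋃ j, {u : ℝ | p + u • w ∈ ball p r ∧ h j (p + u • w) = 0} := by
          intro u hu
          have hb : p + u • w ∈ ball p r := by
            rw [mem_ball, dist_eq_norm, add_sub_cancel_left, norm_smul, Real.norm_eq_abs,
              abs_of_pos hu.1]
            have := hu.2
            rw [lt_div_iff₀ (by positivity)] at this
            nlinarith [hu.1]
          obtain ⟨j, hj⟩ := hcon _ hb
          exact mem_iUnion.mpr ⟨j, hb, hj⟩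
        refine (finite_iUnion fun j => Set.Subsingleton.finite ?_).subset hsub
        rintro a ⟨ha, ha0⟩ b ⟨hb, hb0⟩
        refine line_zero_unique (g := h j) (fun y hy => ⟨(hg j y hy).1, ?_⟩) ha hb ha0 hb0
        simpa using (hg j y hy).2 0 (by simpa using hτ.le)
      exact hinf hfin
    exact (norm_nonneg _).trans (hf' y hy.1 hy.2).2
  have e1 : s • w + v = s • (w + s⁻¹ • v) := by
    rw [smul_add, smul_smul, mul_inv_cancel₀ hspos.ne', one_smul]
  have hn1 : ‖s⁻¹ • v‖ ≤ τ := by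
    rw [norm_smul, Real.norm_eq_abs, abs_of_pos (inv_pos.mpr hspos), hs]
    apply le_of_eq; field_simp
  have b1 := step s (s⁻¹ • v) x hspos.ne' hn1 (ball_subset_ball hrr hx) (e1 ▸ hz)
  rw [← e1] at b1
  have e2 : x + v = (x + (s • w + v)) + (-s) • (w + 0) := by rw [add_zero]; module
  have b2 := step (-s) 0 _ (neg_ne_zero.mpr hspos.ne') (by simpa using hτ.le) hz
    (e2 ▸ ball_subset_ball hrr hy)
  rw [← e2] at b2
  have n1 : ‖s • w + v‖ ≤ (‖w‖ / τ) * ‖v‖ + ‖v‖ := by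
    refine (norm_add_le _ _).trans ?_
    rw [norm_smul, Real.norm_eq_abs, abs_of_pos hspos, hs]
    apply le_of_eq; ring
  have n2 : ‖(-s) • (w + 0)‖ = (‖w‖ / τ) * ‖v‖ := by
    rw [add_zero, norm_smul, Real.norm_eq_abs, abs_neg, abs_of_pos hspos, hs]; ring
  calc ‖f (x + v) - f x‖ = ‖(f (x + v) - f (x + (s • w + v))) + (f (x + (s • w + v)) - f x)‖ := by
        congr 1; abel
    _ ≤ C * ‖(-s) • (w + 0)‖ + C * ‖s • w + v‖ := (norm_add_le _ _).trans (add_le_add b2 b1)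
    _ ≤ C * ((‖w‖ / τ) * ‖v‖) + C * ((‖w‖ / τ) * ‖v‖ + ‖v‖) := by
        rw [n2]; gcongr
    _ = _ := by ring

end Transversal

/-! ### Calculus in the charts of a manifold -/

section ChartCalculus

variable {n : ℕ} {M : Type*} [TopologicalSpace M] [ChartedSpace (E n) M] [IsManifold (𝓡 n) ∞ M]
  {F : Type*} [NormedAddCommGroup F] [NormedSpace ℝ F]
  {e e' : OpenPartialHomeomorph M (E n)}

theorem contDiffOn_chartChange (he : e ∈ atlas (E n) M) (he' : e' ∈ atlas (E n) M) :
    ContDiffOn ℝ ∞ (e.symm.trans e') (e.symm.trans e').source := by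
  have h := HasGroupoid.compatible (G := contDiffGroupoid ∞ (𝓡 n)) he he'
  exact contMDiffOn_iff_contDiffOn.mp (contMDiffOn_of_mem_contDiffGroupoid h)

theorem mem_chartChange_source {p : M} (hp : p ∈ e.source) (hp' : p ∈ e'.source) :
    e p ∈ (e.symm.trans e').source := by
  rw [OpenPartialHomeomorph.trans_source]
  exact ⟨by simpa using e.map_source hp, by simpa [e.left_inv hp] using hp'⟩

theorem contDiffAt_chartChange (he : e ∈ atlas (E n) M) (he' : e' ∈ atlas (E n) M) {p : M}
    (hp : p ∈ e.source) (hp' : p ∈ e'.source) : ContDiffAt ℝ ∞ (e.symm.trans e') (e p) :=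
  (contDiffOn_chartChange he he').contDiffAt
    ((e.symm.trans e').open_source.mem_nhds (mem_chartChange_source hp hp'))

theorem differentiableAt_chartChange (he : e ∈ atlas (E n) M) (he' : e' ∈ atlas (E n) M) {p : M}
    (hp : p ∈ e.source) (hp' : p ∈ e'.source) : DifferentiableAt ℝ (e.symm.trans e') (e p) :=
  (contDiffAt_chartChange he he' hp hp').differentiableAt (by simp)

theorem comp_chart_eventuallyEq (Y : M → F) {p : M} (hp : p ∈ e.source) (hp' : p ∈ e'.source) :
    Y ∘ e.symm =ᶠ[𝓝 (e p)] (Y ∘ e'.symm) ∘ (e.symm.trans e') := by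
  filter_upwards [(e.symm.trans e').open_source.mem_nhds (mem_chartChange_source hp hp')] with u hu
  rw [OpenPartialHomeomorph.trans_source] at hu
  simp only [Function.comp_apply, OpenPartialHomeomorph.coe_trans]
  rw [e'.left_inv hu.2]

theorem differentiableAt_chart (he : e ∈ atlas (E n) M) (he' : e' ∈ atlas (E n) M) {Y : M → F}
    {p : M} (hp : p ∈ e.source) (hp' : p ∈ e'.source)
    (h : DifferentiableAt ℝ (Y ∘ e'.symm) (e' p)) : DifferentiableAt ℝ (Y ∘ e.symm) (e p) := by
  refine DifferentiableAt.congr_of_eventuallyEq ?_ (comp_chart_eventuallyEq Y hp hp')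
  refine DifferentiableAt.comp _ ?_ (differentiableAt_chartChange he he' hp hp')
  simpa [e.left_inv hp] using h

theorem fderiv_chart (he : e ∈ atlas (E n) M) (he' : e' ∈ atlas (E n) M) (Y : M → F)
    {p : M} (hp : p ∈ e.source) (hp' : p ∈ e'.source) :
    fderiv ℝ (Y ∘ e.symm) (e p) =
      fderiv ℝ (Y ∘ e'.symm) (e' p) ∘L fderiv ℝ (e.symm.trans e') (e p) := by
  have hpt : (e.symm.trans e') (e p) = e' p := by simp [e.left_inv hp]
  by_cases h : DifferentiableAt ℝ (Y ∘ e'.symm) (e' p)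
  · rw [(comp_chart_eventuallyEq Y hp hp').fderiv_eq, fderiv_comp _ (by rwa [hpt])
      (differentiableAt_chartChange he he' hp hp'), hpt]
  · rw [fderiv_zero_of_not_differentiableAt h, fderiv_zero_of_not_differentiableAt
      fun h' => h (differentiableAt_chart he' he hp' hp h')]
    rfl

/-- No differentiability is assumed: where it fails, both sides have the default value zero. -/
theorem mfderiv_eq_fderiv_chart (he : e ∈ atlas (E n) M) (Y : M → F) {p : M} (hp : p ∈ e.source) :
    (mfderiv (𝓡 n) 𝓘(ℝ, F) Y p : E n →L[ℝ] F) =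
      fderiv ℝ (Y ∘ e.symm) (e p) ∘L
        fderiv ℝ ((chartAt (E n) p).symm.trans e) (chartAt (E n) p p) := by
  rw [← fderiv_chart (chart_mem_atlas (E n) p) he Y (mem_chart_source (E n) p) hp]
  have key : MDifferentiableAt (𝓡 n) 𝓘(ℝ, F) Y p ↔
      DifferentiableAt ℝ (Y ∘ (chartAt (E n) p).symm) (chartAt (E n) p p) := by
    rw [mdifferentiableAt_iff]
    have h1 : DifferentiableWithinAt ℝ (writtenInExtChartAt (𝓡 n) 𝓘(ℝ, F) p Y) (range (𝓡 n))
        (extChartAt (𝓡 n) p p) ↔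
        DifferentiableAt ℝ (Y ∘ (chartAt (E n) p).symm) (chartAt (E n) p p) := by
      rw [show range (𝓡 n) = univ from range_id, differentiableWithinAt_univ]
      rfl
    rw [h1, and_iff_right_iff_imp]
    intro h
    have h2 : ContinuousAt ((Y ∘ (chartAt (E n) p).symm) ∘ chartAt (E n) p) p :=
      h.continuousAt.comp ((chartAt (E n) p).continuousAt (mem_chart_source (E n) p))
    refine h2.congr ?_
    filter_upwards [chart_source_mem_nhds (E n) p] with q hq
    simp [(chartAt (E n) p).left_inv hq]
  by_cases h : MDifferentiableAt (𝓡 n) 𝓘(ℝ, F) Y p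
  · refine h.mfderiv.trans ?_
    have h3 : fderivWithin ℝ (writtenInExtChartAt (𝓡 n) 𝓘(ℝ, F) p Y) univ
        (extChartAt (𝓡 n) p p) =
        fderiv ℝ (Y ∘ (chartAt (E n) p).symm) (chartAt (E n) p p) := by
      rw [fderivWithin_univ]
      rfl
    rw [← h3, ← (show range (𝓡 n) = univ from range_id)]
  · rw [mfderiv_zero_of_not_mdifferentiableAt h,
      fderiv_zero_of_not_differentiableAt fun h' => h (key.mpr h')]
    rfl

theorem contDiffWithinAt_chart (he : e ∈ atlas (E n) M) {Y : M → F} {s : Set M} {p : M}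
    (hp : p ∈ e.source) {m : ℕ} (h : ContMDiffWithinAt (𝓡 n) 𝓘(ℝ, F) m Y s p) :
    ContDiffWithinAt ℝ m (Y ∘ e.symm) (e.symm ⁻¹' s) (e p) := by
  haveI : IsManifold (𝓡 n) (m : WithTop ℕ∞) M :=
    IsManifold.of_le (n := ∞) (by exact_mod_cast le_top)
  have h1 := (contMDiffWithinAt_iff_of_mem_maximalAtlas (e' := chartAt F (Y p))
    (IsManifold.subset_maximalAtlas he) (IsManifold.chart_mem_maximalAtlas (Y p)) hp
    (mem_chart_source F (Y p))).mp h
  have h2 := h1.2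
  rw [show range (𝓡 n) = univ from range_id, inter_univ] at h2
  exact h2

theorem contDiffAt_chart (he : e ∈ atlas (E n) M) {Y : M → F} {s : Set M} {p : M}
    (hp : p ∈ e.source) {m : ℕ} (h : ContMDiffOn (𝓡 n) 𝓘(ℝ, F) m Y s) (hs : p ∈ interior s) :
    ContDiffAt ℝ m (Y ∘ e.symm) (e p) := by
  refine (contDiffWithinAt_chart he hp (h p (interior_subset hs))).contDiffAt ?_
  have h1 : ContinuousAt e.symm (e p) := e.symm.continuousAt (by simpa using e.map_source hp)
  refine h1.preimage_mem_nhds ?_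
  rw [e.left_inv hp]
  exact mem_interior_iff_mem_nhds.mp hs

end ChartCalculus

/-! ### The edges of a piecewise smooth hypersurface -/

section Edges

variable {n : ℕ} {M : Type*} [TopologicalSpace M] [T2Space M] [ChartedSpace (E n) M]
  [IsManifold (𝓡 n) ∞ M] {F : Type*} [NormedAddCommGroup F] [NormedSpace ℝ F]
  {e : OpenPartialHomeomorph M (E n)} {k : ℕ} {P : Fin k → Set M}

/-- The union of the boundaries of the pieces. -/
def edges (P : Fin k → Set M) : Set M := ⋃ i, frontier (P i)

theorem exists_mem_interior (hP : IsDecomposition (n := n) P) {p : M} (hp : p ∉ edges P) :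
    ∃ i, p ∈ interior (P i) := by
  obtain ⟨i, hi⟩ := mem_iUnion.mp (hP.iUnion_eq ▸ mem_univ p)
  refine ⟨i, ?_⟩
  by_contra h
  exact hp (mem_iUnion.mpr ⟨i, subset_closure hi, h⟩)

theorem eventually_chart {e : OpenPartialHomeomorph M (E n)} {p : M} (hp : p ∈ e.source)
    {U : Set M} (hU : U ∈ 𝓝 p) : ∀ᶠ u in 𝓝 (e p), e.symm u ∈ U := by
  have h1 : ContinuousAt e.symm (e p) := e.symm.continuousAt (by simpa using e.map_source hp)
  exact h1.preimage_mem_nhds (by rwa [e.left_inv hp])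

theorem exists_edge_functions (hP : IsDecomposition (n := n) P) (he : e ∈ atlas (E n) M) {p : M}
    (hp : p ∈ e.source) : ∃ (ι : Type) (_ : Finite ι) (h : ι → E n → ℝ),
      (∀ j, ContDiffAt ℝ 1 (h j) (e p)) ∧ (∀ j, fderiv ℝ (h j) (e p) ≠ 0) ∧
      ∀ᶠ u in 𝓝 (e p), e.symm u ∈ edges P → ∃ j, h j u = 0 := by
  have key : ∀ i, ∃ (m : ℕ) (h : Fin m → E n → ℝ),
      (∀ j, ContDiffAt ℝ 1 (h j) (e p)) ∧ (∀ j, fderiv ℝ (h j) (e p) ≠ 0) ∧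
      ∀ᶠ u in 𝓝 (e p), e.symm u ∈ frontier (P i) → ∃ j, h j u = 0 := by
    intro i
    by_cases hpi : p ∈ frontier (P i)
    · obtain ⟨U, hU, hpU, m, g, hg, hg', hz⟩ := (hP.piecewiseSmooth i).boundary p hpi
      refine ⟨m, fun j => g j ∘ e.symm, fun j => ?_, fun j hj => ?_, ?_⟩
      · have h1 : ContMDiffOn (𝓡 n) 𝓘(ℝ, ℝ) ((1 : ℕ) : WithTop ℕ∞) (g j) U :=
          (hg j).of_le (by exact_mod_cast le_top)
        exact_mod_cast contDiffAt_chart he hp h1 (by rwa [hU.interior_eq])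
      · refine hg' j p hpU ?_
        have h1 := mfderiv_eq_fderiv_chart he (g j) hp
        rw [hj, ContinuousLinearMap.zero_comp] at h1
        exact h1
      · filter_upwards [eventually_chart hp (hU.mem_nhds hpU)] with u hu hf
        exact hz _ ⟨hu, hf⟩
    · refine ⟨0, fun j => j.elim0, fun j => j.elim0, fun j => j.elim0, ?_⟩
      filter_upwards [eventually_chart hp (isClosed_frontier.isOpen_compl.mem_nhds hpi)]
        with u hu hf
      exact absurd hf hu
  choose m h hd hne hz using key
  refine ⟨Σ i, Fin (m i), inferInstance, fun q => h q.1 q.2, fun q => hd q.1 q.2,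
    fun q => hne q.1 q.2, ?_⟩
  filter_upwards [eventually_all.mpr hz] with u hu hf
  obtain ⟨i, hi⟩ := mem_iUnion.mp hf
  obtain ⟨j, hj⟩ := hu i hi
  exact ⟨⟨i, j⟩, hj⟩

/-- The transversality estimates around a point of the surface. The factor `K` does not depend on
`f` or `C`: a bound `C` on the derivative off the edges gives a Lipschitz estimate, and `C = 0`
gives local constancy. -/
theorem exists_ball_edges (F : Type*) [NormedAddCommGroup F] [NormedSpace ℝ F] [CompleteSpace F]
    (hP : IsDecomposition (n := n) P) (he : e ∈ atlas (E n) M)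
    {p : M} (hp : p ∈ e.source) {s : Set (E n)} (hs : s ∈ 𝓝 (e p)) : ∃ R > 0,
      ball (e p) R ⊆ e.target ∩ s ∧ volume (ball (e p) R ∩ e.symm ⁻¹' edges P) = 0 ∧
      ∃ r > 0, r ≤ R ∧ ∃ K : ℝ, 0 ≤ K ∧ ∀ (f : E n → F) (C : ℝ), ContinuousOn f (ball (e p) R) →
        (∀ y ∈ ball (e p) R, e.symm y ∉ edges P → DifferentiableAt ℝ f y ∧ ‖fderiv ℝ f y‖ ≤ C) →
        ∀ x ∈ ball (e p) r, ∀ y ∈ ball (e p) r, ‖f y - f x‖ ≤ C * (K * ‖y - x‖) := by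
  obtain ⟨ι, hι, h, hd, hne, hz⟩ := exists_edge_functions hP he hp
  obtain ⟨w, τ, r₁, hτ, hr₁, hw⟩ := exists_transversal h (e p) hd hne
  have ht : ∀ᶠ u in 𝓝 (e p), u ∈ e.target := e.open_target.mem_nhds (e.map_source hp)
  have hs' : ∀ᶠ u in 𝓝 (e p), u ∈ s := hs
  obtain ⟨R₂, hR₂, hR₂'⟩ := Metric.eventually_nhds_iff_ball.mp (hz.and (ht.and hs'))
  set R := min r₁ R₂ with hR
  have hR0 : 0 < R := lt_min hr₁ hR₂
  have hw' : ∀ j, ∀ x ∈ ball (e p) R, DifferentiableAt ℝ (h j) x ∧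
      ∀ v, ‖v‖ ≤ τ → fderiv ℝ (h j) x (w + v) ≠ 0 :=
    fun j x hx => hw j x (ball_subset_ball (min_le_left _ _) hx)
  have hR' : ∀ y ∈ ball (e p) R, (e.symm y ∈ edges P → ∃ j, h j y = 0) ∧ y ∈ e.target ∧ y ∈ s :=
    fun y hy => hR₂' y (ball_subset_ball (min_le_right _ _) hy)
  refine ⟨R, hR0, fun y hy => (hR' y hy).2, ?_, ?_⟩
  · have : ball (e p) R ∩ e.symm ⁻¹' edges P ⊆ ⋃ j, ball (e p) R ∩ h j ⁻¹' {0} := by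
      rintro y ⟨hy, hy'⟩
      obtain ⟨j, hj⟩ := (hR' y hy).1 hy'
      exact mem_iUnion.mpr ⟨j, hy, hj⟩
    refine measure_mono_null this (measure_iUnion_null fun j => ?_)
    refine addHaar_zeros_eq_zero (w := w) volume fun y hy => ⟨(hw' j y hy).1, ?_⟩
    simpa using (hw' j y hy).2 0 (by simpa using hτ.le)
  · obtain ⟨r, hr, hrR, K, hK, hfin⟩ := norm_sub_le_of_transversal (F := F) hτ hR0 hw'
    refine ⟨r, hr, hrR, K, hK, fun f C hf hf' => hfin f C hf fun y hy hy' => hf' y hy fun hc => ?_⟩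
    obtain ⟨j, hj⟩ := (hR' y hy).1 hc
    exact hy' j hj

/-- The edges are a null set in each chart. -/
theorem volume_edges (hP : IsDecomposition (n := n) P) (he : e ∈ atlas (E n) M) :
    volume (e.target ∩ e.symm ⁻¹' edges P) = 0 := by
  refine measure_null_of_locally_null _ fun u hu => ?_
  obtain ⟨R, hR, -, hnull, -⟩ := exists_ball_edges ℝ hP he (e.map_target hu.1) univ_mem
  rw [e.right_inv hu.1] at hnull
  refine ⟨ball u R ∩ (e.target ∩ e.symm ⁻¹' edges P),
    inter_mem (mem_nhdsWithin_of_mem_nhds (ball_mem_nhds u hR)) self_mem_nhdsWithin, ?_⟩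
  exact measure_mono_null (inter_subset_inter_right _ inter_subset_right) hnull

/-- On each closed piece the derivative extends continuously up to the boundary, hence is bounded
near `p`; in the interior it is the genuine derivative. Pieces that do not contain `p` stay away
from it. -/
theorem eventually_norm_fderiv_le (hP : IsDecomposition (n := n) P) (he : e ∈ atlas (E n) M)
    {Y : M → F} (hY : ∀ i, ContMDiffOn (𝓡 n) 𝓘(ℝ, F) 1 Y (P i)) {p : M} (hp : p ∈ e.source) :
    ∃ C : ℝ, ∀ᶠ u in 𝓝 (e p), e.symm u ∉ edges P →
      DifferentiableAt ℝ (Y ∘ e.symm) u ∧ ‖fderiv ℝ (Y ∘ e.symm) u‖ ≤ C := by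
  have key : ∀ i, ∃ C : ℝ, ∀ᶠ u in 𝓝 (e p), e.symm u ∈ interior (P i) →
      DifferentiableAt ℝ (Y ∘ e.symm) u ∧ ‖fderiv ℝ (Y ∘ e.symm) u‖ ≤ C := by
    intro i
    by_cases hpi : p ∈ P i
    · have h1 : ContDiffWithinAt ℝ ((0 : WithTop ℕ∞) + 1) (Y ∘ e.symm) (e.symm ⁻¹' P i) (e p) := by
        have := contDiffWithinAt_chart (m := 1) he hp (hY i p hpi)
        simpa using this
      obtain ⟨u, hu, -, f', hf', hfc⟩ :=
        (contDiffWithinAt_succ_iff_hasFDerivWithinAt (by simp)).mp h1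
      have hpi' : e p ∈ e.symm ⁻¹' P i := by simpa [e.left_inv hp] using hpi
      rw [insert_eq_of_mem hpi'] at hu
      have hep : e p ∈ u := mem_of_mem_nhdsWithin hpi' hu
      have hc := hfc.continuousWithinAt.norm.eventually_le_const (lt_add_one ‖f' (e p)‖)
      have hu' := mem_nhdsWithin_iff_eventually.mp hu
      have hc' := mem_nhdsWithin_iff_eventually.mp hc
      refine ⟨‖f' (e p)‖ + 1, ?_⟩
      filter_upwards [hu'.eventually_nhds, hc', e.open_target.mem_nhds (e.map_source hp)]
        with x hx hxc hxt hxi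
      have hxn : u ∈ 𝓝 x := by
        have h3 : e.symm ⁻¹' P i ∈ 𝓝 x :=
          (e.symm.continuousAt hxt).preimage_mem_nhds (mem_interior_iff_mem_nhds.mp hxi)
        filter_upwards [hx, h3] with y hy hy' using hy hy'
      have hxd := (hf' x (mem_of_mem_nhds hxn)).hasFDerivAt hxn
      refine ⟨hxd.differentiableAt, ?_⟩
      rw [hxd.fderiv]
      exact hxc (mem_of_mem_nhds hxn)
    · refine ⟨0, ?_⟩
      filter_upwards [eventually_chart hp ((hP.isCompact i).isClosed.isOpen_compl.mem_nhds hpi)]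
        with u hu hf
      exact absurd (interior_subset hf) hu
  choose C hC using key
  refine ⟨∑ i, |C i|, ?_⟩
  filter_upwards [eventually_all.mpr hC] with u hu hf
  obtain ⟨i, hi⟩ := exists_mem_interior hP hf
  refine ⟨(hu i hi).1, (hu i hi).2.trans ((le_abs_self _).trans ?_)⟩
  exact Finset.single_le_sum (f := fun i => |C i|) (fun _ _ => abs_nonneg _) (Finset.mem_univ i)

/-- The map `Y` is locally Lipschitz in all charts of the atlas. -/
def IsLocLip (n : ℕ) {M : Type*} [TopologicalSpace M] [ChartedSpace (E n) M] (Y : M → F) : Prop :=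
  ∀ e ∈ atlas (E n) M, LocallyLipschitzOn e.target (Y ∘ e.symm)

theorem isLocLip_of_piecewise [CompleteSpace F] (hP : IsDecomposition (n := n) P) {Y : M → F}
    (hYc : Continuous Y) (hY : ∀ i, ContMDiffOn (𝓡 n) 𝓘(ℝ, F) 1 Y (P i)) : IsLocLip n Y := by
  intro e he u hu
  have hp := e.map_target hu
  obtain ⟨C, hC⟩ := eventually_norm_fderiv_le hP he hY hp
  obtain ⟨R, hR, hRs, -, r, hr, hrR, K, hK, hfin⟩ := exists_ball_edges F hP he hp hC
  rw [e.right_inv hu] at hRs hfin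
  refine ⟨(|C| * K).toNNReal, ball u r, mem_nhdsWithin_of_mem_nhds (ball_mem_nhds u hr), ?_⟩
  refine LipschitzOnWith.of_dist_le_mul fun x hx y hy => ?_
  rw [dist_eq_norm, dist_eq_norm, Real.coe_toNNReal _ (by positivity), mul_assoc]
  refine (hfin (Y ∘ e.symm) C (hYc.comp_continuousOn (e.continuousOn_symm.mono
    fun z hz => (hRs hz).1)) (fun z hz => (hRs hz).2) y hy x hx).trans ?_
  gcongr
  exact le_abs_self C

/-- A continuous map with vanishing differential on the pieces is constant. -/
theorem eq_of_fderiv_eq_zero [CompleteSpace F] [PreconnectedSpace M]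
    (hP : IsDecomposition (n := n) P) {Y : M → F} (hYc : Continuous Y)
    (hY : ∀ e ∈ atlas (E n) M, ∀ u ∈ e.target, e.symm u ∉ edges P →
      DifferentiableAt ℝ (Y ∘ e.symm) u ∧ fderiv ℝ (Y ∘ e.symm) u = 0) (p q : M) : Y p = Y q := by
  refine IsLocallyConstant.apply_eq_of_preconnectedSpace ?_ p q
  rw [IsLocallyConstant.iff_eventually_eq]
  intro p
  have hp := mem_chart_source (E n) p
  have he := chart_mem_atlas (E n) p
  obtain ⟨R, hR, hRs, -, r, hr, hrR, K, hK, hfin⟩ :=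
    exists_ball_edges F hP he hp univ_mem
  have h1 : ∀ᶠ q in 𝓝 p, chartAt (E n) p q ∈ ball (chartAt (E n) p p) r :=
    ((chartAt (E n) p).continuousAt hp).preimage_mem_nhds (ball_mem_nhds _ hr)
  filter_upwards [h1, chart_source_mem_nhds (E n) p] with q hq hqs
  have h2 := hfin (Y ∘ (chartAt (E n) p).symm) 0 (hYc.comp_continuousOn
    ((chartAt (E n) p).continuousOn_symm.mono fun z hz => (hRs hz).1)) (fun z hz hz' => by
      have := hY _ he z (hRs hz).1 hz'
      exact ⟨this.1, by rw [this.2, norm_zero]⟩) _ (mem_ball_self hr) _ hq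
  rw [zero_mul, norm_le_zero_iff, sub_eq_zero, Function.comp_apply, Function.comp_apply,
    (chartAt (E n) p).left_inv hp, (chartAt (E n) p).left_inv hqs] at h2
  exact h2

end Edges

/-! ### Functions on the manifold, read in a chart and extended by zero -/

section ToChart

variable {n : ℕ} {M : Type*} [TopologicalSpace M] [ChartedSpace (E n) M]
  {F : Type*} [NormedAddCommGroup F] [NormedSpace ℝ F]
  {e e' : OpenPartialHomeomorph M (E n)}

theorem IsLocLip.add {Y Z : M → F} (hY : IsLocLip n Y) (hZ : IsLocLip n Z) :
    IsLocLip n fun p => Y p + Z p :=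
  fun e he => LocallyLipschitzOn.add (hY e he) (hZ e he)

theorem IsLocLip.smul {f : M → ℝ} {Y : M → F} (hf : IsLocLip n f) (hY : IsLocLip n Y) :
    IsLocLip n fun p => f p • Y p :=
  fun e he => LocallyLipschitzOn.smul_vec (hf e he) (hY e he)

theorem isLocLip_const (c : F) : IsLocLip n fun _ : M => c :=
  fun e _ u _ => ⟨0, univ, univ_mem, (LipschitzWith.const c).lipschitzOnWith⟩

theorem IsLocLip.const_smul {Y : M → F} (hY : IsLocLip n Y) (a : ℝ) :
    IsLocLip n fun p => a • Y p :=
  (isLocLip_const a).smul hY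

theorem isLocLip_of_contMDiff [IsManifold (𝓡 n) ∞ M] {Y : M → F}
    (hY : ContMDiff (𝓡 n) 𝓘(ℝ, F) ∞ Y) : IsLocLip n Y := by
  intro e he u hu
  have h1 : ContMDiffOn (𝓡 n) 𝓘(ℝ, F) ((1 : ℕ) : WithTop ℕ∞) Y univ :=
    (hY.of_le (by exact_mod_cast le_top)).contMDiffOn
  have h2 := contDiffAt_chart he (e.map_target hu) h1 (by simp)
  rw [e.right_inv hu] at h2
  obtain ⟨K, t, ht, hK⟩ := ContDiffAt.exists_lipschitzOnWith (𝕂 := ℝ) (by exact_mod_cast h2)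
  exact ⟨K, t, mem_nhdsWithin_of_mem_nhds ht, hK⟩

/-- `f : M → F`, read in the chart `e` and extended by zero. -/
def toChart (e : OpenPartialHomeomorph M (E n)) (f : M → F) : E n → F :=
  e.target.indicator (f ∘ e.symm)

theorem toChart_eventuallyEq (f : M → F) {u : E n} (hu : u ∈ e.target) :
    toChart e f =ᶠ[𝓝 u] f ∘ e.symm := by
  filter_upwards [e.open_target.mem_nhds hu] with v hv
  exact indicator_of_mem hv _

theorem support_toChart_subset (f : M → F) : Function.support (toChart e f) ⊆ e '' tsupport f := by
  intro u hu
  rw [toChart, Function.mem_support] at hu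
  have hut : u ∈ e.target := mem_of_indicator_ne_zero hu
  rw [indicator_of_mem hut] at hu
  exact ⟨e.symm u, subset_tsupport f hu, e.right_inv hut⟩

theorem isCompact_image_tsupport [CompactSpace M] {f : M → F} (hf : tsupport f ⊆ e.source) :
    IsCompact (e '' tsupport f) :=
  (isClosed_tsupport f).isCompact.image_of_continuousOn (e.continuousOn.mono hf)

theorem tsupport_toChart_subset [CompactSpace M] {f : M → F} (hf : tsupport f ⊆ e.source) :
    tsupport (toChart e f) ⊆ e '' tsupport f :=
  closure_minimal (support_toChart_subset f) (isCompact_image_tsupport hf).isClosed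

theorem image_tsupport_subset {f : M → F} (hf : tsupport f ⊆ e.source) :
    e '' tsupport f ⊆ e.target := by
  rintro _ ⟨p, hp, rfl⟩
  exact e.map_source (hf hp)

theorem hasCompactSupport_toChart [CompactSpace M] {f : M → F} (hf : tsupport f ⊆ e.source) :
    HasCompactSupport (toChart e f) :=
  HasCompactSupport.of_support_subset_isCompact (isCompact_image_tsupport hf)
    (support_toChart_subset f)

theorem exists_lipschitzWith_toChart [CompactSpace M] (he : e ∈ atlas (E n) M) {f : M → F}
    (hfl : IsLocLip n f) (hf : tsupport f ⊆ e.source) : ∃ K, LipschitzWith K (toChart e f) := by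
  refine LocallyLipschitz.exists_lipschitzWith (fun u => ?_) (hasCompactSupport_toChart hf)
  by_cases hu : u ∈ e.target
  · obtain ⟨K, t, ht, hK⟩ := hfl e he hu
    refine ⟨K, e.target ∩ t, ?_, ?_⟩
    · rw [e.open_target.nhdsWithin_eq hu] at ht
      exact inter_mem (e.open_target.mem_nhds hu) ht
    · intro x hx y hy
      simp only [toChart]
      rw [indicator_of_mem hx.1, indicator_of_mem hy.1]
      exact hK hx.2 hy.2
  · have hz : ∀ x ∈ (e '' tsupport f)ᶜ, toChart e f x = 0 := fun x hx => by
      by_contra h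
      exact hx (support_toChart_subset f h)
    refine ⟨0, (e '' tsupport f)ᶜ, (isCompact_image_tsupport hf).isClosed.isOpen_compl.mem_nhds
      fun h => hu (image_tsupport_subset hf h), fun x hx y hy => ?_⟩
    rw [hz x hx, hz y hy]
    simp

theorem measure_not_differentiableAt {U : Set (E n)} (hU : IsOpen U) [FiniteDimensional ℝ F]
    {f : E n → F} (hf : LocallyLipschitzOn U f) :
    ∀ᵐ u ∂(volume.restrict U), DifferentiableAt ℝ f u := by
  rw [ae_restrict_iff' hU.measurableSet, ae_iff]
  refine measure_null_of_locally_null _ fun u hu => ?_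
  have huU : u ∈ U := by
    by_contra h
    exact hu fun h' => absurd h' h
  obtain ⟨K, t, ht, hK⟩ := hf huU
  rw [hU.nhdsWithin_eq huU] at ht
  obtain ⟨s, hst, hs, hus⟩ := _root_.mem_nhds_iff.mp ht
  have h := (hK.mono hst).ae_differentiableWithinAt_of_mem (μ := volume)
  rw [ae_iff] at h
  refine ⟨s ∩ {a | ¬ (a ∈ U → DifferentiableAt ℝ f a)},
    inter_mem (mem_nhdsWithin_of_mem_nhds (hs.mem_nhds hus)) self_mem_nhdsWithin,
    measure_mono_null ?_ h⟩
  rintro x ⟨hxs, hx⟩ hx'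
  exact hx fun _ => (hx' hxs).differentiableAt (hs.mem_nhds hxs)

theorem exists_norm_fderiv_le (he : e ∈ atlas (E n) M) {f : M → F} (hf : IsLocLip n f)
    {K : Set (E n)} (hK : IsCompact K) (hKe : K ⊆ e.target) :
    ∃ C : ℝ, ∀ u ∈ K, ‖fderiv ℝ (f ∘ e.symm) u‖ ≤ C := by
  have hloc : ∀ u ∈ K, ∃ t ∈ 𝓝[K] u, ∃ C : ℝ, ∀ v ∈ t, ‖fderiv ℝ (f ∘ e.symm) v‖ ≤ C := by
    intro u hu
    obtain ⟨L, t, ht, hL⟩ := hf e he (hKe hu)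
    rw [e.open_target.nhdsWithin_eq (hKe hu)] at ht
    obtain ⟨s, hst, hs, hus⟩ := _root_.mem_nhds_iff.mp ht
    refine ⟨s, mem_nhdsWithin_of_mem_nhds (hs.mem_nhds hus), L, fun v hv => ?_⟩
    exact norm_fderiv_le_of_lipschitzOn ℝ (hs.mem_nhds hv) (hL.mono hst)
  choose! t ht C hC using hloc
  obtain ⟨T, hTK, hT⟩ := hK.elim_nhdsWithin_subcover t ht
  refine ⟨∑ u ∈ T, |C u|, fun v hv => ?_⟩
  obtain ⟨u, hu, hvu⟩ := mem_iUnion₂.mp (hT hv)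
  refine (hC u (hTK u hu) v hvu).trans ((le_abs_self _).trans ?_)
  exact Finset.single_le_sum (f := fun u => |C u|) (fun _ _ => abs_nonneg _) hu

end ToChart

/-! ### The first variation form in a chart -/

section Form

variable {n : ℕ} {M : Type*} [TopologicalSpace M] [ChartedSpace (E n) M]

/-- The density `⟪Y, crossCoeff 1 (DY) (DZ)⟫ - n ⟪Z, crossVec (DY)⟫` in the chart `e`. -/
def variationForm (Y Z : M → E (n + 1)) (e : OpenPartialHomeomorph M (E n)) (u : E n) : ℝ :=
  ⟪Y (e.symm u), crossCoeff 1 (fderiv ℝ (Y ∘ e.symm) u) (fderiv ℝ (Z ∘ e.symm) u)⟫ -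
    n * ⟪Z (e.symm u), crossVec (fderiv ℝ (Y ∘ e.symm) u)⟫

variable {e e' : OpenPartialHomeomorph M (E n)} {Y Z : M → E (n + 1)}

theorem variationForm_chart [IsManifold (𝓡 n) ∞ M] (hn : 1 ≤ n) (he : e ∈ atlas (E n) M)
    (he' : e' ∈ atlas (E n) M) {p : M} (hp : p ∈ e.source) (hp' : p ∈ e'.source) :
    variationForm Y Z e (e p) =
      (fderiv ℝ (e.symm.trans e') (e p)).det * variationForm Y Z e' (e' p) := by
  simp only [variationForm]
  rw [fderiv_chart he he' Y hp hp', fderiv_chart he he' Z hp hp', crossCoeff_comp 1 _ _ _ hn,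
    crossVec_comp, inner_smul_right, inner_smul_right, e.left_inv hp, e'.left_inv hp']
  ring

theorem fderiv_eq_zero_of_notMem_tsupport {F : Type*} [NormedAddCommGroup F] [NormedSpace ℝ F]
    {Z : M → F} {u : E n} (hu : u ∈ e.target) (hZ : e.symm u ∉ tsupport Z) :
    fderiv ℝ (Z ∘ e.symm) u = 0 := by
  have h1 : Z ∘ e.symm =ᶠ[𝓝 u] fun _ => 0 := by
    have h2 : ∀ᶠ v in 𝓝 u, e.symm v ∈ (tsupport Z)ᶜ :=
      (e.symm.continuousAt hu).preimage_mem_nhds ((isClosed_tsupport Z).isOpen_compl.mem_nhds hZ)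
    filter_upwards [h2] with v hv
    exact image_eq_zero_of_notMem_tsupport (f := Z) hv
  rw [h1.fderiv_eq, fderiv_const_apply]

theorem variationForm_eq_zero {u : E n} (hu : u ∈ e.target) (hZ : e.symm u ∉ tsupport Z) :
    variationForm Y Z e u = 0 := by
  rw [variationForm, fderiv_eq_zero_of_notMem_tsupport hu hZ, crossCoeff_one_zero,
    image_eq_zero_of_notMem_tsupport hZ]
  simp

/-- The form involves `Y` only where `Z` or `DZ` is nonzero. So `Y` may be multiplied by a cutoff
that equals 1 near the support of `Z`, which brings both maps into the compactly supported flat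
case. -/
theorem integral_variationForm_chart [T2Space M] [CompactSpace M] [IsManifold (𝓡 n) ∞ M]
    (hn : 1 ≤ n) (he : e ∈ atlas (E n) M) (hY : IsLocLip n Y) (hZ : IsLocLip n Z)
    (hZs : tsupport Z ⊆ e.source) : IntegrableOn (variationForm Y Z e) e.target ∧
      ∫ u in e.target, variationForm Y Z e u = 0 := by
  obtain ⟨ψ, hψ0, hψ1, -⟩ := exists_contMDiffMap_zero_one_nhds_of_isClosed (𝓡 n) (n := ⊤)
    e.open_source.isClosed_compl (isClosed_tsupport Z)
    (disjoint_left.mpr fun p hp hp' => hp (hZs hp'))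
  rw [Filter.eventually_iff, mem_nhdsSet_iff_forall] at hψ0 hψ1
  set Y' : M → E (n + 1) := fun p => ψ p • Y p with hY'
  have hY's : tsupport Y' ⊆ e.source := by
    intro p hp
    by_contra hpe
    have h1 : Y' =ᶠ[𝓝 p] 0 := by
      filter_upwards [hψ0 p hpe] with q hq
      have : ψ q = 0 := hq
      simp [hY', this]
    exact (notMem_tsupport_iff_eventuallyEq.mpr h1) hp
  have hY'l : IsLocLip n Y' := (isLocLip_of_contMDiff ψ.contMDiff).smul hY
  obtain ⟨K, hK⟩ := exists_lipschitzWith_toChart he hY'l hY's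
  obtain ⟨K', hK'⟩ := exists_lipschitzWith_toChart he hZ hZs
  have hYc := hasCompactSupport_toChart (e := e) hY's
  have hZc := hasCompactSupport_toChart (e := e) hZs
  set f : E n → ℝ := fun u =>
    ⟪toChart e Y' u, crossCoeff 1 (fderiv ℝ (toChart e Y') u) (fderiv ℝ (toChart e Z) u)⟫ -
      n * ⟪toChart e Z u, crossVec (fderiv ℝ (toChart e Y') u)⟫ with hf
  have hi1 := integrable_inner_crossCoeff hK hK' hK.continuous hYc 1
  have hi2 : Integrable fun u => ⟪toChart e Z u, crossVec (fderiv ℝ (toChart e Y') u)⟫ := by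
    have := integrable_inner_crossCoeff hK hK hK'.continuous hZc 0
    simpa only [crossCoeff_zero] using this
  have hfi : Integrable f := hi1.sub (hi2.const_mul _)
  have hf0 : ∫ u, f u = 0 := by
    rw [integral_sub hi1 (hi2.const_mul _), integral_const_mul,
      integral_inner_crossCoeff_one hn hK hK' hYc hZc, sub_self]
  have hEq : e.target.indicator (variationForm Y Z e) = f := by
    ext u
    by_cases hu : u ∈ e.target
    · rw [indicator_of_mem hu]
      by_cases hus : e.symm u ∈ tsupport Z
      · have h1 : toChart e Y' =ᶠ[𝓝 u] Y ∘ e.symm := by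
          have h2 : ∀ᶠ v in 𝓝 u, ψ (e.symm v) = 1 :=
            (e.symm.continuousAt hu).preimage_mem_nhds (hψ1 _ hus)
          filter_upwards [toChart_eventuallyEq Y' hu, h2] with v hv hv'
          rw [hv, hY', Function.comp_apply, Function.comp_apply, hv', one_smul]
        have h3 := toChart_eventuallyEq Z hu
        rw [hf, variationForm]
        simp only
        rw [h1.fderiv_eq, h3.fderiv_eq, h1.eq_of_nhds, h3.eq_of_nhds]
        rfl
      · rw [variationForm_eq_zero hu hus, hf]
        simp only
        rw [(toChart_eventuallyEq Z hu).fderiv_eq, fderiv_eq_zero_of_notMem_tsupport hu hus,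
          crossCoeff_one_zero, (toChart_eventuallyEq Z hu).eq_of_nhds, Function.comp_apply,
          image_eq_zero_of_notMem_tsupport hus]
        simp
    · rw [indicator_of_notMem hu, hf]
      have h1 : u ∉ tsupport (toChart e Z) := fun h =>
        hu (image_tsupport_subset hZs (tsupport_toChart_subset hZs h))
      have h2 : fderiv ℝ (toChart e Z) u = 0 := by
        rw [(notMem_tsupport_iff_eventuallyEq.mp h1).fderiv_eq]
        exact fderiv_const_apply _
      simp only
      rw [h2, crossCoeff_one_zero, image_eq_zero_of_notMem_tsupport h1]
      simp
  constructor
  · rw [← integrable_indicator_iff e.open_target.measurableSet, hEq]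
    exact hfi
  · rw [← integral_indicator e.open_target.measurableSet, hEq, hf0]

/-- Both integrands vanish off the overlap of the two charts, on one side because of `Z` and on the
other because of `ρ`. On the overlap the form transforms with the Jacobian determinant, which
orientation makes equal to its absolute value. -/
theorem setIntegral_variationForm_chart [IsManifold (𝓡 n) ∞ M] (hn : 1 ≤ n)
    (horient : IsOrientedAtlas n M) (he : e ∈ atlas (E n) M) (he' : e' ∈ atlas (E n) M)
    (hZs : tsupport Z ⊆ e'.source) {ρ : M → ℝ} (hρ : tsupport ρ ⊆ e.source) :
    ∫ u in e.target, ρ (e.symm u) * variationForm Y Z e u =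
      ∫ u in e'.target, ρ (e'.symm u) * variationForm Y Z e' u := by
  set φ := e.symm.trans e' with hφ
  have hs : MeasurableSet φ.source := φ.open_source.measurableSet
  have hsrc : φ.source = e.target ∩ e.symm ⁻¹' e'.source := by
    rw [hφ, OpenPartialHomeomorph.trans_source]; rfl
  have htgt : φ.target = e'.target ∩ e'.symm ⁻¹' e.source := by
    rw [hφ, OpenPartialHomeomorph.trans_target]; rfl
  have h1 : ∫ u in e.target, ρ (e.symm u) * variationForm Y Z e u =
      ∫ u in φ.source, ρ (e.symm u) * variationForm Y Z e u := by
    refine setIntegral_eq_of_subset_of_forall_sdiff_eq_zero e.open_target.measurableSet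
      (hsrc ▸ inter_subset_left) fun u hu => ?_
    rw [hsrc] at hu
    rw [variationForm_eq_zero hu.1 fun h => hu.2 ⟨hu.1, hZs h⟩, mul_zero]
  have h2 : ∫ u in e'.target, ρ (e'.symm u) * variationForm Y Z e' u =
      ∫ u in φ.target, ρ (e'.symm u) * variationForm Y Z e' u := by
    refine setIntegral_eq_of_subset_of_forall_sdiff_eq_zero e'.open_target.measurableSet
      (htgt ▸ inter_subset_left) fun u hu => ?_
    rw [htgt] at hu
    rw [image_eq_zero_of_notMem_tsupport fun h => hu.2 ⟨hu.1, hρ h⟩, zero_mul]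
  rw [h1, h2, ← φ.image_source_eq_target, integral_image_eq_integral_abs_det_fderiv_smul volume hs
    (f' := fderiv ℝ φ) (fun u hu => ((((contDiffOn_chartChange he he').contDiffAt
      (φ.open_source.mem_nhds hu)).differentiableAt (by simp)).hasFDerivAt).hasFDerivWithinAt)
    φ.injOn]
  refine setIntegral_congr_fun hs fun u hu => ?_
  have hpos := horient e he e' he' u hu
  have hu' := hu
  rw [hsrc] at hu'
  have hp : e.symm u ∈ e.source := e.map_target hu'.1
  have h3 := variationForm_chart (Y := Y) (Z := Z) hn he he' hp hu'.2
  rw [e.right_inv hu'.1] at h3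
  simp only [smul_eq_mul]
  rw [abs_of_pos hpos, h3]
  have h4 : φ u = e' (e.symm u) := rfl
  rw [h4, e'.left_inv hu'.2]
  ring

end Form

/-! ### Integration by a partition of unity -/

/-- Finitely many charts with a smooth partition of unity that is subordinate to them. -/
structure ChartPartition (n : ℕ) (M : Type*) [TopologicalSpace M] [ChartedSpace (E n) M] where
  /-- The number of charts. -/
  size : ℕ
  /-- The charts. -/
  chart : Fin size → OpenPartialHomeomorph M (E n)
  mem_atlas : ∀ a, chart a ∈ atlas (E n) M
  /-- The partition of unity. -/
  weight : Fin size → M → ℝ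
  contMDiff : ∀ a, ContMDiff (𝓡 n) 𝓘(ℝ, ℝ) ∞ (weight a)
  tsupport_subset : ∀ a, tsupport (weight a) ⊆ (chart a).source
  nonneg : ∀ a p, 0 ≤ weight a p
  sum_eq_one : ∀ p, ∑ a, weight a p = 1

section Partition

variable {n : ℕ} {M : Type*} [TopologicalSpace M] [ChartedSpace (E n) M]

theorem exists_chartPartition [T2Space M] [CompactSpace M] [IsManifold (𝓡 n) ∞ M] :
    Nonempty (ChartPartition n M) := by
  obtain ⟨t, ht⟩ := isCompact_univ.elim_nhds_subcover
    (fun p : M => (chartAt (E n) p).source) (fun p _ => chart_source_mem_nhds (E n) p)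
  obtain ⟨f, hf⟩ := SmoothPartitionOfUnity.exists_isSubordinate (𝓡 n) (isClosed_univ (X := M))
    (fun a : Fin t.card => (chartAt (E n) ((t.equivFin.symm a : t) : M)).source)
    (fun a => (chartAt (E n) _).open_source) (fun p hp => by
      obtain ⟨q, hq, hpq⟩ := mem_iUnion₂.mp (ht.2 hp)
      exact mem_iUnion.mpr ⟨t.equivFin ⟨q, hq⟩, by simpa using hpq⟩)
  refine ⟨⟨t.card, fun a => chartAt (E n) ((t.equivFin.symm a : t) : M),
    fun a => chart_mem_atlas _ _, fun a => f a, fun a => (f a).contMDiff, hf,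
    fun a p => f.nonneg a p, fun p => ?_⟩⟩
  have := f.sum_eq_one (mem_univ p)
  rwa [finsum_eq_sum_of_fintype] at this

namespace ChartPartition

variable (Q : ChartPartition n M)

theorem weight_le_one (a : Fin Q.size) (p : M) : Q.weight a p ≤ 1 := by
  rw [← Q.sum_eq_one p]
  exact Finset.single_le_sum (f := fun a => Q.weight a p) (fun b _ => Q.nonneg b p)
    (Finset.mem_univ a)

/-- Lebesgue measure in the chart `a`, weighted by the partition of unity. -/
def measureAt (a : Fin Q.size) : Measure (E n) :=
  (volume.restrict (Q.chart a).target).withDensity fun u =>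
    ENNReal.ofReal (Q.weight a ((Q.chart a).symm u))

/-- The sum of the weighted Lebesgue measures in the charts. -/
def measure : Measure (Fin Q.size × E n) :=
  Measure.sum fun a => (Q.measureAt a).map (Prod.mk a)

/-- The point of `M` with given chart and coordinates. -/
def pt (z : Fin Q.size × E n) : M := (Q.chart z.1).symm z.2

/-- The differential in the coordinates of a given chart. -/
def grad {F : Type*} [NormedAddCommGroup F] [NormedSpace ℝ F] (Y : M → F)
    (z : Fin Q.size × E n) : E n →L[ℝ] F :=
  fderiv ℝ (Y ∘ (Q.chart z.1).symm) z.2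

theorem continuousOn_weight (a : Fin Q.size) :
    ContinuousOn (fun u => Q.weight a ((Q.chart a).symm u)) (Q.chart a).target :=
  (Q.contMDiff a).continuous.comp_continuousOn (Q.chart a).continuousOn_symm

theorem aemeasurable_weight (a : Fin Q.size) :
    AEMeasurable (fun u => ENNReal.ofReal (Q.weight a ((Q.chart a).symm u)))
      (volume.restrict (Q.chart a).target) :=
  ((Q.continuousOn_weight a).aemeasurable (Q.chart a).open_target.measurableSet).ennreal_ofReal

theorem ae_measure_iff {p : Fin Q.size × E n → Prop} : (∀ᵐ z ∂Q.measure, p z) ↔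
    ∀ a, ∀ᵐ u ∂(volume.restrict (Q.chart a).target),
      0 < Q.weight a ((Q.chart a).symm u) → p (a, u) := by
  rw [measure, Measure.ae_sum_iff]
  refine forall_congr' fun a => ?_
  rw [(measurableEmbedding_prodMk_left a).ae_map_iff, measureAt,
    ae_withDensity_iff' (Q.aemeasurable_weight a)]
  simp only [ne_eq, ENNReal.ofReal_eq_zero, not_le]

theorem ae_of_target {p : Fin Q.size × E n → Prop}
    (h : ∀ a, ∀ᵐ u ∂(volume.restrict (Q.chart a).target), p (a, u)) : ∀ᵐ z ∂Q.measure, p z :=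
  Q.ae_measure_iff.mpr fun a => (h a).mono fun _ hu _ => hu

theorem ae_mem_target : ∀ᵐ z ∂Q.measure, z.2 ∈ (Q.chart z.1).target :=
  Q.ae_of_target fun a => ae_restrict_mem (Q.chart a).open_target.measurableSet

theorem ae_notMem_edges [T2Space M] [IsManifold (𝓡 n) ∞ M] {k : ℕ} {P : Fin k → Set M}
    (hP : IsDecomposition (n := n) P) : ∀ᵐ z ∂Q.measure, Q.pt z ∉ edges P := by
  refine Q.ae_of_target fun a => ?_
  rw [ae_restrict_iff' (Q.chart a).open_target.measurableSet, ae_iff]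
  refine measure_mono_null ?_ (volume_edges hP (Q.mem_atlas a))
  intro u hu
  simp only [mem_ofPred_eq, Classical.not_imp, not_not] at hu
  exact hu

/-- Each weight is at most 1 and has compact support inside its chart. -/
instance [CompactSpace M] : IsFiniteMeasure Q.measure := by
  refine ⟨?_⟩
  rw [measure, Measure.sum_apply _ MeasurableSet.univ, tsum_fintype, ENNReal.sum_lt_top]
  intro a _
  rw [(measurableEmbedding_prodMk_left a).map_apply, preimage_univ, measureAt,
    withDensity_apply _ MeasurableSet.univ, Measure.restrict_univ]
  set K := Q.chart a '' tsupport (Q.weight a)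
  have hK : IsCompact K := isCompact_image_tsupport (Q.tsupport_subset a)
  calc ∫⁻ u in (Q.chart a).target, ENNReal.ofReal (Q.weight a ((Q.chart a).symm u))
      ≤ ∫⁻ u in (Q.chart a).target, K.indicator 1 u := by
        refine setLIntegral_mono' (Q.chart a).open_target.measurableSet fun u hu => ?_
        by_cases h : u ∈ K
        · rw [indicator_of_mem h]
          exact ENNReal.ofReal_le_one.mpr (Q.weight_le_one a _)
        · rw [image_eq_zero_of_notMem_tsupport fun h' => h ⟨_, h', (Q.chart a).right_inv hu⟩]
          simp
    _ ≤ ∫⁻ u, K.indicator 1 u := setLIntegral_le_lintegral _ _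
    _ = volume K := lintegral_indicator_one hK.measurableSet
    _ < ⊤ := hK.measure_lt_top

theorem aestronglyMeasurable {F : Type*} [TopologicalSpace F] {f : Fin Q.size × E n → F}
    (h : ∀ a, AEStronglyMeasurable (fun u => f (a, u)) (volume.restrict (Q.chart a).target))
    [TopologicalSpace.PseudoMetrizableSpace F] :
    AEStronglyMeasurable f Q.measure := by
  rw [measure, aestronglyMeasurable_sum_measure_iff]
  intro a
  rw [(measurableEmbedding_prodMk_left a).aestronglyMeasurable_map_iff]
  exact (h a).mono_ac (withDensity_absolutelyContinuous _ _)

theorem integral_eq_sum {f : Fin Q.size × E n → ℝ} (hf : Integrable f Q.measure) :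
    ∫ z, f z ∂Q.measure =
      ∑ a, ∫ u in (Q.chart a).target, Q.weight a ((Q.chart a).symm u) * f (a, u) := by
  have h := (hasSum_integral_measure hf).unique (hasSum_fintype _)
  rw [measure, h]
  refine Finset.sum_congr rfl fun a _ => ?_
  rw [(measurableEmbedding_prodMk_left a).integral_map, measureAt,
    integral_withDensity_eq_integral_toReal_smul₀ (Q.aemeasurable_weight a) (by simp)]
  refine integral_congr_ae (Eventually.of_forall fun u => ?_)
  simp only [smul_eq_mul]
  rw [ENNReal.toReal_ofReal (Q.nonneg a _)]

theorem aestronglyMeasurable_comp_pt {F : Type*} [TopologicalSpace F]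
    [TopologicalSpace.PseudoMetrizableSpace F] {Y : M → F} (hY : Continuous Y) :
    AEStronglyMeasurable (fun z => Y (Q.pt z)) Q.measure :=
  Q.aestronglyMeasurable fun a =>
    (hY.comp_continuousOn (Q.chart a).continuousOn_symm).aestronglyMeasurable
      (Q.chart a).open_target.measurableSet

variable {F : Type*} [NormedAddCommGroup F] [NormedSpace ℝ F] [FiniteDimensional ℝ F]

theorem aestronglyMeasurable_grad (Y : M → F) : AEStronglyMeasurable (Q.grad Y) Q.measure := by
  haveI := FiniteDimensional.complete ℝ F
  haveI : ProperSpace (E n →L[ℝ] F) := FiniteDimensional.proper ℝ _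
  borelize (E n →L[ℝ] F)
  refine Q.aestronglyMeasurable fun a => ?_
  have h := (measurable_fderiv ℝ (Y ∘ (Q.chart a).symm)).aestronglyMeasurable
    (μ := volume.restrict (Q.chart a).target)
  exact h

theorem exists_grad_bound [CompactSpace M] {Y : M → F} (hY : IsLocLip n Y) :
    ∃ C : ℝ, ∀ᵐ z ∂Q.measure, ‖Q.grad Y z‖ ≤ C := by
  have h : ∀ a, ∃ C : ℝ, ∀ u ∈ Q.chart a '' tsupport (Q.weight a), ‖Q.grad Y (a, u)‖ ≤ C :=
    fun a => exists_norm_fderiv_le (Q.mem_atlas a) hY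
      (isCompact_image_tsupport (Q.tsupport_subset a)) (image_tsupport_subset (Q.tsupport_subset a))
  choose C hC using h
  refine ⟨∑ a, |C a|, Q.ae_measure_iff.mpr fun a => ?_⟩
  filter_upwards [ae_restrict_mem (Q.chart a).open_target.measurableSet] with u hu hpos
  refine (hC a u ⟨_, subset_tsupport _ hpos.ne', (Q.chart a).right_inv hu⟩).trans
    ((le_abs_self _).trans ?_)
  exact Finset.single_le_sum (f := fun a => |C a|) (fun _ _ => abs_nonneg _) (Finset.mem_univ a)

theorem ae_differentiableAt {Y : M → F} (hY : IsLocLip n Y) :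
    ∀ᵐ z ∂Q.measure, DifferentiableAt ℝ (Y ∘ (Q.chart z.1).symm) z.2 :=
  Q.ae_of_target fun a =>
    measure_not_differentiableAt (Q.chart a).open_target (hY _ (Q.mem_atlas a))

end ChartPartition

theorem IsLocLip.continuous {F : Type*} [NormedAddCommGroup F] [NormedSpace ℝ F] {Y : M → F}
    (hY : IsLocLip n Y) : Continuous Y := by
  rw [continuous_iff_continuousAt]
  intro p
  set e := chartAt (E n) p
  have h1 := (hY e (chart_mem_atlas _ p)).continuousOn.continuousAt
    (e.open_target.mem_nhds (e.map_source (mem_chart_source _ p)))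
  have h2 : ContinuousAt ((Y ∘ e.symm) ∘ e) p := h1.comp (e.continuousAt (mem_chart_source _ p))
  refine h2.congr ?_
  filter_upwards [chart_source_mem_nhds (E n) p] with q hq
  simp [e.left_inv hq]

/-- A continuous function of a bounded measurable map is integrable for a finite measure. -/
theorem integrable_continuous_comp {Ω V G : Type*} [MeasurableSpace Ω] {μ : Measure Ω}
    [IsFiniteMeasure μ] [NormedAddCommGroup V] [ProperSpace V] [NormedAddCommGroup G]
    {f : Ω → V} (hf : AEStronglyMeasurable f μ) (hb : ∃ C : ℝ, ∀ᵐ z ∂μ, ‖f z‖ ≤ C)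
    {Φ : V → G} (hΦ : Continuous Φ) : Integrable (fun z => Φ (f z)) μ := by
  obtain ⟨C, hC⟩ := hb
  obtain ⟨D, hD⟩ := (isCompact_closedBall (0 : V) C).exists_bound_of_continuousOn hΦ.continuousOn
  refine Integrable.of_bound (hΦ.comp_aestronglyMeasurable hf) D ?_
  filter_upwards [hC] with z hz
  exact hD _ (by simpa using hz)

theorem exists_norm_le_prodMk {Ω V W : Type*} [MeasurableSpace Ω] {μ : Measure Ω}
    [NormedAddCommGroup V] [NormedAddCommGroup W] {f : Ω → V} {g : Ω → W}
    (hf : ∃ C : ℝ, ∀ᵐ z ∂μ, ‖f z‖ ≤ C) (hg : ∃ C : ℝ, ∀ᵐ z ∂μ, ‖g z‖ ≤ C) :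
    ∃ C : ℝ, ∀ᵐ z ∂μ, ‖(f z, g z)‖ ≤ C := by
  obtain ⟨C, hC⟩ := hf
  obtain ⟨D, hD⟩ := hg
  refine ⟨max C D, ?_⟩
  filter_upwards [hC, hD] with z h1 h2
  exact max_le_max h1 h2

namespace ChartPartition

variable (Q : ChartPartition n M) [CompactSpace M]

theorem exists_comp_pt_bound {F : Type*} [NormedAddCommGroup F] {Y : M → F} (hY : Continuous Y) :
    ∃ C : ℝ, ∀ᵐ z ∂Q.measure, ‖Y (Q.pt z)‖ ≤ C := by
  obtain ⟨C, hC⟩ := isCompact_univ.exists_bound_of_continuousOn hY.continuousOn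
  exact ⟨C, Eventually.of_forall fun z => hC _ (mem_univ _)⟩

/-- Continuous functions of two locally Lipschitz maps and their differentials are integrable. -/
theorem integrable_comp {Y Z : M → E (n + 1)} (hY : IsLocLip n Y) (hZ : IsLocLip n Z)
    {Φ : (E (n + 1) × E (n + 1)) × ((E n →L[ℝ] E (n + 1)) × (E n →L[ℝ] E (n + 1))) → ℝ}
    (hΦ : Continuous Φ) :
    Integrable (fun z => Φ ((Y (Q.pt z), Z (Q.pt z)), (Q.grad Y z, Q.grad Z z))) Q.measure := by
  haveI : ProperSpace (E n →L[ℝ] E (n + 1)) := FiniteDimensional.proper ℝ _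
  exact integrable_continuous_comp
    (((Q.aestronglyMeasurable_comp_pt hY.continuous).prodMk
      (Q.aestronglyMeasurable_comp_pt hZ.continuous)).prodMk
      ((Q.aestronglyMeasurable_grad Y).prodMk (Q.aestronglyMeasurable_grad Z)))
    (exists_norm_le_prodMk (exists_norm_le_prodMk (Q.exists_comp_pt_bound hY.continuous)
      (Q.exists_comp_pt_bound hZ.continuous))
      (exists_norm_le_prodMk (Q.exists_grad_bound hY) (Q.exists_grad_bound hZ))) hΦ

theorem integrable_variationForm {Y Z : M → E (n + 1)} (hY : IsLocLip n Y) (hZ : IsLocLip n Z) :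
    Integrable (fun z => variationForm Y Z (Q.chart z.1) z.2) Q.measure := by
  refine Q.integrable_comp hY hZ
    (Φ := fun q => ⟪q.1.1, crossCoeff 1 q.2.1 q.2.2⟫ - n * ⟪q.1.2, crossVec q.2.1⟫) ?_
  have h1 : Continuous fun q : (E (n + 1) × E (n + 1)) ×
      ((E n →L[ℝ] E (n + 1)) × (E n →L[ℝ] E (n + 1))) => crossCoeff 1 q.2.1 q.2.2 :=
    (continuous_crossCoeff 1).comp continuous_snd
  have h2 : Continuous fun q : (E (n + 1) × E (n + 1)) ×
      ((E n →L[ℝ] E (n + 1)) × (E n →L[ℝ] E (n + 1))) => crossVec q.2.1 :=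
    continuous_crossVec.comp (continuous_fst.comp continuous_snd)
  fun_prop

/-- The form is additive in `Z`, so `Z` is split by the partition of unity. For the part supported
in chart `b`, all weighted chart integrals are transported to that chart, where the weights add up
to 1 and the flat formula applies. -/
theorem integral_variationForm [T2Space M] [IsManifold (𝓡 n) ∞ M] (hn : 1 ≤ n)
    (horient : IsOrientedAtlas n M) {Y Z : M → E (n + 1)} (hY : IsLocLip n Y)
    (hZ : IsLocLip n Z) : ∫ z, variationForm Y Z (Q.chart z.1) z.2 ∂Q.measure = 0 := by
  have hZb : ∀ b, IsLocLip n fun p => Q.weight b p • Z p := fun b =>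
    (isLocLip_of_contMDiff (Q.contMDiff b)).smul hZ
  have hZs : ∀ b, tsupport (fun p => Q.weight b p • Z p) ⊆ (Q.chart b).source := fun b =>
    (closure_mono (Function.support_smul_subset_left _ _)).trans (Q.tsupport_subset b)
  have hsum : (fun z => variationForm Y Z (Q.chart z.1) z.2) =ᵐ[Q.measure]
      fun z => ∑ b, variationForm Y (fun p => Q.weight b p • Z p) (Q.chart z.1) z.2 := by
    filter_upwards [eventually_all.mpr fun b => Q.ae_differentiableAt (hZb b)] with z hz
    have h1 : Z = fun p => ∑ b, Q.weight b p • Z p := by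
      ext1 p; rw [← Finset.sum_smul, Q.sum_eq_one, one_smul]
    have h2 : fderiv ℝ (Z ∘ (Q.chart z.1).symm) z.2 =
        ∑ b, fderiv ℝ ((fun p => Q.weight b p • Z p) ∘ (Q.chart z.1).symm) z.2 := by
      have h3 : Z ∘ (Q.chart z.1).symm =
          fun u => ∑ b, ((fun p => Q.weight b p • Z p) ∘ (Q.chart z.1).symm) u := by
        conv_lhs => rw [h1]
        rfl
      rw [h3, fderiv_fun_sum fun b _ => hz b]
    have h4 : Z ((Q.chart z.1).symm z.2) =
        ∑ b, Q.weight b ((Q.chart z.1).symm z.2) • Z ((Q.chart z.1).symm z.2) := congrFun h1 _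
    simp only [variationForm]
    rw [h2, crossCoeff_one_sum, Finset.sum_sub_distrib, inner_sum, ← Finset.mul_sum, ← sum_inner,
      ← h4]
  rw [integral_congr_ae hsum, integral_finsetSum _ fun b _ =>
    Q.integrable_variationForm hY (hZb b)]
  refine Finset.sum_eq_zero fun b _ => ?_
  rw [Q.integral_eq_sum (Q.integrable_variationForm hY (hZb b))]
  obtain ⟨hi, h0⟩ := integral_variationForm_chart hn (Q.mem_atlas b) hY (hZb b) (hZs b)
  rw [Finset.sum_congr rfl fun a _ => setIntegral_variationForm_chart (Y := Y) hn horient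
    (Q.mem_atlas a) (Q.mem_atlas b) (hZs b) (Q.tsupport_subset a), ← integral_finsetSum]
  · rw [← h0]
    refine integral_congr_ae (Eventually.of_forall fun u => ?_)
    simp only
    rw [← Finset.sum_mul, Q.sum_eq_one, one_mul]
  · intro a _
    refine Integrable.bdd_mul (c := 1) hi ?_ (Eventually.of_forall fun u => ?_)
    · exact ((Q.contMDiff a).continuous.comp_continuousOn
        (Q.chart b).continuousOn_symm).aestronglyMeasurable (Q.chart b).open_target.measurableSet
    · rw [Real.norm_eq_abs, abs_of_nonneg (Q.nonneg a _)]
      exact Q.weight_le_one a _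

theorem integral_crossCoeff_one [T2Space M] [IsManifold (𝓡 n) ∞ M] (hn : 1 ≤ n)
    (horient : IsOrientedAtlas n M) {Y Z : M → E (n + 1)} (hY : IsLocLip n Y)
    (hZ : IsLocLip n Z) :
    ∫ z, ⟪Y (Q.pt z), crossCoeff 1 (Q.grad Y z) (Q.grad Z z)⟫ ∂Q.measure =
      n * ∫ z, ⟪Z (Q.pt z), crossVec (Q.grad Y z)⟫ ∂Q.measure := by
  have h1 : Integrable (fun z => ⟪Y (Q.pt z), crossCoeff 1 (Q.grad Y z) (Q.grad Z z)⟫)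
      Q.measure := by
    refine Q.integrable_comp hY hZ (Φ := fun q => ⟪q.1.1, crossCoeff 1 q.2.1 q.2.2⟫) ?_
    have h1 := (continuous_crossCoeff (n := n) 1).comp
      (continuous_snd (X := E (n + 1) × E (n + 1)))
    exact (continuous_fst.comp continuous_fst).inner h1
  have h2 : Integrable (fun z => ⟪Z (Q.pt z), crossVec (Q.grad Y z)⟫) Q.measure := by
    refine Q.integrable_comp hY hZ (Φ := fun q => ⟪q.1.2, crossVec q.2.1⟫) ?_
    exact (continuous_snd.comp continuous_fst).inner
      (continuous_crossVec.comp (continuous_fst.comp continuous_snd))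
  have h3 := Q.integral_variationForm hn horient hY hZ
  have h4 := integral_sub h1 (h2.const_mul (n : ℝ))
  rw [integral_const_mul] at h4
  rw [← sub_eq_zero, ← h4]
  exact h3

end ChartPartition

end Partition

/-! ### The induced measure in a chart -/

section Area

variable {n : ℕ} {M : Type*} [TopologicalSpace M] [ChartedSpace (E n) M] [IsManifold (𝓡 n) ∞ M]
  {e e' : OpenPartialHomeomorph M (E n)}

theorem det_chartChange_pos (horient : IsOrientedAtlas n M) (he : e ∈ atlas (E n) M)
    (he' : e' ∈ atlas (E n) M) {p : M} (hp : p ∈ e.source) (hp' : p ∈ e'.source) :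
    0 < (fderiv ℝ (e.symm.trans e') (e p)).det :=
  horient e he e' he' _ (mem_chartChange_source hp hp')

theorem normalField_chart (horient : IsOrientedAtlas n M) (he : e ∈ atlas (E n) M)
    (Y : M → E (n + 1)) {p : M} (hp : p ∈ e.source) :
    normalField Y p = unitNormal (fderiv ℝ (Y ∘ e.symm) (e p)) := by
  have h := mfderiv_eq_fderiv_chart he Y hp
  rw [normalField, diff]
  refine (congrArg unitNormal h).trans ?_
  exact unitNormal_comp _ (det_chartChange_pos horient (chart_mem_atlas _ p) he
    (mem_chart_source _ p) hp)

theorem volDensity_chart (horient : IsOrientedAtlas n M) (he : e ∈ atlas (E n) M)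
    (he' : e' ∈ atlas (E n) M) (Y : M → E (n + 1)) {p : M} (hp : p ∈ e.source)
    (hp' : p ∈ e'.source) :
    volDensity (fderiv ℝ (Y ∘ e.symm) (e p)) =
      (fderiv ℝ (e.symm.trans e') (e p)).det * volDensity (fderiv ℝ (Y ∘ e'.symm) (e' p)) := by
  rw [volDensity_eq, volDensity_eq, fderiv_chart he he' Y hp hp', crossVec_comp, norm_smul,
    Real.norm_eq_abs, abs_of_pos (det_chartChange_pos horient he he' hp hp')]

theorem measurable_volDensity_fderiv (f : E n → E (n + 1)) :
    Measurable fun u => ENNReal.ofReal (volDensity (fderiv ℝ f u)) := by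
  simp only [volDensity_eq]
  exact ((continuous_crossVec.measurable.comp (measurable_fderiv ℝ f)).norm).ennreal_ofReal

theorem norm_unitNormal_le (L : E n →L[ℝ] E (n + 1)) : ‖unitNormal L‖ ≤ 1 := by
  rw [unitNormal, norm_smul, norm_inv, norm_norm]
  exact inv_mul_le_one

theorem measurable_unitNormal : Measurable (unitNormal : (E n →L[ℝ] E (n + 1)) → E (n + 1)) :=
  (continuous_crossVec.measurable.norm.inv).smul continuous_crossVec.measurable

theorem image_chart_eq {B : Set M} (hB : B ⊆ e.source) : e '' B = e.target ∩ e.symm ⁻¹' B := by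
  ext u
  constructor
  · rintro ⟨p, hp, rfl⟩
    exact ⟨e.map_source (hB hp), by simpa [e.left_inv (hB hp)] using hp⟩
  · rintro ⟨hu, hu'⟩
    exact ⟨_, hu', e.right_inv hu⟩

variable [MeasurableSpace M] [BorelSpace M]

theorem measurableSet_image_chart [Nonempty M] {B : Set M} (hB : MeasurableSet B)
    (hBs : B ⊆ e.source) : MeasurableSet (e '' B) := by
  classical
  obtain ⟨p₀⟩ := ‹Nonempty M›
  have h1 : Measurable (e.target.piecewise e.symm fun _ => p₀) :=
    e.continuousOn_symm.measurable_piecewise continuousOn_const e.open_target.measurableSet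
  have h2 : e '' B = e.target ∩ (e.target.piecewise e.symm fun _ => p₀) ⁻¹' B := by
    rw [image_chart_eq hBs]
    ext u
    simp only [mem_inter_iff, mem_preimage]
    refine and_congr_right fun hu => ?_
    rw [piecewise_eq_of_mem _ _ _ hu]
  rw [h2]
  exact e.open_target.measurableSet.inter (h1 hB)

theorem lintegral_volDensity_image [Nonempty M] (horient : IsOrientedAtlas n M)
    (he : e ∈ atlas (E n) M) (he' : e' ∈ atlas (E n) M) (Y : M → E (n + 1)) {B : Set M}
    (hB : MeasurableSet B) (hBe : B ⊆ e.source) (hBe' : B ⊆ e'.source) :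
    ∫⁻ u in e' '' B, ENNReal.ofReal (volDensity (fderiv ℝ (Y ∘ e'.symm) u)) =
      ∫⁻ u in e '' B, ENNReal.ofReal (volDensity (fderiv ℝ (Y ∘ e.symm) u)) := by
  set φ := e.symm.trans e' with hφ
  have h1 : e' '' B = φ '' (e '' B) := by
    rw [image_image]
    refine image_congr fun p hp => ?_
    rw [hφ, OpenPartialHomeomorph.coe_trans, Function.comp_apply, e.left_inv (hBe hp)]
  have hsub : e '' B ⊆ φ.source := by
    rintro _ ⟨p, hp, rfl⟩
    exact mem_chartChange_source (hBe hp) (hBe' hp)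
  have hm := measurableSet_image_chart hB hBe
  rw [h1, lintegral_image_eq_lintegral_abs_det_fderiv_mul volume hm (f' := fderiv ℝ φ)
    (fun u hu => ((((contDiffOn_chartChange he he').contDiffAt
      (φ.open_source.mem_nhds (hsub hu))).differentiableAt (by simp)).hasFDerivAt).hasFDerivWithinAt)
    (φ.injOn.mono hsub)]
  refine setLIntegral_congr_fun hm ?_
  rintro _ ⟨p, hp, rfl⟩
  have hpos := det_chartChange_pos horient he he' (hBe hp) (hBe' hp)
  simp only
  rw [volDensity_chart horient he he' Y (hBe hp) (hBe' hp), abs_of_pos hpos,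
    ENNReal.ofReal_mul hpos.le, OpenPartialHomeomorph.coe_trans, Function.comp_apply,
    e.left_inv (hBe hp)]

theorem aemeasurable_chart_symm (μ : Measure (E n)) : AEMeasurable e.symm (μ.restrict e.target) :=
  e.continuousOn_symm.aemeasurable e.open_target.measurableSet

variable [CompactSpace M] [Nonempty M]

/-- Each disjointed piece is moved to the chart `e` by change of variables, and the pieces are
summed by countable additivity. This frees the measure from the chosen sequence of charts. -/
theorem areaMeasure_restrict (horient : IsOrientedAtlas n M) (he : e ∈ atlas (E n) M)
    (Y : M → E (n + 1)) : (areaMeasure Y).restrict e.source =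
      ((volume.withDensity fun u =>
        ENNReal.ofReal (volDensity (fderiv ℝ (Y ∘ e.symm) u))).restrict e.target).map e.symm := by
  set D : ℕ → Set M := disjointed fun i => (chartSeq n M i).source with hD
  have hDm : ∀ j, MeasurableSet (D j) := fun j =>
    MeasurableSet.disjointed (fun i => (chartSeq n M i).open_source.measurableSet) j
  have hDs : ∀ j, D j ⊆ (chartSeq n M j).source := fun j => disjointed_subset _ j
  have hDu : (⋃ j, D j) = univ := by
    rw [hD, iUnion_disjointed]
    exact (exists_chart_cover (n := n) (M := M)).choose_spec
  have hDd : Pairwise (Function.onFun Disjoint D) := disjoint_disjointed _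
  have hc : ∀ j, chartSeq n M j ∈ atlas (E n) M := fun j => chart_mem_atlas _ _
  have hem := e.open_source.measurableSet
  ext A hA
  have hBs : ∀ j, A ∩ e.source ∩ D j ⊆ e.source := fun j => inter_subset_left.trans inter_subset_right
  have hBm : ∀ j, MeasurableSet (A ∩ e.source ∩ D j) := fun j => (hA.inter hem).inter (hDm j)
  rw [Measure.restrict_apply hA, areaMeasure, Measure.sum_apply _ (hA.inter hem),
    Measure.map_apply_of_aemeasurable (aemeasurable_chart_symm _) hA,
    Measure.restrict_apply' e.open_target.measurableSet]
  have hterm : ∀ j, (Measure.map (chartSeq n M j).symm ((volume.withDensity fun u =>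
      ENNReal.ofReal (volDensity (fderiv ℝ (Y ∘ (chartSeq n M j).symm) u))).restrict
        (chartSeq n M j '' D j))) (A ∩ e.source) =
      (volume.withDensity fun u => ENNReal.ofReal (volDensity (fderiv ℝ (Y ∘ e.symm) u)))
        (e '' (A ∩ e.source ∩ D j)) := by
    intro j
    have hsub : chartSeq n M j '' D j ⊆ (chartSeq n M j).target := by
      rintro _ ⟨p, hp, rfl⟩
      exact (chartSeq n M j).map_source (hDs j hp)
    have hset : (chartSeq n M j).symm ⁻¹' (A ∩ e.source) ∩ chartSeq n M j '' D j =
        chartSeq n M j '' (A ∩ e.source ∩ D j) := by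
      rw [image_chart_eq (hDs j), image_chart_eq (inter_subset_right.trans (hDs j))]
      ext u
      simp only [mem_inter_iff, mem_preimage]
      tauto
    rw [Measure.map_apply_of_aemeasurable (((chartSeq n M j).continuousOn_symm.mono hsub).aemeasurable
      (measurableSet_image_chart (hDm j) (hDs j))) (hA.inter hem),
      Measure.restrict_apply' (measurableSet_image_chart (hDm j) (hDs j)), hset,
      withDensity_apply _ (measurableSet_image_chart (hBm j) (inter_subset_right.trans (hDs j))),
      withDensity_apply _ (measurableSet_image_chart (hBm j) (hBs j))]
    exact lintegral_volDensity_image horient he (hc j) Y (hBm j) (hBs j)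
      (inter_subset_right.trans (hDs j))
  rw [tsum_congr hterm, ← measure_iUnion]
  · congr 1
    rw [← image_iUnion, ← inter_iUnion, hDu, inter_univ, image_chart_eq inter_subset_right]
    ext u
    simp only [mem_inter_iff, mem_preimage]
    constructor
    · rintro ⟨h1, h2, -⟩
      exact ⟨h2, h1⟩
    · rintro ⟨h1, h2⟩
      exact ⟨h2, h1, e.map_target h2⟩
  · intro i j hij
    refine disjoint_image_image fun p hp q hq hpq => ?_
    have h1 := e.injOn (hBs i hp) (hBs j hq) hpq
    exact disjoint_left.mp (hDd hij) hp.2 (h1 ▸ hq.2)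
  · exact fun j => measurableSet_image_chart (hBm j) (hBs j)

/-- The chart, extended by 0 outside its source, is a measurable map `g` on `M` that inverts
`e.symm` almost everywhere; `f` is then `(f ∘ e.symm) ∘ g` up to a null set. -/
theorem aestronglyMeasurable_map_chart {F : Type*} [TopologicalSpace F]
    [TopologicalSpace.PseudoMetrizableSpace F] {f : M → F} {μ : Measure (E n)}
    (hf : AEStronglyMeasurable (f ∘ e.symm) (μ.restrict e.target)) :
    AEStronglyMeasurable f ((μ.restrict e.target).map e.symm) := by
  classical
  set ν := μ.restrict e.target with hν
  have hae : AEMeasurable e.symm ν := aemeasurable_chart_symm μ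
  set g : M → E n := e.source.piecewise e fun _ => 0 with hg
  have hgm : Measurable g :=
    e.continuousOn.measurable_piecewise continuousOn_const e.open_source.measurableSet
  have hcomp : ∀ᵐ u ∂ν, g (e.symm u) = u := by
    filter_upwards [ae_restrict_mem e.open_target.measurableSet] with u hu
    rw [hg, piecewise_eq_of_mem _ _ _ (e.map_target hu), e.right_inv hu]
  have hmap : (ν.map e.symm).map g = ν := by
    rw [AEMeasurable.map_map_of_aemeasurable hgm.aemeasurable hae,
      Measure.map_congr (show g ∘ e.symm =ᵐ[ν] id from hcomp), Measure.map_id]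
  have h1 : AEStronglyMeasurable ((f ∘ e.symm) ∘ g) (ν.map e.symm) := by
    refine AEStronglyMeasurable.comp_measurable ?_ hgm
    rwa [hmap]
  refine h1.congr ?_
  have hs : ∀ᵐ p ∂(ν.map e.symm), p ∈ e.source := by
    refine (ae_map_iff (p := fun p => p ∈ e.source) hae e.open_source.measurableSet).mpr ?_
    filter_upwards [ae_restrict_mem e.open_target.measurableSet] with u hu
    exact e.map_target hu
  filter_upwards [hs] with p hp
  rw [Function.comp_apply, Function.comp_apply, hg, piecewise_eq_of_mem _ _ _ hp, e.left_inv hp]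

end Area

/-! ### Energy and enclosed volume as integrals over weighted charts -/

section AreaIntegral

variable {n : ℕ} {M : Type*} [TopologicalSpace M] [ChartedSpace (E n) M] [IsManifold (𝓡 n) ∞ M]
  [MeasurableSpace M] [BorelSpace M] [CompactSpace M] [Nonempty M] (Q : ChartPartition n M)

namespace ChartPartition


theorem integrable_at {f : Fin Q.size × E n → ℝ} (hf : Integrable f Q.measure) (a : Fin Q.size) :
    IntegrableOn (fun u => Q.weight a ((Q.chart a).symm u) * f (a, u)) (Q.chart a).target := by
  have h1 : Integrable f ((Q.measureAt a).map (Prod.mk a)) :=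
    hf.mono_measure (Measure.le_sum (fun a => (Q.measureAt a).map (Prod.mk a)) a)
  rw [(measurableEmbedding_prodMk_left a).integrable_map_iff, measureAt,
    integrable_withDensity_iff_integrable_smul₀' (Q.aemeasurable_weight a) (by simp)] at h1
  refine h1.congr (Eventually.of_forall fun u => ?_)
  simp only [smul_eq_mul, Function.comp_apply]
  rw [ENNReal.toReal_ofReal (Q.nonneg a _)]

/-- The area measure depends on `Y`, whereas `Q.measure` does not: all dependence on `Y` moves into
the integrand, so different surfaces of a variation can be compared. -/
theorem integral_areaMeasure (horient : IsOrientedAtlas n M) {Y : M → E (n + 1)}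
    (hY : IsLocLip n Y) {f : M → ℝ}
    (hf : ∀ e ∈ atlas (E n) M, AEStronglyMeasurable (f ∘ e.symm) (volume.restrict e.target))
    {C : ℝ} (hb : ∀ p, |f p| ≤ C) :
    ∫ p, f p ∂(areaMeasure Y) = ∫ z, f (Q.pt z) * ‖crossVec (Q.grad Y z)‖ ∂Q.measure := by
  have hint : Integrable (fun z => f (Q.pt z) * ‖crossVec (Q.grad Y z)‖) Q.measure := by
    refine Integrable.bdd_mul (c := C) ?_ ?_ (Eventually.of_forall fun z => hb _)
    · exact Q.integrable_comp hY hY (Φ := fun q => ‖crossVec q.2.1‖)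
        (continuous_crossVec.comp (continuous_fst.comp continuous_snd)).norm
    · exact Q.aestronglyMeasurable fun a => hf _ (Q.mem_atlas a)
  have key : ∀ a, Integrable (fun p => Q.weight a p * f p) (areaMeasure Y) ∧
      ∫ p, Q.weight a p * f p ∂(areaMeasure Y) = ∫ u in (Q.chart a).target,
        Q.weight a ((Q.chart a).symm u) *
          (f (Q.pt (a, u)) * ‖crossVec (Q.grad Y (a, u))‖) := by
    intro a
    set e := Q.chart a with he
    have hea : e ∈ atlas (E n) M := Q.mem_atlas a
    have hdm := measurable_volDensity_fderiv (Y ∘ e.symm)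
    have hsupp : ∀ p ∉ e.source, Q.weight a p * f p = 0 := fun p hp => by
      rw [image_eq_zero_of_notMem_tsupport fun h => hp (Q.tsupport_subset a h), zero_mul]
    have hwd : ((volume.withDensity fun u => ENNReal.ofReal
        (volDensity (fderiv ℝ (Y ∘ e.symm) u))).restrict e.target) =
        (volume.restrict e.target).withDensity fun u => ENNReal.ofReal
          (volDensity (fderiv ℝ (Y ∘ e.symm) u)) :=
      restrict_withDensity e.open_target.measurableSet _
    have hres := areaMeasure_restrict horient hea Y
    have hprod : AEStronglyMeasurable ((fun p => Q.weight a p * f p) ∘ e.symm)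
        (volume.restrict e.target) :=
      ((Q.continuousOn_weight a).aestronglyMeasurable e.open_target.measurableSet).mul (hf e hea)
    have hprod' : AEStronglyMeasurable ((fun p => Q.weight a p * f p) ∘ e.symm)
        ((volume.withDensity fun u => ENNReal.ofReal
          (volDensity (fderiv ℝ (Y ∘ e.symm) u))).restrict e.target) := by
      rw [hwd]
      exact hprod.mono_ac (withDensity_absolutelyContinuous _ _)
    have hm := aestronglyMeasurable_map_chart hprod'
    have heq : ∀ u, (ENNReal.ofReal (volDensity (fderiv ℝ (Y ∘ e.symm) u))).toReal •
        ((fun p => Q.weight a p * f p) ∘ e.symm) u = Q.weight a (e.symm u) *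
          (f (Q.pt (a, u)) * ‖crossVec (Q.grad Y (a, u))‖) := by
      intro u
      rw [volDensity_eq, ENNReal.toReal_ofReal (norm_nonneg _), smul_eq_mul, Function.comp_apply,
        pt, grad]
      ring
    constructor
    · have hsub : Function.support (fun p => Q.weight a p * f p) ⊆ e.source := fun p hp => by
        by_contra h
        exact hp (hsupp p h)
      rw [← integrableOn_iff_integrable_of_support_subset hsub, IntegrableOn, hres,
        integrable_map_measure hm (aemeasurable_chart_symm _), hwd,
        integrable_withDensity_iff_integrable_smul' hdm (by simp)]
      exact (Q.integrable_at hint a).congr (Eventually.of_forall fun u => (heq u).symm)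
    · rw [← setIntegral_eq_integral_of_forall_compl_eq_zero hsupp, hres,
        integral_map (aemeasurable_chart_symm _) hm, hwd,
        integral_withDensity_eq_integral_toReal_smul hdm (by simp)]
      exact integral_congr_ae (Eventually.of_forall fun u => heq u)
  rw [Q.integral_eq_sum hint, ← Finset.sum_congr rfl fun a _ => (key a).2,
    ← integral_finsetSum _ fun a _ => (key a).1]
  refine integral_congr_ae (Eventually.of_forall fun p => ?_)
  simp only
  rw [← Finset.sum_mul, Q.sum_eq_one, one_mul]

theorem normalField_pt (horient : IsOrientedAtlas n M) (Y : M → E (n + 1))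
    {z : Fin Q.size × E n} (hz : z.2 ∈ (Q.chart z.1).target) :
    normalField Y (Q.pt z) = unitNormal (Q.grad Y z) := by
  have h := normalField_chart horient (Q.mem_atlas z.1) Y ((Q.chart z.1).map_target hz)
  rw [(Q.chart z.1).right_inv hz] at h
  exact h

theorem normalField_comp_symm (horient : IsOrientedAtlas n M) (Y : M → E (n + 1))
    {e : OpenPartialHomeomorph M (E n)} (he : e ∈ atlas (E n) M) :
    (fun u => unitNormal (fderiv ℝ (Y ∘ e.symm) u)) =ᵐ[volume.restrict e.target]
      fun u => normalField Y (e.symm u) := by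
  filter_upwards [ae_restrict_mem e.open_target.measurableSet] with u hu
  rw [normalField_chart horient he Y (e.map_target hu), e.right_inv hu]

/-- Homogeneity absorbs the area density into the argument of `homogExt γ`. The integrand is then
continuous in the differential, also where the surface degenerates and has no normal. -/
theorem energy_eq (horient : IsOrientedAtlas n M) {γ : S n → ℝ} (hconv : IsConvexIntegrand γ)
    {Y : M → E (n + 1)} (hY : IsLocLip n Y) :
    energy γ Y = ∫ z, homogExt γ (crossVec (Q.grad Y z)) ∂Q.measure := by
  have hc := continuous_homogExt hconv
  obtain ⟨C, hC⟩ := (isCompact_closedBall (0 : E (n + 1)) 1).exists_bound_of_continuousOn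
    hc.continuousOn
  rw [energy, Q.integral_areaMeasure horient hY (C := C)]
  · refine integral_congr_ae ?_
    filter_upwards [Q.ae_mem_target] with z hz
    rw [Q.normalField_pt horient Y hz, mul_comm, ← homogExt_smul (norm_nonneg _),
      norm_smul_unitNormal]
  · intro e he
    have h1 : Measurable fun u => homogExt γ (unitNormal (fderiv ℝ (Y ∘ e.symm) u)) :=
      hc.measurable.comp (measurable_unitNormal.comp (measurable_fderiv ℝ _))
    refine h1.aestronglyMeasurable.congr ?_
    filter_upwards [normalField_comp_symm horient Y he] with u hu
    rw [hu, Function.comp_apply]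
  · intro p
    exact hC _ (mem_closedBall_zero_iff.mpr (norm_unitNormal_le (diff Y p)))

theorem enclosedVolume_eq (horient : IsOrientedAtlas n M) {Y : M → E (n + 1)}
    (hY : IsLocLip n Y) : enclosedVolume Y =
      (1 / ((n : ℝ) + 1)) * ∫ z, ⟪Y (Q.pt z), crossVec (Q.grad Y z)⟫ ∂Q.measure := by
  obtain ⟨C, hC⟩ := isCompact_univ.exists_bound_of_continuousOn hY.continuous.continuousOn
  rw [enclosedVolume, Q.integral_areaMeasure horient hY (C := C)]
  · congr 1
    refine integral_congr_ae ?_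
    filter_upwards [Q.ae_mem_target] with z hz
    rw [Q.normalField_pt horient Y hz, mul_comm, ← inner_smul_right, norm_smul_unitNormal]
  · intro e he
    have h1 : AEStronglyMeasurable (fun u => unitNormal (fderiv ℝ (Y ∘ e.symm) u))
        (volume.restrict e.target) :=
      (measurable_unitNormal.comp (measurable_fderiv ℝ _)).aestronglyMeasurable
    have h2 : AEStronglyMeasurable (Y ∘ e.symm) (volume.restrict e.target) :=
      (hY e he).continuousOn.aestronglyMeasurable e.open_target.measurableSet
    exact h2.inner (𝕜 := ℝ) (h1.congr (normalField_comp_symm horient Y he))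
  · intro p
    refine (abs_real_inner_le_norm _ _).trans ?_
    calc ‖Y p‖ * ‖normalField Y p‖ ≤ ‖Y p‖ * 1 := by
          gcongr
          exact norm_unitNormal_le _
      _ ≤ C := by rw [mul_one]; exact hC p (mem_univ p)

end ChartPartition

end AreaIntegral

/-! ### Expansions of polynomials -/

section Expansion

theorem exists_sum_remainder (n : ℕ) (a : ℕ → ℝ) (ha : ∀ r, n < r → a r = 0) :
    ∃ R : ℝ → ℝ, Continuous R ∧ ∀ s, ∑ r ∈ Finset.range (n + 1), s ^ r * a r =
      a 0 + a 1 * s + a 2 * s ^ 2 + s ^ 3 * R s := by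
  refine ⟨fun s => ∑ r ∈ Finset.range n, s ^ r * a (r + 3), by fun_prop, fun s => ?_⟩
  -- Padding with vanishing coefficients makes three terms available even when `n < 2`.
  have h1 : ∑ r ∈ Finset.range (n + 1), s ^ r * a r = ∑ r ∈ Finset.range (n + 3), s ^ r * a r := by
    refine Finset.sum_subset (Finset.range_mono (by omega)) fun r _ hr => ?_
    rw [ha r (by simpa using hr), mul_zero]
  rw [h1, Finset.sum_range_succ', Finset.sum_range_succ', Finset.sum_range_succ', Finset.mul_sum]
  have h2 : ∀ r, s ^ (r + 1 + 1 + 1) * a (r + 1 + 1 + 1) = s ^ 3 * (s ^ r * a (r + 3)) := fun r => by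
    ring
  simp only [h2]
  ring

theorem exists_pow_remainder (t : ℝ) (m : ℕ) : ∃ R : ℝ → ℝ, Continuous R ∧ ∀ s,
    (1 - t * s) ^ m = 1 - m * t * s + m * (m - 1) / 2 * t ^ 2 * s ^ 2 + s ^ 3 * R s := by
  induction m with
  | zero => exact ⟨fun _ => 0, continuous_const, fun s => by simp⟩
  | succ m ih =>
    obtain ⟨R, hR, h⟩ := ih
    refine ⟨fun s => R s * (1 - t * s) - m * (m - 1) / 2 * t ^ 3, by fun_prop, fun s => ?_⟩
    rw [pow_succ, h]
    push_cast
    ring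

theorem isLittleO_cube_mul {R : ℝ → ℝ} (hR : Continuous R) :
    (fun s : ℝ => s ^ 3 * R s) =o[𝓝 0] fun s => s ^ 2 := by
  have h1 : (fun s : ℝ => s * R s) =o[𝓝 0] fun _ => (1 : ℝ) := by
    rw [Asymptotics.isLittleO_one_iff]
    have : ContinuousAt (fun s : ℝ => s * R s) 0 := by fun_prop
    simpa [ContinuousAt] using this
  have h2 := (Asymptotics.isBigO_refl (fun s : ℝ => s ^ 2) (𝓝 0)).mul_isLittleO h1
  refine (h2.congr_left fun s => ?_).congr_right fun s => ?_ <;> ring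

open Polynomial in
theorem coeff_prod_one_sub {ι : Type*} (t : Finset ι) (k : ι → ℝ) :
    (∏ i ∈ t, (1 - C (k i) * X)).coeff 0 = 1 ∧
    (∏ i ∈ t, (1 - C (k i) * X)).coeff 1 = -∑ i ∈ t, k i ∧
    2 * (∏ i ∈ t, (1 - C (k i) * X)).coeff 2 = (∑ i ∈ t, k i) ^ 2 - ∑ i ∈ t, k i ^ 2 := by
  classical
  induction t using Finset.induction_on with
  | empty => simp [coeff_one]
  | insert i t hi ih =>
    obtain ⟨h0, h1, h2⟩ := ih
    have hs : ∀ p : ℝ[X], ∀ j, ((1 - C (k i) * X) * p).coeff (j + 1) =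
        p.coeff (j + 1) - k i * p.coeff j := fun p j => by
      rw [sub_mul, one_mul, mul_assoc, coeff_sub, coeff_C_mul, coeff_X_mul]
    rw [Finset.prod_insert hi, Finset.sum_insert hi, Finset.sum_insert hi]
    refine ⟨?_, ?_, ?_⟩
    · rw [mul_coeff_zero, h0]; simp
    · rw [hs _ 0, h0, h1]; ring
    · rw [hs _ 1, mul_sub, h2, h1]; ring

open Polynomial in
theorem coeff_of_sum_eq_prod {n : ℕ} {a : ℕ → ℝ} (ha : ∀ r, n < r → a r = 0) {ι : Type*}
    (t : Finset ι) {k : ι → ℝ} {d : ℝ}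
    (h : ∀ s : ℝ, ∑ r ∈ Finset.range (n + 1), s ^ r * a r = d * ∏ i ∈ t, (1 - s * k i)) :
    a 0 = d ∧ a 1 = -(∑ i ∈ t, k i) * d ∧
      2 * a 2 = ((∑ i ∈ t, k i) ^ 2 - ∑ i ∈ t, k i ^ 2) * d := by
  have h1 : (∑ r ∈ Finset.range (n + 1), C (a r) * X ^ r : ℝ[X]) =
      C d * ∏ i ∈ t, (1 - C (k i) * X) := by
    refine Polynomial.funext fun s => ?_
    rw [eval_finsetSum, eval_mul, eval_C, eval_prod]
    simp only [eval_mul, eval_C, eval_pow, eval_X, eval_sub, eval_one]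
    rw [← Finset.sum_congr rfl fun r _ => mul_comm (s ^ r) (a r), h s]
    simp only [mul_comm s]
  have h2 : ∀ j, (∑ r ∈ Finset.range (n + 1), C (a r) * X ^ r : ℝ[X]).coeff j = a j := fun j => by
    rw [finsetSum_coeff]
    simp only [coeff_C_mul, coeff_X_pow]
    by_cases hj : j ∈ Finset.range (n + 1)
    · rw [Finset.sum_eq_single j (fun b _ hb => by simp [hb.symm]) (fun h => absurd hj h)]
      simp
    · rw [ha j (by simpa using hj)]
      refine Finset.sum_eq_zero fun r hr => ?_
      have : j ≠ r := fun h => hj (h ▸ hr)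
      simp [this]
  obtain ⟨c0, c1, c2⟩ := coeff_prod_one_sub t k
  have h3 : ∀ j, a j = d * (∏ i ∈ t, (1 - C (k i) * X)).coeff j := fun j => by
    rw [← h2 j, h1, coeff_C_mul]
  refine ⟨?_, ?_, ?_⟩
  · rw [h3, c0, mul_one]
  · rw [h3, c1]; ring
  · rw [h3, ← c2]; ring

/-- The expansion of the energy after rescaling to constant volume. -/
theorem rescaled_expansion (n : ℕ) {Λ q₀ q₂ : ℝ} {R P T : ℝ → ℝ} (hR : Continuous R)
    (hP : ∀ s, P s = (1 - Λ * s) ^ (n + 1) + s ^ 3 * R s)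
    (hT : (fun s => T s - (q₀ - n * Λ * q₀ * s + q₂ * s ^ 2)) =o[𝓝 0] fun s => s ^ 2) :
    (fun s => (P s ^ (-(1 / ((n : ℝ) + 1)))) ^ n * T s -
      (q₀ + 0 * s + (q₂ - n * (n - 1) / 2 * Λ ^ 2 * q₀) * s ^ 2)) =o[𝓝 0] fun s => s ^ 2 := by
  set α : ℝ := n / ((n : ℝ) + 1) with hα
  have hn1 : (n : ℝ) + 1 ≠ 0 := by positivity
  have hPc : Continuous P := by
    have : P = fun s => (1 - Λ * s) ^ (n + 1) + s ^ 3 * R s := funext hP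
    rw [this]; fun_prop
  have hP0 : P 0 = 1 := by simp [hP]
  have hPpos : ∀ᶠ s in 𝓝 0, 0 < P s :=
    hPc.continuousAt.eventually (lt_mem_nhds (by rw [hP0]; exact one_pos))
  have hlin : ∀ᶠ s : ℝ in 𝓝 0, 0 < 1 - Λ * s := by
    have : ContinuousAt (fun s : ℝ => 1 - Λ * s) 0 := by fun_prop
    exact this.eventually (lt_mem_nhds (by simp))
  set m : ℝ → ℝ := fun s => (P s ^ (-(1 / ((n : ℝ) + 1)))) ^ n with hm
  have hmc : Tendsto m (𝓝 0) (𝓝 1) := by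
    have h1 : ContinuousAt m 0 :=
      (hPc.continuousAt.rpow_const (Or.inl (by rw [hP0]; exact one_ne_zero))).pow n
    have h2 : m 0 = 1 := by simp [hm, hP0]
    rw [← h2]; exact h1
  have hmg : ∀ᶠ s in 𝓝 0, m s * P s ^ α = 1 := by
    filter_upwards [hPpos] with s hs
    rw [hm]
    simp only
    rw [← Real.rpow_natCast, ← Real.rpow_mul hs.le, ← Real.rpow_add hs,
      show -(1 / ((n : ℝ) + 1)) * n + α = 0 by rw [hα]; ring, Real.rpow_zero]
  have hpow : ∀ᶠ s : ℝ in 𝓝 0, ((1 - Λ * s) ^ (n + 1)) ^ α = (1 - Λ * s) ^ n := by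
    filter_upwards [hlin] with s hs
    rw [← Real.rpow_natCast, ← Real.rpow_mul hs.le, ← Real.rpow_natCast (1 - Λ * s) n]
    congr 1
    rw [hα]; push_cast; field_simp
  -- The power function is Lipschitz near 1, and `P` differs from `(1 - Λs)ⁿ⁺¹` by a cubic term.
  have hg : (fun s => P s ^ α - (1 - Λ * s) ^ n) =o[𝓝 0] fun s => s ^ 2 := by
    have hstrict : HasStrictDerivAt (fun y : ℝ => y ^ α) (α * 1 ^ (α - 1)) 1 :=
      Real.hasStrictDerivAt_rpow_const_of_ne one_ne_zero α
    have h1 := hstrict.hasStrictFDerivAt.isBigO_sub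
    have h2 : Tendsto (fun s : ℝ => (P s, (1 - Λ * s) ^ (n + 1))) (𝓝 0) (𝓝 ((1 : ℝ), (1 : ℝ))) := by
      have h3 : ContinuousAt (fun s : ℝ => (P s, (1 - Λ * s) ^ (n + 1))) 0 :=
        (hPc.prodMk (by fun_prop)).continuousAt
      have h4 := h3.tendsto
      simpa [hP0] using h4
    have h3 := h1.comp_tendsto h2
    have h4 : (fun s => P s - (1 - Λ * s) ^ (n + 1)) =o[𝓝 0] fun s => s ^ 2 :=
      (isLittleO_cube_mul hR).congr_left fun s => by rw [hP]; ring
    refine (h3.trans_isLittleO h4).congr' ?_ EventuallyEq.rfl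
    filter_upwards [hpow] with s hs
    simp only [Function.comp_apply]
    rw [hs]
  obtain ⟨R₂, hR₂, hpw⟩ := exists_pow_remainder Λ n
  set b := q₂ - n * (n - 1) / 2 * Λ ^ 2 * q₀ with hb
  -- The rescaling factor is `P ^ (-α)`, so `T` is compared with `q₀ P ^ α` before the division. The
  -- linear terms cancel, and the quadratic ones leave `b`.
  have hmain : (fun s => T s - q₀ * P s ^ α - b * s ^ 2) =o[𝓝 0] fun s => s ^ 2 := by
    refine ((hT.sub (hg.const_mul_left q₀)).sub
      ((isLittleO_cube_mul hR₂).const_mul_left q₀)).congr_left fun s => ?_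
    rw [hpw, hb]; ring
  have h1 : (fun s => m s * (T s - q₀ * P s ^ α - b * s ^ 2)) =o[𝓝 0] fun s => s ^ 2 := by
    have := (hmc.isBigO_one ℝ).mul_isLittleO hmain
    simpa only [one_mul] using this
  have h2 : (fun s => (m s - 1) * (b * s ^ 2)) =o[𝓝 0] fun s => s ^ 2 := by
    have h3 : (fun s => m s - 1) =o[𝓝 0] fun _ => (1 : ℝ) := by
      rw [Asymptotics.isLittleO_one_iff]
      simpa using hmc.sub_const 1
    have h4 := h3.mul_isBigO ((Asymptotics.isBigO_refl (fun s : ℝ => s ^ 2) (𝓝 0)).const_mul_left b)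
    simpa only [one_mul] using h4
  refine (h1.add h2).congr' ?_ EventuallyEq.rfl
  filter_upwards [hmg] with s hs
  have : m s * (q₀ * P s ^ α) = q₀ := by rw [mul_left_comm, hs, mul_one]
  linear_combination -this

end Expansion

/-! ### The second variation of the energy -/

section SecondVariation

variable {n : ℕ} {γ : S n → ℝ}

/-- The pointwise structure of an anisotropic surface with mean curvature `Λ`: the map with
differential `L` has the unit normal `N`, its Cahn-Hoffman field `ξ` has differential `A`, and `k`
are the principal curvatures. -/
def PrincipalData (γ : S n → ℝ) (Λ : ℝ) (ξ : E (n + 1)) (L A : E n →L[ℝ] E (n + 1)) : Prop :=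
  ∃ (N : E (n + 1)) (k : Fin n → ℝ) (d : ℝ), ‖N‖ = 1 ∧ ξ = homogGrad γ N ∧ 0 < d ∧
    ∑ i, k i = n * Λ ∧ (∀ s : ℝ, crossVec (L + s • A) = (d * ∏ i, (1 - s * k i)) • N) ∧
    (Λ ≠ 0 → (∀ i, k i = Λ) → A = (-Λ) • L)

theorem crossCoeff_eq_zero {r : ℕ} (hr : n < r) (L M : E n →L[ℝ] E (n + 1)) :
    crossCoeff r L M = 0 := by
  rw [crossCoeff, Finset.powersetCard_eq_empty.mpr (by simpa using hr), Finset.sum_empty]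

theorem inner_crossCoeff_of_prod {L A : E n →L[ℝ] E (n + 1)} {N : E (n + 1)} {k : Fin n → ℝ} {d : ℝ}
    (h : ∀ s : ℝ, crossVec (L + s • A) = (d * ∏ i, (1 - s * k i)) • N) (v : E (n + 1)) :
    ⟪v, crossCoeff 0 L A⟫ = d * ⟪v, N⟫ ∧ ⟪v, crossCoeff 1 L A⟫ = -(∑ i, k i) * (d * ⟪v, N⟫) ∧
      2 * ⟪v, crossCoeff 2 L A⟫ = ((∑ i, k i) ^ 2 - ∑ i, k i ^ 2) * (d * ⟪v, N⟫) := by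
  refine coeff_of_sum_eq_prod (n := n) (a := fun r => ⟪v, crossCoeff r L A⟫)
    (fun r hr => by simp [crossCoeff_eq_zero hr]) Finset.univ fun s => ?_
  have h1 := congrArg (fun w => ⟪v, w⟫) (h s)
  rw [crossVec_add_smul, inner_sum, inner_smul_right] at h1
  simp only [inner_smul_right] at h1
  rw [h1]; ring

variable {Λ : ℝ} {ξ : E (n + 1)} {L A : E n →L[ℝ] E (n + 1)}

theorem PrincipalData.crossCoeff_one (h : PrincipalData γ Λ ξ L A) :
    crossCoeff 1 L A = (-(n * Λ)) • crossVec L := by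
  obtain ⟨N, k, d, -, -, -, hk, hc, -⟩ := h
  refine ext_inner_left ℝ fun v => ?_
  obtain ⟨h0, h1, -⟩ := inner_crossCoeff_of_prod hc v
  rw [crossCoeff_zero] at h0
  rw [h1, inner_smul_right, h0, hk]

theorem unit_ne_zero {N : E (n + 1)} (hN : ‖N‖ = 1) : N ≠ 0 := by
  rintro rfl
  simp at hN

theorem PrincipalData.inner_pos (hC2 : ContMDiff (𝓡 n) 𝓘(ℝ, ℝ) 2 γ) (hpos : ∀ ν, 0 < γ ν)
    (h : PrincipalData γ Λ ξ L A) : 0 < ⟪ξ, crossVec L⟫ := by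
  obtain ⟨N, k, d, hN, rfl, hd, hk, hc, -⟩ := h
  have h0 := (inner_crossCoeff_of_prod hc (homogGrad γ N)).1
  rw [crossCoeff_zero, inner_homogGrad_self hC2 (unit_ne_zero hN)] at h0
  rw [h0]
  exact mul_pos hd (homogExt_pos hpos (unit_ne_zero hN))

/-- The second elementary symmetric function is `((nΛ)² - ∑ kᵢ²) / 2`, so the difference equals `-½
∑ (kᵢ - Λ)²` times the positive number `d * homogExt γ N`. Equality forces every `kᵢ` to be `Λ`. -/
theorem PrincipalData.second_nonpos (hC2 : ContMDiff (𝓡 n) 𝓘(ℝ, ℝ) 2 γ) (hpos : ∀ ν, 0 < γ ν)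
    (h : PrincipalData γ Λ ξ L A) :
    ⟪ξ, crossCoeff 2 L A⟫ - n * (n - 1) / 2 * Λ ^ 2 * ⟪ξ, crossVec L⟫ ≤ 0 ∧
    (Λ ≠ 0 → ⟪ξ, crossCoeff 2 L A⟫ - n * (n - 1) / 2 * Λ ^ 2 * ⟪ξ, crossVec L⟫ = 0 →
      A = (-Λ) • L) := by
  obtain ⟨N, k, d, hN, rfl, hd, hk, hc, hA⟩ := h
  obtain ⟨h0, -, h2⟩ := inner_crossCoeff_of_prod hc (homogGrad γ N)
  rw [crossCoeff_zero] at h0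
  rw [inner_homogGrad_self hC2 (unit_ne_zero hN)] at h0 h2
  have hp : 0 < d * homogExt γ N := mul_pos hd (homogExt_pos hpos (unit_ne_zero hN))
  have hsum : ∑ i, (k i - Λ) ^ 2 = ∑ i, k i ^ 2 - n * Λ ^ 2 := by
    have : ∀ i, (k i - Λ) ^ 2 = k i ^ 2 - 2 * Λ * k i + Λ ^ 2 := fun i => by ring
    simp only [this]
    rw [Finset.sum_add_distrib, Finset.sum_sub_distrib, ← Finset.mul_sum, hk, Finset.sum_const,
      Finset.card_univ, Fintype.card_fin, nsmul_eq_mul]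
    ring
  have key : ⟪homogGrad γ N, crossCoeff 2 L A⟫ -
      n * (n - 1) / 2 * Λ ^ 2 * ⟪homogGrad γ N, crossVec L⟫ =
      -(1 / 2) * (∑ i, (k i - Λ) ^ 2) * (d * homogExt γ N) := by
    rw [hsum, h0]
    rw [hk] at h2
    linear_combination h2 / 2
  have hs0 : 0 ≤ ∑ i, (k i - Λ) ^ 2 := Finset.sum_nonneg fun i _ => sq_nonneg _
  rw [key]
  refine ⟨by nlinarith, fun hΛ h => hA hΛ fun i => ?_⟩
  have h3 : ∑ i, (k i - Λ) ^ 2 = 0 := by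
    rcases mul_eq_zero.mp h with h | h
    · linarith
    · exact absurd h hp.ne'
  have h4 := (Finset.sum_eq_zero_iff_of_nonneg fun i _ => sq_nonneg (k i - Λ)).mp h3 i
    (Finset.mem_univ i)
  exact sub_eq_zero.mp (pow_eq_zero_iff (two_ne_zero)|>.mp h4)

/-- The energy density of the variation agrees with its value by the Cahn-Hoffman field up to
second order. -/
theorem PrincipalData.abs_sub_le (hn : 1 ≤ n) (hC2 : ContMDiff (𝓡 n) 𝓘(ℝ, ℝ) 2 γ)
    (h : PrincipalData γ Λ ξ L A) {B D : ℝ} (hB : ∀ y, ‖y‖ ≤ 1 → |homogExt γ y| ≤ B)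
    (hD : ∑ r ∈ Finset.range (n + 1), ‖crossCoeff r L A‖ ≤ D) {s : ℝ} (hs : |s| ≤ 1)
    (hs' : n * Λ * s ≤ 1) :
    |homogExt γ (crossVec (L + s • A)) - ⟪ξ, crossVec (L + s • A)⟫| ≤ 2 * B * D * s ^ 2 := by
  obtain ⟨N, k, d, hN, rfl, hd, hk, hc, -⟩ := h
  have hN0 := unit_ne_zero hN
  have hB0 : 0 ≤ B := (abs_nonneg _).trans (hB N hN.le)
  have hD0 : 0 ≤ D := (Finset.sum_nonneg fun r _ => norm_nonneg _).trans hD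
  have hself : ⟪N, N⟫ = (1 : ℝ) := by rw [real_inner_self_eq_norm_sq, hN]; norm_num
  obtain ⟨h0, h1, -⟩ := inner_crossCoeff_of_prod hc N
  set t := d * ∏ i, (1 - s * k i) with ht
  have hct : crossVec (L + s • A) = t • N := hc s
  rw [hct, inner_smul_right, inner_homogGrad_self hC2 hN0]
  rcases le_or_gt 0 t with ht0 | ht0
  · rw [homogExt_smul ht0, sub_self, abs_zero]
    positivity
  -- The terms of order 0 and 1 in `t` are `d (1 - nΛs)`, which is nonnegative. Only the terms of
  -- order at least 2 can make `t` negative, whatever the size of the individual curvatures.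
  have htB : -t ≤ D * s ^ 2 := by
    have e1 : t = ∑ r ∈ Finset.range (n + 1), s ^ r * ⟪N, crossCoeff r L A⟫ := by
      have h2 := congrArg (fun w => ⟪N, w⟫) hct
      rw [inner_smul_right, hself, mul_one, crossVec_add_smul, inner_sum] at h2
      simp only [inner_smul_right] at h2
      exact h2.symm
    obtain ⟨m, rfl⟩ : ∃ m, n = m + 1 := ⟨n - 1, by omega⟩
    rw [Finset.sum_range_succ', Finset.sum_range_succ'] at e1
    rw [Finset.sum_range_succ', Finset.sum_range_succ'] at hD
    rw [zero_add, pow_one, pow_zero, one_mul, h0, h1, hk, hself, mul_one] at e1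
    have e2 : |∑ r ∈ Finset.range m, s ^ (r + 1 + 1) * ⟪N, crossCoeff (r + 1 + 1) L A⟫| ≤
        D * s ^ 2 := by
      calc |∑ r ∈ Finset.range m, s ^ (r + 1 + 1) * ⟪N, crossCoeff (r + 1 + 1) L A⟫|
          ≤ ∑ r ∈ Finset.range m, |s ^ (r + 1 + 1) * ⟪N, crossCoeff (r + 1 + 1) L A⟫| :=
            Finset.abs_sum_le_sum_abs _ _
        _ ≤ ∑ r ∈ Finset.range m, s ^ 2 * ‖crossCoeff (r + 1 + 1) L A‖ := by
            refine Finset.sum_le_sum fun r _ => ?_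
            rw [abs_mul, abs_pow, show r + 1 + 1 = r + 2 by ring, pow_add, ← sq_abs s]
            have e3 : |s| ^ r ≤ 1 := pow_le_one₀ (abs_nonneg s) hs
            have e4 : |⟪N, crossCoeff (r + 2) L A⟫| ≤ ‖crossCoeff (r + 2) L A‖ := by
              have := abs_real_inner_le_norm N (crossCoeff (r + 2) L A)
              rwa [hN, one_mul] at this
            calc |s| ^ r * |s| ^ 2 * |⟪N, crossCoeff (r + 2) L A⟫|
                ≤ 1 * |s| ^ 2 * ‖crossCoeff (r + 2) L A‖ := by gcongr
              _ = _ := by rw [one_mul]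
        _ = (∑ r ∈ Finset.range m, ‖crossCoeff (r + 1 + 1) L A‖) * s ^ 2 := by
            rw [← Finset.mul_sum, mul_comm]
        _ ≤ D * s ^ 2 := by
            gcongr
            linarith [norm_nonneg (crossCoeff (0 + 1) L A), norm_nonneg (crossCoeff 0 L A)]
    have e3 : 0 ≤ d * (1 - ((m + 1 : ℕ) : ℝ) * Λ * s) := mul_nonneg hd.le (by linarith)
    have e4 := (abs_le.mp e2).1
    nlinarith
  have e5 : homogExt γ (t • N) = -t * homogExt γ (-N) := by
    rw [← homogExt_smul (by linarith : 0 ≤ -t)]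
    congr 1
    module
  rw [e5]
  have e6 := hB N hN.le
  have e7 := hB (-N) (by rw [norm_neg, hN])
  calc |-t * homogExt γ (-N) - t * homogExt γ N| = -t * |homogExt γ (-N) + homogExt γ N| := by
        rw [show -t * homogExt γ (-N) - t * homogExt γ N =
          -t * (homogExt γ (-N) + homogExt γ N) by ring, abs_mul, abs_of_pos (by linarith : 0 < -t)]
    _ ≤ D * s ^ 2 * (B + B) := by
        gcongr
        · exact (abs_add_le _ _).trans (add_le_add e7 e6)
    _ = _ := by ring

/-- At a fixed point the factor `d ∏ (1 - s kᵢ)` is positive for small `s`. How small depends on the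
point, since the curvatures need not be bounded; the uniform bound `PrincipalData.abs_sub_le`
compensates for this. -/
theorem PrincipalData.eventually_eq (hC2 : ContMDiff (𝓡 n) 𝓘(ℝ, ℝ) 2 γ)
    (h : PrincipalData γ Λ ξ L A) : ∀ᶠ s : ℝ in 𝓝 0,
      homogExt γ (crossVec (L + s • A)) - ⟪ξ, crossVec (L + s • A)⟫ = 0 := by
  obtain ⟨N, k, d, hN, rfl, hd, hk, hc, -⟩ := h
  have h1 : ContinuousAt (fun s : ℝ => d * ∏ i, (1 - s * k i)) 0 := by fun_prop
  have h2 : ∀ᶠ s : ℝ in 𝓝 0, 0 < d * ∏ i, (1 - s * k i) :=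
    h1.eventually (lt_mem_nhds (by simpa using hd))
  filter_upwards [h2] with s hs
  rw [hc, homogExt_smul hs.le, inner_smul_right, inner_homogGrad_self hC2 (unit_ne_zero hN),
    sub_self]

end SecondVariation

/-! ### The second variation, integrated -/

section Integrated

variable {n : ℕ} {γ : S n → ℝ} {Ω : Type*} [MeasurableSpace Ω] {μ : Measure Ω} [IsFiniteMeasure μ]
  {x ξ : Ω → E (n + 1)} {L A : Ω → E n →L[ℝ] E (n + 1)}

theorem integral_inner_crossVec_add_smul
    (h : ∀ r, Integrable (fun z => ⟪x z, crossCoeff r (L z) (A z)⟫) μ) (s : ℝ) :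
    ∫ z, ⟪x z, crossVec (L z + s • A z)⟫ ∂μ =
      ∑ r ∈ Finset.range (n + 1), s ^ r * ∫ z, ⟪x z, crossCoeff r (L z) (A z)⟫ ∂μ := by
  simp only [crossVec_add_smul, inner_sum, inner_smul_right]
  rw [integral_finsetSum _ fun r _ => (h r).const_mul _]
  simp only [integral_const_mul]

theorem integral_inner_crossCoeff_one_add_smul (hn : 1 ≤ n)
    (h : ∀ r, Integrable (fun z => ⟪x z, crossCoeff r (L z) (A z)⟫) μ) (s : ℝ) :
    Integrable (fun z => ⟪x z, crossCoeff 1 (L z + s • A z) (A z)⟫) μ ∧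
    ∫ z, ⟪x z, crossCoeff 1 (L z + s • A z) (A z)⟫ ∂μ =
      ∑ r ∈ Finset.range (n + 1), r * s ^ (r - 1) * ∫ z, ⟪x z, crossCoeff r (L z) (A z)⟫ ∂μ := by
  have h1 : ∀ z, crossCoeff 1 (L z + s • A z) (A z) = _ :=
    fun z => crossCoeff_one_add_smul (L z) (A z) hn s
  simp only [h1, inner_sum, inner_smul_right]
  refine ⟨integrable_finsetSum _ fun r _ => (h r).const_mul _, ?_⟩
  rw [integral_finsetSum _ fun r _ => (h r).const_mul _]
  simp only [integral_const_mul]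

/-- The Minkowski formula for `X + sξ` is an identity of polynomials; its coefficient of `sʳ` is `(r
+ 1) aᵣ₊₁ + r qᵣ = n qᵣ`, used here for `r = 0` and `r = 1`. -/
theorem coeff_relations (hn : 1 ≤ n) {a q : ℕ → ℝ} (ha : ∀ r, n < r → a r = 0)
    (h : ∀ s : ℝ, ∑ r ∈ Finset.range (n + 1), r * s ^ (r - 1) * a r +
      s * ∑ r ∈ Finset.range (n + 1), r * s ^ (r - 1) * q r =
      n * ∑ r ∈ Finset.range (n + 1), s ^ r * q r) :
    a 1 = n * q 0 ∧ 2 * a 2 = (n - 1) * q 1 := by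
  have h1 : ∀ s : ℝ, ∑ r ∈ Finset.range (n + 1),
      s ^ r • ((r + 1 : ℝ) * a (r + 1) + r * q r - n * q r) = 0 := by
    intro s
    have e1 : ∑ r ∈ Finset.range (n + 1), s ^ r * ((r + 1 : ℝ) * a (r + 1)) =
        ∑ r ∈ Finset.range (n + 1), r * s ^ (r - 1) * a r := by
      rw [Finset.sum_range_succ, ha (n + 1) (by omega), Finset.sum_range_succ' (n := n)]
      simp only [Nat.cast_zero, zero_mul, mul_zero, add_zero, Nat.cast_add, Nat.cast_one,
        Nat.add_sub_cancel]
      exact Finset.sum_congr rfl fun r _ => by ring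
    have e2 : ∑ r ∈ Finset.range (n + 1), s ^ r * ((r : ℝ) * q r) =
        s * ∑ r ∈ Finset.range (n + 1), r * s ^ (r - 1) * q r := by
      rw [Finset.mul_sum]
      refine Finset.sum_congr rfl fun r _ => ?_
      rcases Nat.eq_zero_or_pos r with rfl | hr
      · simp
      · obtain ⟨m, rfl⟩ : ∃ m, r = m + 1 := ⟨r - 1, by omega⟩
        rw [Nat.add_sub_cancel]; ring
    have e3 : ∑ r ∈ Finset.range (n + 1), s ^ r * ((n : ℝ) * q r) =
        n * ∑ r ∈ Finset.range (n + 1), s ^ r * q r := by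
      rw [Finset.mul_sum]
      exact Finset.sum_congr rfl fun r _ => by ring
    have e0 : ∑ r ∈ Finset.range (n + 1), s ^ r • ((r + 1 : ℝ) * a (r + 1) + r * q r - n * q r) =
        ∑ r ∈ Finset.range (n + 1), s ^ r * ((r + 1 : ℝ) * a (r + 1)) +
        ∑ r ∈ Finset.range (n + 1), s ^ r * ((r : ℝ) * q r) -
        ∑ r ∈ Finset.range (n + 1), s ^ r * ((n : ℝ) * q r) := by
      rw [← Finset.sum_add_distrib, ← Finset.sum_sub_distrib]
      exact Finset.sum_congr rfl fun r _ => by rw [smul_eq_mul]; ring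
    rw [e0, e1, e2, e3, h s, sub_self]
  have r0 := eq_zero_of_forall_sum_pow_smul_eq_zero h1 (r := 0) (by omega)
  have r1 := eq_zero_of_forall_sum_pow_smul_eq_zero h1 (r := 1) (by omega)
  simp only [Nat.cast_zero, Nat.cast_one] at r0 r1
  norm_num at r0 r1
  exact ⟨by linarith, by linarith⟩

theorem exists_sum_norm_crossCoeff_bound
    (hb : ∃ C : ℝ, ∀ᵐ z ∂μ, ‖((x z, ξ z), (L z, A z))‖ ≤ C) :
    ∃ D : ℝ, ∀ᵐ z ∂μ, ∑ r ∈ Finset.range (n + 1), ‖crossCoeff r (L z) (A z)‖ ≤ D := by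
  obtain ⟨C, hC⟩ := hb
  choose D hD using fun r => bounded_crossCoeff (n := n) r C
  refine ⟨∑ r ∈ Finset.range (n + 1), D r, ?_⟩
  filter_upwards [hC] with z hz
  have h1 : ‖(L z, A z)‖ ≤ C := (le_max_right _ _).trans hz
  exact Finset.sum_le_sum fun r _ =>
    hD r _ _ ((le_max_left _ _).trans h1) ((le_max_right _ _).trans h1)

/-- Dominated convergence: divided by `s²`, the difference of the integrands is uniformly bounded,
and at almost every point it vanishes for small `s`. -/
theorem isLittleO_energy_sub (hn : 1 ≤ n) (hC2 : ContMDiff (𝓡 n) 𝓘(ℝ, ℝ) 2 γ)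
    (hconv : IsConvexIntegrand γ) {Λ D : ℝ}
    (hHs : ∀ s : ℝ, Integrable (fun z => homogExt γ (crossVec (L z + s • A z))) μ)
    (hξs : ∀ s : ℝ, Integrable (fun z => ⟪ξ z, crossVec (L z + s • A z)⟫) μ)
    (hD : ∀ᵐ z ∂μ, ∑ r ∈ Finset.range (n + 1), ‖crossCoeff r (L z) (A z)‖ ≤ D)
    (hpt : ∀ᵐ z ∂μ, PrincipalData γ Λ (ξ z) (L z) (A z)) :
    (fun s : ℝ => ∫ z, homogExt γ (crossVec (L z + s • A z)) ∂μ -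
      ∫ z, ⟪ξ z, crossVec (L z + s • A z)⟫ ∂μ) =o[𝓝 0] fun s => s ^ 2 := by
  obtain ⟨B, hB⟩ := (isCompact_closedBall (0 : E (n + 1)) 1).exists_bound_of_continuousOn
    (continuous_homogExt hconv).continuousOn
  set g : ℝ → Ω → ℝ := fun s z =>
    homogExt γ (crossVec (L z + s • A z)) - ⟪ξ z, crossVec (L z + s • A z)⟫ with hg
  have hgi : ∀ s, Integrable (g s) μ := fun s => (hHs s).sub (hξs s)
  have hdiff : ∀ s : ℝ, ∫ z, homogExt γ (crossVec (L z + s • A z)) ∂μ -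
      ∫ z, ⟪ξ z, crossVec (L z + s • A z)⟫ ∂μ = ∫ z, g s z ∂μ :=
    fun s => (integral_sub (hHs s) (hξs s)).symm
  have hbd : ∀ᶠ s : ℝ in 𝓝 0, ∀ᵐ z ∂μ, ‖(s ^ 2)⁻¹ * g s z‖ ≤ |2 * B * D| := by
    have c1 : ∀ᶠ s : ℝ in 𝓝 0, |s| ≤ 1 := by
      filter_upwards [closedBall_mem_nhds (0 : ℝ) one_pos] with s hs
      rwa [mem_closedBall_zero_iff] at hs
    have c2 : ∀ᶠ s : ℝ in 𝓝 0, n * Λ * s ≤ 1 := by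
      have : ContinuousAt (fun s : ℝ => n * Λ * s) 0 := by fun_prop
      filter_upwards [this.eventually (gt_mem_nhds (show n * Λ * 0 < 1 by simp))] with s hs
      exact hs.le
    filter_upwards [c1, c2] with s hs hs'
    filter_upwards [hpt, hD] with z hz hDz
    have := hz.abs_sub_le hn hC2 (fun y hy => hB y (mem_closedBall_zero_iff.mpr hy)) hDz hs hs'
    rw [norm_mul, norm_inv, Real.norm_eq_abs, Real.norm_eq_abs, abs_of_nonneg (sq_nonneg s)]
    rcases eq_or_ne s 0 with rfl | hs0
    · simp only [ne_eq, OfNat.ofNat_ne_zero, not_false_eq_true, zero_pow, inv_zero, zero_mul]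
      positivity
    · rw [inv_mul_le_iff₀ (by positivity), mul_comm]
      refine this.trans ?_
      gcongr
      exact le_abs_self _
  have hlim : Tendsto (fun s : ℝ => ∫ z, (s ^ 2)⁻¹ * g s z ∂μ) (𝓝 0) (𝓝 (∫ _, (0 : ℝ) ∂μ)) := by
    refine tendsto_integral_filter_of_dominated_convergence (fun _ => |2 * B * D|)
      (Eventually.of_forall fun s => ((hgi s).const_mul _).aestronglyMeasurable) hbd
      (integrable_const _) ?_
    filter_upwards [hpt] with z hz
    refine tendsto_const_nhds.congr' ?_
    filter_upwards [hz.eventually_eq hC2] with s hs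
    simp only [hg]
    rw [hs, mul_zero]
  rw [integral_zero] at hlim
  rw [Asymptotics.isLittleO_iff_tendsto']
  · refine hlim.congr fun s => ?_
    rw [hdiff, integral_const_mul, div_eq_inv_mul]
  · refine Eventually.of_forall fun s hs => ?_
    have hs0 : s = 0 := by simpa using hs
    rw [hdiff, hs0]
    refine integral_eq_zero_of_ae ?_
    filter_upwards [hpt] with z hz
    exact (hz.eventually_eq hC2).self_of_nhds

/-- The integrand is nonpositive and its integral is not negative, so it vanishes almost everywhere
and the equality case of the pointwise inequality applies. -/
theorem ae_eq_smul_of_second_coeff_nonneg (hC2 : ContMDiff (𝓡 n) 𝓘(ℝ, ℝ) 2 γ)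
    (hpos : ∀ ν, 0 < γ ν) {Λ : ℝ} (hΛ : Λ ≠ 0)
    (h0 : Integrable (fun z => ⟪ξ z, crossCoeff 0 (L z) (A z)⟫) μ)
    (h2 : Integrable (fun z => ⟪ξ z, crossCoeff 2 (L z) (A z)⟫) μ)
    (hpt : ∀ᵐ z ∂μ, PrincipalData γ Λ (ξ z) (L z) (A z))
    (hb : 0 ≤ ∫ z, ⟪ξ z, crossCoeff 2 (L z) (A z)⟫ ∂μ -
      n * (n - 1) / 2 * Λ ^ 2 * ∫ z, ⟪ξ z, crossCoeff 0 (L z) (A z)⟫ ∂μ) :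
    ∀ᵐ z ∂μ, A z = (-Λ) • L z := by
  simp only [crossCoeff_zero] at h0 hb
  set g : Ω → ℝ := fun z => ⟪ξ z, crossCoeff 2 (L z) (A z)⟫ -
    n * (n - 1) / 2 * Λ ^ 2 * ⟪ξ z, crossVec (L z)⟫ with hg
  have h1 : Integrable g μ := h2.sub (h0.const_mul _)
  rw [← integral_const_mul, ← integral_sub h2 (h0.const_mul _)] at hb
  have h3 : 0 ≤ᵐ[μ] fun z => -g z := by
    filter_upwards [hpt] with z hz
    exact neg_nonneg.mpr (hz.second_nonpos hC2 hpos).1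
  have h4 : ∫ z, -g z ∂μ = 0 := by
    refine le_antisymm ?_ (integral_nonneg_of_ae h3)
    rw [integral_neg]
    linarith
  filter_upwards [(integral_eq_zero_iff_of_nonneg_ae h3 h1.neg).mp h4, hpt] with z hz hz'
  exact (hz'.second_nonpos hC2 hpos).2 hΛ (neg_eq_zero.mp hz)

/-- With `aᵣ` and `qᵣ` the integrals of `crossCoeff r` against `x` and `ξ`, the Minkowski formula
and constancy of the mean curvature give `a₁ = n q₀ = -nΛ a₀`, `q₁ = -nΛ q₀` and `2 a₂ = (n - 1)
q₁`. Hence `q₀ = -Λ a₀`, and as `q₀ > 0`, neither `Λ` nor the volume is zero. The same relations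
make `p / p 0` agree with `(1 - Λs)ⁿ⁺¹` up to order 2. -/
theorem second_variation (hn : 1 ≤ n) (hC2 : ContMDiff (𝓡 n) 𝓘(ℝ, ℝ) 2 γ) (hpos : ∀ ν, 0 < γ ν)
    (hconv : IsConvexIntegrand γ) (hμ : μ ≠ 0) {Λ : ℝ}
    (hf : AEStronglyMeasurable (fun z => ((x z, ξ z), (L z, A z))) μ)
    (hb : ∃ C : ℝ, ∀ᵐ z ∂μ, ‖((x z, ξ z), (L z, A z))‖ ≤ C)
    (hvar : ∀ s : ℝ, ∫ z, ⟪x z + s • ξ z, crossCoeff 1 (L z + s • A z) (A z)⟫ ∂μ =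
      n * ∫ z, ⟪ξ z, crossVec (L z + s • A z)⟫ ∂μ)
    (hpt : ∀ᵐ z ∂μ, PrincipalData γ Λ (ξ z) (L z) (A z)) {p : ℝ → ℝ}
    (hp : ∀ s, p s = ∫ z, ⟪x z + s • ξ z, crossVec (L z + s • A z)⟫ ∂μ) :
    ContDiff ℝ ∞ p ∧ 0 < -Λ * p 0 ∧ ∃ b : ℝ,
      (fun s => ((p s / p 0) ^ (-(1 / ((n : ℝ) + 1)))) ^ n *
        ∫ z, homogExt γ (crossVec (L z + s • A z)) ∂μ -
        (∫ z, homogExt γ (crossVec (L z)) ∂μ + 0 * s + b * s ^ 2)) =o[𝓝 0] (fun s => s ^ 2) ∧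
      (0 ≤ b → ∀ᵐ z ∂μ, A z = (-Λ) • L z) := by
  haveI : ProperSpace (E n →L[ℝ] E (n + 1)) := FiniteDimensional.proper ℝ _
  have hH := continuous_homogExt hconv
  have hcc : ∀ r, Continuous fun v : (E (n + 1) × E (n + 1)) ×
      ((E n →L[ℝ] E (n + 1)) × (E n →L[ℝ] E (n + 1))) => crossCoeff r v.2.1 v.2.2 :=
    fun r => (continuous_crossCoeff r).comp continuous_snd
  have hcs : ∀ s : ℝ, Continuous fun v : (E (n + 1) × E (n + 1)) ×
      ((E n →L[ℝ] E (n + 1)) × (E n →L[ℝ] E (n + 1))) => crossVec (v.2.1 + s • v.2.2) :=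
    fun s => continuous_crossVec.comp ((continuous_fst.comp continuous_snd).add
      ((continuous_snd.comp continuous_snd).const_smul s))
  have hxi : ∀ r, Integrable (fun z => ⟪x z, crossCoeff r (L z) (A z)⟫) μ := fun r =>
    integrable_continuous_comp hf hb (Φ := fun v => ⟪v.1.1, crossCoeff r v.2.1 v.2.2⟫)
      ((continuous_fst.comp continuous_fst).inner (hcc r))
  have hξi : ∀ r, Integrable (fun z => ⟪ξ z, crossCoeff r (L z) (A z)⟫) μ := fun r =>
    integrable_continuous_comp hf hb (Φ := fun v => ⟪v.1.2, crossCoeff r v.2.1 v.2.2⟫)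
      ((continuous_snd.comp continuous_fst).inner (hcc r))
  have hxs : ∀ s : ℝ, Integrable (fun z => ⟪x z, crossVec (L z + s • A z)⟫) μ := fun s =>
    integrable_continuous_comp hf hb (Φ := fun v => ⟪v.1.1, crossVec (v.2.1 + s • v.2.2)⟫)
      ((continuous_fst.comp continuous_fst).inner (hcs s))
  have hξs : ∀ s : ℝ, Integrable (fun z => ⟪ξ z, crossVec (L z + s • A z)⟫) μ := fun s =>
    integrable_continuous_comp hf hb (Φ := fun v => ⟪v.1.2, crossVec (v.2.1 + s • v.2.2)⟫)
      ((continuous_snd.comp continuous_fst).inner (hcs s))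
  have hHs : ∀ s : ℝ, Integrable (fun z => homogExt γ (crossVec (L z + s • A z))) μ := fun s =>
    integrable_continuous_comp hf hb (Φ := fun v => homogExt γ (crossVec (v.2.1 + s • v.2.2)))
      (hH.comp (hcs s))
  set a : ℕ → ℝ := fun r => ∫ z, ⟪x z, crossCoeff r (L z) (A z)⟫ ∂μ with ha
  set q : ℕ → ℝ := fun r => ∫ z, ⟪ξ z, crossCoeff r (L z) (A z)⟫ ∂μ with hq
  have ha0 : ∀ r, n < r → a r = 0 := fun r hr => by simp [ha, crossCoeff_eq_zero hr]
  have hq0 : ∀ r, n < r → q r = 0 := fun r hr => by simp [hq, crossCoeff_eq_zero hr]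
  have hqs : ∀ s : ℝ, ∫ z, ⟪ξ z, crossVec (L z + s • A z)⟫ ∂μ =
      ∑ r ∈ Finset.range (n + 1), s ^ r * q r := integral_inner_crossVec_add_smul hξi
  have hps : ∀ s, p s = ∑ r ∈ Finset.range (n + 1), s ^ r * a r +
      s * ∑ r ∈ Finset.range (n + 1), s ^ r * q r := by
    intro s
    rw [hp]
    simp only [inner_add_left, inner_smul_left, conj_trivial]
    rw [integral_add (hxs s) ((hξs s).const_mul s), integral_const_mul, hqs,
      integral_inner_crossVec_add_smul hxi]
  obtain ⟨r1, r2⟩ : a 1 = n * q 0 ∧ 2 * a 2 = (n - 1) * q 1 := by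
    refine coeff_relations hn ha0 fun s => ?_
    obtain ⟨i1, e1⟩ := integral_inner_crossCoeff_one_add_smul hn hxi s
    obtain ⟨i2, e2⟩ := integral_inner_crossCoeff_one_add_smul hn hξi s
    rw [← hqs, ← hvar]
    simp only [inner_add_left, inner_smul_left, conj_trivial]
    rw [integral_add i1 (i2.const_mul s), integral_const_mul, e1, e2]
  have r3 : a 1 = -(n * Λ) * a 0 := by
    simp only [ha, crossCoeff_zero]
    rw [← integral_const_mul]
    refine integral_congr_ae ?_
    filter_upwards [hpt] with z hz
    rw [hz.crossCoeff_one, inner_smul_right]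
  have r4 : q 1 = -(n * Λ) * q 0 := by
    simp only [hq, crossCoeff_zero]
    rw [← integral_const_mul]
    refine integral_congr_ae ?_
    filter_upwards [hpt] with z hz
    rw [hz.crossCoeff_one, inner_smul_right]
  have hn0 : (n : ℝ) ≠ 0 := by positivity
  have r5 : q 0 = -Λ * a 0 := by
    have : (n : ℝ) * q 0 = n * (-Λ * a 0) := by rw [← r1, r3]; ring
    exact mul_left_cancel₀ hn0 this
  have hp0 : p 0 = a 0 := by
    rw [hps, Finset.sum_range_succ']
    simp
  have hq0pos : 0 < q 0 := by
    simp only [hq, crossCoeff_zero]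
    rw [integral_pos_iff_support_of_nonneg_ae]
    · have h1 : ∀ᵐ z ∂μ, z ∈ Function.support fun z => ⟪ξ z, crossVec (L z)⟫ := by
        filter_upwards [hpt] with z hz
        exact (hz.inner_pos hC2 hpos).ne'
      have h2 : μ (Function.support fun z => ⟪ξ z, crossVec (L z)⟫) = μ univ :=
        measure_congr (eventuallyEq_univ.mpr h1)
      rw [h2]
      exact Measure.measure_univ_pos.mpr hμ
    · filter_upwards [hpt] with z hz
      exact (hz.inner_pos hC2 hpos).le
    · simpa only [crossCoeff_zero] using hξi 0
  have hΛa : 0 < -Λ * a 0 := r5 ▸ hq0pos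
  have ha0ne : a 0 ≠ 0 := fun h => by simp [h] at hΛa
  have hΛne : Λ ≠ 0 := fun h => by simp [h] at hΛa
  refine ⟨?_, by rwa [hp0], q 2 - n * (n - 1) / 2 * Λ ^ 2 * q 0, ?_, ?_⟩
  · rw [show p = _ from funext hps]
    fun_prop
  · obtain ⟨R₁, hR₁, h1⟩ := exists_sum_remainder n a ha0
    obtain ⟨R₂, hR₂, h2⟩ := exists_sum_remainder n q hq0
    obtain ⟨R₃, hR₃, h3⟩ := exists_pow_remainder Λ (n + 1)
    set T : ℝ → ℝ := fun s => ∫ z, homogExt γ (crossVec (L z + s • A z)) ∂μ with hT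
    have hcorr : (fun s => T s - ∫ z, ⟪ξ z, crossVec (L z + s • A z)⟫ ∂μ) =o[𝓝 0]
        fun s => s ^ 2 := by
      obtain ⟨D, hD⟩ := exists_sum_norm_crossCoeff_bound hb
      exact isLittleO_energy_sub hn hC2 hconv hHs hξs hD hpt
    have hT0 : ∫ z, homogExt γ (crossVec (L z)) ∂μ = q 0 := by
      simp only [hq, crossCoeff_zero]
      refine integral_congr_ae ?_
      filter_upwards [hpt] with z hz
      have := (hz.eventually_eq hC2).self_of_nhds
      have h0 : L z + (0 : ℝ) • A z = L z := by ext v : 1; simp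
      rwa [h0, sub_eq_zero] at this
    rw [hT0]
    -- Since `p` is the polynomial of the `aᵣ` plus `s` times that of the `qᵣ`, its cubic remainder
    -- collects `R₁`, `q₂` and `s R₂`; `R₃` is the remainder of `(1 - Λs)ⁿ⁺¹`.
    refine rescaled_expansion n
      (R := fun s => (R₁ s + q 2 + s * R₂ s) / a 0 - R₃ s) (P := fun s => p s / p 0)
      (by fun_prop) (fun s => ?_) ?_
    · rw [hp0, hps, h1, h2, h3]
      field_simp
      push_cast
      have r6 : 2 * a 2 = (n - 1) * (n * Λ ^ 2 * a 0) := by rw [r2, r4, r5]; ring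
      have r7 : q 1 = n * Λ ^ 2 * a 0 := by rw [r4, r5]; ring
      rw [r3, r5, r7]
      linear_combination s ^ 2 * r6
    · refine (hcorr.add (isLittleO_cube_mul hR₂)).congr_left fun s => ?_
      rw [hqs, h2, r4]
      ring
  · intro hb0
    refine ae_eq_smul_of_second_coeff_nonneg hC2 hpos hΛne (hξi 0) (hξi 2) hpt ?_
    simpa only [hq] using hb0

end Integrated

/-! ### The principal curvatures at the regular points -/

section Regular

variable {n : ℕ} {γ : S n → ℝ}

/-- Differentiating `|ν|² = 1` shows that `dν` takes values in `ν^⊥`. Differentiating `⟪ν, df⟫ = 0`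
and using the symmetry of `D²f` gives the symmetry of the second fundamental form. The semidefinite
factor is the Hessian of `homogExt γ` at `ν`, which annihilates `ν`. -/
theorem exists_principal_of_normal (hC2 : ContMDiff (𝓡 n) 𝓘(ℝ, ℝ) 2 γ)
    (hconv : IsConvexIntegrand γ) {f ν : E n → E (n + 1)} {u : E n} (hf : ContDiffAt ℝ 2 f u)
    (hν : DifferentiableAt ℝ ν u) (hfi : Function.Injective (fderiv ℝ f u))
    (hνf : ∀ᶠ v in 𝓝 u, ν v = unitNormal (fderiv ℝ f v) ∧ ‖ν v‖ = 1) :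
    ∃ (T : E n →L[ℝ] E n) (k : Fin n → ℝ),
      HasFDerivAt (fun v => homogGrad γ (ν v)) (-(fderiv ℝ f u ∘L T)) u ∧
      (∀ s : ℝ, (1 - s • T).det = ∏ i, (1 - s * k i)) ∧
      LinearMap.trace ℝ (E n) (T : E n →ₗ[ℝ] E n) = ∑ i, k i ∧
      ∀ c ≠ 0, (∀ i, k i = c) → T = c • 1 := by
  obtain ⟨hνu, hνu1⟩ := hνf.self_of_nhds
  have hN0 := unit_ne_zero hνu1
  have hdf : DifferentiableAt ℝ (fderiv ℝ f) u :=
    (hf.fderiv_right (m := 1) (by norm_num)).differentiableAt (by norm_num)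
  have hBN : ∀ v, ⟪ν u, fderiv ℝ ν u v⟫ = 0 := by
    intro v
    have h1 := fderiv_inner_apply ℝ hν hν v
    have h2 : (fun t => ⟪ν t, ν t⟫) =ᶠ[𝓝 u] fun _ => (1 : ℝ) := by
      filter_upwards [hνf] with t ht
      rw [real_inner_self_eq_norm_sq, ht.2]; norm_num
    rw [h2.fderiv_eq, fderiv_const_apply, zero_apply, real_inner_comm (ν u)] at h1
    linarith
  have hdiff : ∀ v w, ⟪ν u, fderiv ℝ (fderiv ℝ f) u w v⟫ + ⟪fderiv ℝ ν u w, fderiv ℝ f u v⟫ = 0 := by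
    intro v w
    have h0 : DifferentiableAt ℝ (fun t => fderiv ℝ f t v) u :=
      hdf.clm_apply (differentiableAt_const v)
    have h1 := fderiv_inner_apply ℝ hν h0 w
    have h2 : (fun t => ⟪ν t, fderiv ℝ f t v⟫) =ᶠ[𝓝 u] fun _ => (0 : ℝ) := by
      filter_upwards [hνf] with t ht
      rw [ht.1, inner_unitNormal_apply]
    have h3 : fderiv ℝ (fun t => fderiv ℝ f t v) u w = fderiv ℝ (fderiv ℝ f) u w v := by
      rw [(hdf.hasFDerivAt.clm_apply (hasFDerivAt_const v u)).fderiv]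
      simp
    rw [h2.fderiv_eq, fderiv_const_apply, zero_apply, h3] at h1
    exact h1.symm
  have hs := hf.isSymmSndFDerivAt (by simp)
  have hB : ∀ v w, ⟪fderiv ℝ f u v, fderiv ℝ ν u w⟫ = ⟪fderiv ℝ f u w, fderiv ℝ ν u v⟫ := by
    intro v w
    have h1 := hdiff v w
    have h2 := hdiff w v
    rw [hs w v] at h1
    rw [real_inner_comm, real_inner_comm (fderiv ℝ ν u v)]
    linarith
  obtain ⟨T, k, hT, hdet, htr, hc⟩ := exists_principal hfi hνu1
    (fun v => by rw [hνu]; exact inner_unitNormal_apply _ v)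
    (fderiv_homogGrad_symm hC2 hN0) (fderiv_homogGrad_nonneg hC2 hconv hN0)
    (fderiv_homogGrad_self hC2 hconv hN0) hBN hB
  refine ⟨T, k, ?_, hdet, htr, hc⟩
  rw [← hT]
  exact (hasFDerivAt_homogGrad hC2 hN0).comp u hν.hasFDerivAt

theorem principalData_of_trace {f ν : E n → E (n + 1)} {u : E n} {Λ : ℝ}
    (hfi : Function.Injective (fderiv ℝ f u)) (hν : ν u = unitNormal (fderiv ℝ f u))
    {T : E n →L[ℝ] E n} {k : Fin n → ℝ}
    (hT : HasFDerivAt (fun v => homogGrad γ (ν v)) (-(fderiv ℝ f u ∘L T)) u)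
    (hdet : ∀ s : ℝ, (1 - s • T).det = ∏ i, (1 - s * k i)) (hk : ∑ i, k i = n * Λ)
    (hc : ∀ c ≠ 0, (∀ i, k i = c) → T = c • 1) :
    PrincipalData γ Λ (homogGrad γ (ν u)) (fderiv ℝ f u)
      (fderiv ℝ (fun v => homogGrad γ (ν v)) u) := by
  refine ⟨ν u, k, ‖crossVec (fderiv ℝ f u)‖, hν ▸ norm_unitNormal hfi, rfl,
    norm_pos_iff.mpr (crossVec_ne_zero hfi), hk, fun s => ?_, fun hΛ hkΛ => ?_⟩
  · have h1 : fderiv ℝ f u + s • fderiv ℝ (fun v => homogGrad γ (ν v)) u =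
        fderiv ℝ f u ∘L (1 - s • T) := by
      rw [hT.fderiv]
      ext v : 1
      simp only [add_apply, smul_apply, neg_apply, ContinuousLinearMap.comp_apply, sub_apply,
        ContinuousLinearMap.one_apply, map_sub, map_smul, smul_neg]
      rw [sub_eq_add_neg]
    rw [h1, crossVec_comp, hdet, hν, mul_comm, mul_smul, norm_smul_unitNormal]
  · rw [hT.fderiv, hc Λ hΛ hkΛ]
    ext v : 1
    simp

variable {M : Type*} [TopologicalSpace M] [ChartedSpace (E n) M] [IsManifold (𝓡 n) ∞ M]

/-- The shape operator is written in the preferred chart at `p`; in another chart it is conjugated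
by the differential of the chart change, which leaves the trace alone. -/
theorem trace_shapeOp (horient : IsOrientedAtlas n M) {e : OpenPartialHomeomorph M (E n)}
    (he : e ∈ atlas (E n) M) {X : M → E (n + 1)} {p : M} (hp : p ∈ e.source)
    (hXi : Function.Injective (diff X p)) {T : E n →L[ℝ] E n}
    (hT : fderiv ℝ ((fun q => cahnHoffman γ (normalField X q)) ∘ e.symm) (e p) =
      -(fderiv ℝ (X ∘ e.symm) (e p) ∘L T)) :
    LinearMap.trace ℝ (E n) (shapeOp γ X p) = LinearMap.trace ℝ (E n) (T : E n →ₗ[ℝ] E n) := by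
  set c := fderiv ℝ ((chartAt (E n) p).symm.trans e) (chartAt (E n) p p) with hc
  have hdet : c.det ≠ 0 :=
    (det_chartChange_pos horient (chart_mem_atlas _ p) he (mem_chart_source _ p) hp).ne'
  set g := c.toContinuousLinearEquivOfDetNeZero hdet with hg
  have hX : diff X p = fderiv ℝ (X ∘ e.symm) (e p) ∘L c := mfderiv_eq_fderiv_chart he X hp
  have hξ : diff (fun q => cahnHoffman γ (normalField X q)) p =
      (-(fderiv ℝ (X ∘ e.symm) (e p) ∘L T)) ∘L c := by
    rw [← hT]
    exact mfderiv_eq_fderiv_chart he (fun q => cahnHoffman γ (normalField X q)) hp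
  have hgc : ∀ v, c v = g v := fun v => rfl
  have hS : shapeOp γ X p = (g.symm.toLinearEquiv : E n ≃ₗ[ℝ] E n).conj (T : E n →ₗ[ℝ] E n) := by
    ext1 v
    rw [shapeOp, hξ]
    have h1 : ((-(fderiv ℝ (X ∘ e.symm) (e p) ∘L T)) ∘L c) v = -(diff X p (g.symm (T (c v)))) := by
      rw [hX]
      simp only [ContinuousLinearMap.comp_apply, neg_apply]
      rw [hgc (g.symm _), g.apply_symm_apply]
    simp only [LinearMap.neg_apply, ContinuousLinearMap.coe_coe, ContinuousLinearMap.comp_apply]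
    rw [ContinuousLinearMap.comp_apply] at h1
    rw [h1, map_neg, leftInv_apply hXi, neg_neg]
    rfl
  rw [hS, LinearMap.trace_conj']

variable [T2Space M] {k : ℕ} {P : Fin k → Set M} {X : M → E (n + 1)} {ν : Fin k → M → E (n + 1)}

/-- On a CAMC surface the Cahn-Hoffman fields of the pieces fit together. -/
theorem exists_cahnField (hC2 : ContMDiff (𝓡 n) 𝓘(ℝ, ℝ) 2 γ) (hconv : IsConvexIntegrand γ)
    (hP : IsDecomposition (n := n) P) (hX : IsWeakImmersion P X ν) (hCAMC : IsCAMC γ P X ν) :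
    ∃ ξ : M → E (n + 1), ∀ i, ∀ p ∈ P i, ξ p = homogGrad γ (ν i p) := by
  have hcov : ∀ p, ∃ i, p ∈ P i := fun p => mem_iUnion.mp (hP.iUnion_eq ▸ mem_univ p)
  choose ι hι using hcov
  refine ⟨fun p => homogGrad γ (ν (ι p) p), fun i p hp => ?_⟩
  by_cases hij : i = ι p
  · rw [hij]
  have hni := hX.normal_unit i p hp
  have hnj := hX.normal_unit (ι p) p (hι p)
  -- With Euler's relation, half of the edge condition says that the Cahn–Hoffman vector of the
  -- other sheet attains the support bound at the normal of this one; uniqueness of the supporting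
  -- vector concludes.
  have h1 := (hCAMC.2 i (ι p) hij p (hP.inter_eq i (ι p) hij ▸ ⟨hp, hι p⟩)).1
  rw [cahnHoffman_eq hC2 hni, cahnHoffman_eq hC2 hnj, inner_sub_left,
    inner_homogGrad_self hC2 (unit_ne_zero hni), sub_eq_zero] at h1
  exact (eq_homogGrad_of_inner_eq hC2 (inner_homogGrad_le hC2 hconv (unit_ne_zero hnj))
    (unit_ne_zero hni) h1.symm).symm

theorem contMDiffOn_cahnField (hC2 : ContMDiff (𝓡 n) 𝓘(ℝ, ℝ) 2 γ) (hX : IsWeakImmersion P X ν)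
    {ξ : M → E (n + 1)} (hξ : ∀ i, ∀ p ∈ P i, ξ p = homogGrad γ (ν i p)) (i : Fin k) :
    ContMDiffOn (𝓡 n) 𝓘(ℝ, E (n + 1)) 1 ξ (P i) := by
  refine ContMDiffOn.congr (fun p hp => ?_) (hξ i)
  have h1 := contDiffAt_homogGrad hC2 (unit_ne_zero (hX.normal_unit i p hp))
  exact h1.contMDiffAt.comp_contMDiffWithinAt p (hX.normal_contMDiffOn i p hp)

theorem continuous_of_pieces (hP : IsDecomposition (n := n) P) {F : Type*} [TopologicalSpace F]
    {Y : M → F} (hY : ∀ i, ContinuousOn Y (P i)) : Continuous Y :=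
  (locallyFinite_of_finite P).continuous hP.iUnion_eq (fun i => (hP.isCompact i).isClosed) hY

/-- Besides the curvature data, the orthogonality of `νᵢ` to both `dX` and `dξ` is recorded: it
makes `νᵢ` a normal field of every `X + sξ`. -/
theorem principalData_of_mem_interior (hn : 1 ≤ n) (hC2 : ContMDiff (𝓡 n) 𝓘(ℝ, ℝ) 2 γ)
    (hconv : IsConvexIntegrand γ) (horient : IsOrientedAtlas n M) (hX : IsWeakImmersion P X ν)
    {Λ : ℝ} (hΛ : ∀ i, ∀ p ∈ interior (P i), meanCurvature γ X 1 p = Λ)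
    {ξ : M → E (n + 1)} (hξ : ∀ i, ∀ p ∈ P i, ξ p = homogGrad γ (ν i p))
    {e : OpenPartialHomeomorph M (E n)} (he : e ∈ atlas (E n) M) {p : M} (hp : p ∈ e.source)
    {i : Fin k} (hpi : p ∈ interior (P i)) :
    PrincipalData γ Λ (ξ p) (fderiv ℝ (X ∘ e.symm) (e p)) (fderiv ℝ (ξ ∘ e.symm) (e p)) ∧
      DifferentiableAt ℝ (ξ ∘ e.symm) (e p) ∧
      (∀ v, ⟪ν i p, fderiv ℝ (X ∘ e.symm) (e p) v⟫ = 0) ∧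
      (∀ v, ⟪ν i p, fderiv ℝ (ξ ∘ e.symm) (e p) v⟫ = 0) := by
  have hin : ∀ᶠ v in 𝓝 (e p), e.symm v ∈ interior (P i) ∧ v ∈ e.target :=
    (eventually_chart hp (isOpen_interior.mem_nhds hpi)).and
      (e.open_target.mem_nhds (e.map_source hp))
  have hf : ContDiffAt ℝ 2 (X ∘ e.symm) (e p) :=
    contDiffAt_chart (m := 2) he hp (hX.contMDiffOn i) hpi
  have hν : DifferentiableAt ℝ (ν i ∘ e.symm) (e p) := by
    have h1 : ContDiffAt ℝ 1 (ν i ∘ e.symm) (e p) := by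
      have := contDiffAt_chart (m := 1) he hp (hX.normal_contMDiffOn i) hpi
      simpa using this
    exact h1.differentiableAt (by norm_num)
  have hνf : ∀ᶠ v in 𝓝 (e p), (ν i ∘ e.symm) v = unitNormal (fderiv ℝ (X ∘ e.symm) v) ∧
      ‖(ν i ∘ e.symm) v‖ = 1 := by
    filter_upwards [hin] with v hv
    rw [Function.comp_apply]
    refine ⟨?_, hX.normal_unit i _ (interior_subset hv.1)⟩
    rw [hX.normal_eq i _ hv.1, normalField_chart horient he X (e.map_target hv.2),
      e.right_inv hv.2]
  have hXi := hX.immersion i p hpi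
  have hfi : Function.Injective (fderiv ℝ (X ∘ e.symm) (e p)) := by
    set c := fderiv ℝ ((chartAt (E n) p).symm.trans e) (chartAt (E n) p p) with hc
    have hdet : c.det ≠ 0 :=
      (det_chartChange_pos horient (chart_mem_atlas _ p) he (mem_chart_source _ p) hp).ne'
    have hX' : diff X p = fderiv ℝ (X ∘ e.symm) (e p) ∘L c := mfderiv_eq_fderiv_chart he X hp
    intro v w hvw
    set g := c.toContinuousLinearEquivOfDetNeZero hdet
    have h1 : ∀ v, c (g.symm v) = v := fun v => g.apply_symm_apply v
    have h2 : diff X p (g.symm v) = diff X p (g.symm w) := by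
      rw [hX', ContinuousLinearMap.comp_apply, ContinuousLinearMap.comp_apply, h1, h1, hvw]
    exact g.symm.injective (hXi h2)
  obtain ⟨T, κ, hT, hdet, htr, hc⟩ := exists_principal_of_normal hC2 hconv hf hν hfi hνf
  have hξe : ξ ∘ e.symm =ᶠ[𝓝 (e p)] fun v => homogGrad γ ((ν i ∘ e.symm) v) := by
    filter_upwards [hin] with v hv
    exact hξ i _ (interior_subset hv.1)
  have hcξ : (fun q => cahnHoffman γ (normalField X q)) ∘ e.symm =ᶠ[𝓝 (e p)]
      fun v => homogGrad γ ((ν i ∘ e.symm) v) := by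
    filter_upwards [hin] with v hv
    have := hX.normal_eq i _ hv.1
    rw [Function.comp_apply, ← this,
      cahnHoffman_eq hC2 (hX.normal_unit i _ (interior_subset hv.1))]
    rfl
  have hsum : ∑ j, κ j = n * Λ := by
    have h1 := hΛ i p hpi
    rw [meanCurvature_one, trace_shapeOp horient he hp hXi
      (hcξ.fderiv_eq.trans hT.fderiv), htr] at h1
    have hn0 : (n : ℝ) ≠ 0 := by positivity
    rw [← h1]
    field_simp
  have hpt := principalData_of_trace hfi hνf.self_of_nhds.1 hT hdet hsum hc
  have hνp : (ν i ∘ e.symm) (e p) = ν i p := by rw [Function.comp_apply, e.left_inv hp]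
  have hperp : ∀ v, ⟪ν i p, fderiv ℝ (X ∘ e.symm) (e p) v⟫ = 0 := fun v => by
    rw [← hνp, hνf.self_of_nhds.1]
    exact inner_unitNormal_apply _ v
  refine ⟨?_, ?_, hperp, fun v => ?_⟩
  · rw [hξe.fderiv_eq, hξ i p (interior_subset hpi), ← hνp]
    exact hpt
  · exact hT.differentiableAt.congr_of_eventuallyEq hξe
  · rw [hξe.fderiv_eq, hT.fderiv, neg_apply, inner_neg_right, ContinuousLinearMap.comp_apply,
      hperp, neg_zero]

end Regular

/-! ### Rescaled linear variations -/

section RescaledVariation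

theorem contDiffAt_iteratedDeriv {F : Type*} [NormedAddCommGroup F] [NormedSpace ℝ F] {f : ℝ → F}
    {t : ℝ} (hf : ContDiffAt ℝ ∞ f t) (j : ℕ) : ContDiffAt ℝ 1 (iteratedDeriv j f) t := by
  rw [iteratedDeriv_eq_equiv_comp]
  exact ((ContinuousMultilinearMap.piFieldEquiv ℝ (Fin j) F).symm.toContinuousLinearEquiv.contDiff
    |>.contDiffAt).comp t (hf.iteratedFDeriv_right (by exact_mod_cast le_top))

theorem iteratedDeriv_smul_add_smul {F : Type*} [NormedAddCommGroup F] [NormedSpace ℝ F]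
    {f g : ℝ → ℝ} {t : ℝ} (hf : ContDiffAt ℝ ∞ f t) (hg : ContDiffAt ℝ ∞ g t) (v w : F) (j : ℕ) :
    iteratedDeriv j (fun s => f s • v + g s • w) t =
      iteratedDeriv j f t • v + iteratedDeriv j g t • w := by
  have hf' : ContDiffAt ℝ j f t := hf.of_le (by exact_mod_cast le_top)
  have hg' : ContDiffAt ℝ j g t := hg.of_le (by exact_mod_cast le_top)
  have hfv : ContDiffAt ℝ j (fun s => f s • v) t := hf'.smul contDiffAt_const
  have hgw : ContDiffAt ℝ j (fun s => g s • w) t := hg'.smul contDiffAt_const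
  rw [iteratedDeriv_fun_add hfv hgw, iteratedDeriv_smul_const hf', iteratedDeriv_smul_const hg']

variable {n : ℕ} {M : Type*} [TopologicalSpace M] [ChartedSpace (E n) M] [IsManifold (𝓡 n) ∞ M]
  {k : ℕ} {P : Fin k → Set M} {X ξ : M → E (n + 1)} {ν : Fin k → M → E (n + 1)}

theorem contMDiffOn_smul_comp {I : Set ℝ} {f : ℝ → ℝ} (hf : ∀ t ∈ I, ContDiffAt ℝ 1 f t)
    {s : Set M} (hX : ContMDiffOn (𝓡 n) 𝓘(ℝ, E (n + 1)) 1 X s) :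
    ContMDiffOn (𝓘(ℝ, ℝ).prod (𝓡 n)) 𝓘(ℝ, E (n + 1)) 1
      (fun q : ℝ × M => f q.1 • X q.2) (I ×ˢ s) := by
  have h1 : ContMDiffOn (𝓘(ℝ, ℝ).prod (𝓡 n)) 𝓘(ℝ, ℝ) 1 (fun q : ℝ × M => f q.1) (I ×ˢ s) :=
    fun q hq => ((hf q.1 hq.1).contMDiffAt.comp q contMDiffAt_fst).contMDiffWithinAt
  have h2 : ContMDiffOn (𝓘(ℝ, ℝ).prod (𝓡 n)) 𝓘(ℝ, E (n + 1)) 1 (fun q : ℝ × M => X q.2)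
      (I ×ˢ s) := hX.comp contMDiffOn_snd fun q hq => hq.2
  exact h1.smul h2

/-- The fields `νᵢ` themselves serve as unit normals for all parameters, because `dX` and `dξ` both
map into `νᵢ^⊥`. No member of the family other than `X` has to be an immersion. -/
theorem isVariation_rescaled {ε₀ : ℝ} (hε : 0 < ε₀) {m : ℝ → ℝ} (hm0 : m 0 = 1)
    (hm : ∀ t ∈ Ioo (-ε₀) ε₀, ContDiffAt ℝ ∞ m t) (hX : IsWeakImmersion P X ν)
    (hξ : ∀ i, ContMDiffOn (𝓡 n) 𝓘(ℝ, E (n + 1)) 1 ξ (P i))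
    (hd : ∀ i, ∀ p ∈ interior (P i),
      (∀ v, ⟪ν i p, fderiv ℝ (X ∘ (chartAt (E n) p).symm) (chartAt (E n) p p) v⟫ = 0) ∧
      (∀ v, ⟪ν i p, fderiv ℝ (ξ ∘ (chartAt (E n) p).symm) (chartAt (E n) p p) v⟫ = 0)) :
    IsVariation P X ν ε₀ fun t p => m t • (X p + t • ξ p) := by
  refine ⟨hε, ?_, fun j i => ?_, fun _ => ν, fun i => ?_, fun _ _ i p hp => hX.normal_unit i p hp,
    fun t ht i p hp v => ?_, fun i p _ => rfl⟩
  · funext p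
    simp [hm0]
  · have hm' : ∀ t ∈ Ioo (-ε₀) ε₀, ContDiffAt ℝ ∞ (fun t => m t * t) t :=
      fun t ht => (hm t ht).mul contDiffAt_id
    refine ContMDiffOn.congr (f := fun q : ℝ × M =>
      iteratedDeriv j m q.1 • X q.2 + iteratedDeriv j (fun t => m t * t) q.1 • ξ q.2) ?_ ?_
    · exact (contMDiffOn_smul_comp (fun t ht => contDiffAt_iteratedDeriv (hm t ht) j)
        ((hX.contMDiffOn i).of_le (by norm_num))).add
        (contMDiffOn_smul_comp (fun t ht => contDiffAt_iteratedDeriv (hm' t ht) j) (hξ i))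
    · rintro ⟨t, p⟩ ht
      simp only [smul_add, smul_smul]
      exact iteratedDeriv_smul_add_smul (hm t ht.1) (hm' t ht.1) _ _ j
  · exact (hX.normal_contMDiffOn i).continuousOn.comp continuousOn_snd fun q hq => hq.2
  · obtain ⟨hXp, hξp⟩ := hd i p hp
    have hc := mem_chart_source (E n) p
    have he := chart_mem_atlas (E n) p
    have h1 : diff (fun p => m t • (X p + t • ξ p)) p = _ :=
      mfderiv_eq_fderiv_chart he (fun p => m t • (X p + t • ξ p)) hc
    have hXd : DifferentiableAt ℝ (X ∘ (chartAt (E n) p).symm) (chartAt (E n) p p) :=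
      (contDiffAt_chart (m := 2) he hc (hX.contMDiffOn i) hp).differentiableAt (by norm_num)
    have hξd : DifferentiableAt ℝ (ξ ∘ (chartAt (E n) p).symm) (chartAt (E n) p p) :=
      (contDiffAt_chart (m := 1) he hc (by simpa using hξ i) hp).differentiableAt (by norm_num)
    have h2 : HasFDerivAt ((fun p => m t • (X p + t • ξ p)) ∘ (chartAt (E n) p).symm) _
        (chartAt (E n) p p) :=
      (hXd.hasFDerivAt.add (hξd.hasFDerivAt.const_smul t)).const_smul (m t)
    rw [h1, h2.fderiv, real_inner_comm, ContinuousLinearMap.comp_apply, smul_apply, add_apply,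
      smul_apply, inner_smul_right, inner_add_right, inner_smul_right, hXp, hξp]
    simp

end RescaledVariation

/-! ### Almost everywhere statements and rescaled surfaces in weighted charts -/

section Partition

variable {n : ℕ} {M : Type*} [TopologicalSpace M] [ChartedSpace (E n) M] [MeasurableSpace M]
  [BorelSpace M] (Q : ChartPartition n M)

namespace ChartPartition

/-- Some weight is positive at `p`, so in that chart the measure charges every neighbourhood of `p`.
Identities between continuous functions thereby pass from almost everywhere to a given point. -/
theorem exists_frequently_of_ae [T2Space M] [IsManifold (𝓡 n) ∞ M] {q : Fin Q.size × E n → Prop} (h : ∀ᵐ z ∂Q.measure, q z) (p : M) :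
    ∃ a, p ∈ (Q.chart a).source ∧ ∃ᶠ u in 𝓝 (Q.chart a p), q (a, u) := by
  obtain ⟨a, ha⟩ : ∃ a, 0 < Q.weight a p := by
    by_contra hne
    push Not at hne
    have h1 : ∑ a, Q.weight a p ≤ 0 := Finset.sum_nonpos fun a _ => hne a
    rw [Q.sum_eq_one] at h1
    linarith
  have hp : p ∈ (Q.chart a).source := Q.tsupport_subset a (subset_tsupport _ ha.ne')
  refine ⟨a, hp, fun hne => ?_⟩
  have h1 := Q.ae_measure_iff.mp h a
  rw [ae_restrict_iff' (Q.chart a).open_target.measurableSet] at h1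
  have h2 : ∀ᶠ u in 𝓝 (Q.chart a p), 0 < Q.weight a ((Q.chart a).symm u) :=
    eventually_chart hp (((Q.contMDiff a).continuous.isOpen_preimage _ isOpen_Ioi).mem_nhds ha)
  have h3 := (hne.and h2).and ((Q.chart a).open_target.mem_nhds ((Q.chart a).map_source hp))
  obtain ⟨V, hV, hVo, hpV⟩ := _root_.mem_nhds_iff.mp h3
  refine (hVo.measure_pos volume ⟨_, hpV⟩).ne' ?_
  refine measure_mono_null (fun u hu => ?_) h1
  obtain ⟨⟨hu1, hu2⟩, hu3⟩ := hV hu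
  exact fun hu' => hu1 (hu' hu3 hu2)

theorem measure_ne_zero [T2Space M] [IsManifold (𝓡 n) ∞ M] [Nonempty M] : Q.measure ≠ 0 := by
  intro h
  obtain ⟨a, -, ha⟩ := Q.exists_frequently_of_ae (q := fun _ => False) (by simp [h])
    (Classical.arbitrary M)
  exact ha.exists.choose_spec

theorem grad_const_smul (Y : M → E (n + 1)) (m : ℝ) (z : Fin Q.size × E n) :
    Q.grad (fun p => m • Y p) z = m • Q.grad Y z :=
  congrFun (fderiv_const_smul_of_field (f := Y ∘ (Q.chart z.1).symm) m) z.2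

theorem ae_grad_add_smul {Y Z : M → E (n + 1)} (hY : IsLocLip n Y) (hZ : IsLocLip n Z) (s : ℝ) :
    ∀ᵐ z ∂Q.measure, Q.grad (fun p => Y p + s • Z p) z = Q.grad Y z + s • Q.grad Z z := by
  filter_upwards [Q.ae_differentiableAt hY, Q.ae_differentiableAt hZ] with z h1 h2
  exact (h1.hasFDerivAt.add (h2.hasFDerivAt.const_smul s)).fderiv

variable [IsManifold (𝓡 n) ∞ M] [CompactSpace M] [Nonempty M]

theorem energy_rescaled (horient : IsOrientedAtlas n M) {γ : S n → ℝ}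
    (hconv : IsConvexIntegrand γ) {Y Z : M → E (n + 1)} (hY : IsLocLip n Y) (hZ : IsLocLip n Z)
    {m : ℝ} (hm : 0 ≤ m) (s : ℝ) : energy γ (fun p => m • (Y p + s • Z p)) =
      m ^ n * ∫ z, homogExt γ (crossVec (Q.grad Y z + s • Q.grad Z z)) ∂Q.measure := by
  rw [Q.energy_eq horient hconv ((hY.add (hZ.const_smul s)).const_smul m), ← integral_const_mul]
  refine integral_congr_ae ?_
  filter_upwards [Q.ae_grad_add_smul hY hZ s] with z hz
  rw [Q.grad_const_smul, hz, crossVec_smul, homogExt_smul (pow_nonneg hm n)]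

theorem enclosedVolume_rescaled (horient : IsOrientedAtlas n M) {Y Z : M → E (n + 1)}
    (hY : IsLocLip n Y) (hZ : IsLocLip n Z) (m s : ℝ) :
    enclosedVolume (fun p => m • (Y p + s • Z p)) = (1 / ((n : ℝ) + 1)) * (m ^ (n + 1) *
      ∫ z, ⟪Y (Q.pt z) + s • Z (Q.pt z), crossVec (Q.grad Y z + s • Q.grad Z z)⟫ ∂Q.measure) := by
  have hL : IsLocLip n fun p => m • (Y p + s • Z p) := (hY.add (hZ.const_smul s)).const_smul m
  rw [Q.enclosedVolume_eq horient hL, ← integral_const_mul (m ^ (n + 1))]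
  refine congrArg _ (integral_congr_ae ?_)
  filter_upwards [Q.ae_grad_add_smul hY hZ s] with z hz
  rw [Q.grad_const_smul, hz, crossVec_smul, real_inner_smul_left, real_inner_smul_right]
  ring

end ChartPartition

end Partition

/-! ### Stable surfaces -/

section Stable

variable {n : ℕ} {γ : S n → ℝ} {M : Type*} [TopologicalSpace M] [T2Space M] [CompactSpace M]
  [ChartedSpace (E n) M] [IsManifold (𝓡 n) ∞ M] [MeasurableSpace M] [BorelSpace M]
  {k : ℕ} {P : Fin k → Set M} {X ξ : M → E (n + 1)} {ν : Fin k → M → E (n + 1)} {Λ : ℝ}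

theorem isLocLip_of_isWeakImmersion (hP : IsDecomposition (n := n) P)
    (hX : IsWeakImmersion P X ν) : IsLocLip n X :=
  isLocLip_of_piecewise hP hX.continuous fun i => (hX.contMDiffOn i).of_le (by norm_num)

theorem isLocLip_cahnField (hC2 : ContMDiff (𝓡 n) 𝓘(ℝ, ℝ) 2 γ) (hP : IsDecomposition (n := n) P)
    (hX : IsWeakImmersion P X ν) (hξ : ∀ i, ∀ p ∈ P i, ξ p = homogGrad γ (ν i p)) :
    IsLocLip n ξ :=
  isLocLip_of_piecewise hP
    (continuous_of_pieces hP fun i => (contMDiffOn_cahnField hC2 hX hξ i).continuousOn)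
    (contMDiffOn_cahnField hC2 hX hξ)

theorem ae_principalData (hn : 1 ≤ n) (hC2 : ContMDiff (𝓡 n) 𝓘(ℝ, ℝ) 2 γ)
    (hconv : IsConvexIntegrand γ) (horient : IsOrientedAtlas n M) (hP : IsDecomposition (n := n) P)
    (hX : IsWeakImmersion P X ν)
    (hΛ : ∀ i, ∀ p ∈ interior (P i), meanCurvature γ X 1 p = Λ)
    (hξ : ∀ i, ∀ p ∈ P i, ξ p = homogGrad γ (ν i p)) (Q : ChartPartition n M) :
    ∀ᵐ z ∂Q.measure, PrincipalData γ Λ (ξ (Q.pt z)) (Q.grad X z) (Q.grad ξ z) := by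
  filter_upwards [Q.ae_mem_target, Q.ae_notMem_edges hP] with z hz hze
  obtain ⟨i, hi⟩ := exists_mem_interior hP hze
  have h := (principalData_of_mem_interior hn hC2 hconv horient hX hΛ hξ (Q.mem_atlas z.1)
    ((Q.chart z.1).map_target hz) hi).1
  rw [(Q.chart z.1).right_inv hz] at h
  exact h

/-- Stability is tested on the single variation `m(t) (X + tξ)`, whose second-order energy
coefficient is already known to be nonpositive. -/
theorem ae_grad_cahnField [Nonempty M] (hn : 1 ≤ n) (hpos : ∀ ν, 0 < γ ν)
    (hC2 : ContMDiff (𝓡 n) 𝓘(ℝ, ℝ) 2 γ)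
    (hconv : IsConvexIntegrand γ) (horient : IsOrientedAtlas n M) (hP : IsDecomposition (n := n) P)
    (hX : IsWeakImmersion P X ν)
    (hΛ : ∀ i, ∀ p ∈ interior (P i), meanCurvature γ X 1 p = Λ)
    (hξ : ∀ i, ∀ p ∈ P i, ξ p = homogGrad γ (ν i p)) (hstable : IsStable γ P X ν)
    (Q : ChartPartition n M) :
    0 < -Λ * enclosedVolume X ∧ ∀ᵐ z ∂Q.measure, Q.grad ξ z = (-Λ) • Q.grad X z := by
  have hXl := isLocLip_of_isWeakImmersion hP hX
  have hξl := isLocLip_cahnField hC2 hP hX hξ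
  obtain ⟨p, hp⟩ : ∃ p : ℝ → ℝ, ∀ s, p s = ∫ z, ⟪X (Q.pt z) + s • ξ (Q.pt z),
      crossVec (Q.grad X z + s • Q.grad ξ z)⟫ ∂Q.measure := ⟨_, fun _ => rfl⟩
  have hvar : ∀ s : ℝ, ∫ z, ⟪X (Q.pt z) + s • ξ (Q.pt z),
      crossCoeff 1 (Q.grad X z + s • Q.grad ξ z) (Q.grad ξ z)⟫ ∂Q.measure =
      n * ∫ z, ⟪ξ (Q.pt z), crossVec (Q.grad X z + s • Q.grad ξ z)⟫ ∂Q.measure := by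
    intro s
    have h1 := Q.integral_crossCoeff_one hn horient (hXl.add (hξl.const_smul s)) hξl
    have h2 := Q.ae_grad_add_smul hXl hξl s
    refine (integral_congr_ae ?_).trans (h1.trans (congrArg _ (integral_congr_ae ?_)))
    · exact h2.mono fun z hz => by simp only [hz]
    · exact h2.mono fun z hz => by simp only [hz]
  obtain ⟨hps, hneg, b, ho, hb⟩ := second_variation hn hC2 hpos hconv Q.measure_ne_zero
    (((Q.aestronglyMeasurable_comp_pt hXl.continuous).prodMk
      (Q.aestronglyMeasurable_comp_pt hξl.continuous)).prodMk
      ((Q.aestronglyMeasurable_grad X).prodMk (Q.aestronglyMeasurable_grad ξ)))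
    (exists_norm_le_prodMk
      (exists_norm_le_prodMk (Q.exists_comp_pt_bound hXl.continuous)
        (Q.exists_comp_pt_bound hξl.continuous))
      (exists_norm_le_prodMk (Q.exists_grad_bound hXl) (Q.exists_grad_bound hξl)))
    hvar (ae_principalData hn hC2 hconv horient hP hX hΛ hξ Q) hp
  have hp0 : p 0 ≠ 0 := fun h => by simp [h] at hneg
  have hq : ContDiff ℝ ∞ fun t => p t / p 0 := hps.div_const _
  have hq0 : ∀ᶠ t in 𝓝 (0 : ℝ), 0 < p t / p 0 := by
    refine hq.continuous.continuousAt.eventually (lt_mem_nhds ?_)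
    simp [hp0]
  obtain ⟨ε₀, hε, hball⟩ := Metric.eventually_nhds_iff_ball.mp hq0
  rw [Real.ball_eq_Ioo, zero_sub, zero_add] at hball
  -- Scaling by `m` multiplies the volume by `mⁿ⁺¹`, and `p` is `n + 1` times the volume of `X +
  -- tξ`; this exponent restores the initial volume.
  set m : ℝ → ℝ := fun t => (p t / p 0) ^ (-(1 / ((n : ℝ) + 1))) with hm
  have hm0 : m 0 = 1 := by simp [hm, hp0]
  have hmpow : ∀ t ∈ Ioo (-ε₀) ε₀, m t ^ (n + 1) * p t = p 0 := by
    intro t ht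
    have h1 := hball t ht
    have h2 : m t ^ (n + 1) = (p t / p 0)⁻¹ := by
      rw [hm, ← Real.rpow_natCast, ← Real.rpow_mul h1.le, ← Real.rpow_neg_one]
      congr 1
      push_cast
      field_simp
    have h3 : p t ≠ 0 := fun h => by simp [h] at h1
    rw [h2]
    field_simp
  have hYvar : IsVariation P X ν ε₀ fun t q => m t • (X q + t • ξ q) := by
    refine isVariation_rescaled hε hm0
      (fun t ht => hq.contDiffAt.rpow_const_of_ne (hball t ht).ne') hX
      (contMDiffOn_cahnField hC2 hX hξ) fun i q hq => ?_
    exact (principalData_of_mem_interior hn hC2 hconv horient hX hΛ hξ (chart_mem_atlas _ q)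
      (mem_chart_source _ q) hq).2.2
  have hY0 : (fun q => m 0 • (X q + (0 : ℝ) • ξ q)) = X := hYvar.start
  have hVX : enclosedVolume X = 1 / ((n : ℝ) + 1) * p 0 := by
    have h1 := Q.enclosedVolume_rescaled horient hXl hξl (m 0) 0
    rw [hY0, ← hp, hm0, one_pow, one_mul] at h1
    exact h1
  have hs := hstable ε₀ _ hYvar (fun t ht => by
    rw [Q.enclosedVolume_rescaled horient hXl hξl, ← hp, hmpow t ht, hVX]) 0 b
  refine ⟨?_, hb (hs (ho.congr' ?_ EventuallyEq.rfl))⟩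
  · rw [hVX, mul_left_comm]
    positivity
  · have h0 : energy γ X = ∫ z, homogExt γ (crossVec (Q.grad X z)) ∂Q.measure :=
      Q.energy_eq horient hconv hXl
    filter_upwards [Ioo_mem_nhds (neg_lt_zero.mpr hε) hε] with t ht
    rw [hY0, h0, Q.energy_rescaled horient hconv hXl hξl (Real.rpow_nonneg (hball t ht).le _)]

/-- In the interior of the pieces both differentials are continuous, so the relation `dξ = -Λ dX`
holds there everywhere. A continuous map whose differential vanishes off the edges is constant on
the connected surface. -/
theorem cahnField_add_smul_eq [PreconnectedSpace M] (hn : 1 ≤ n)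
    (hC2 : ContMDiff (𝓡 n) 𝓘(ℝ, ℝ) 2 γ) (hconv : IsConvexIntegrand γ)
    (horient : IsOrientedAtlas n M) (hP : IsDecomposition (n := n) P)
    (hX : IsWeakImmersion P X ν)
    (hΛ : ∀ i, ∀ p ∈ interior (P i), meanCurvature γ X 1 p = Λ)
    (hξ : ∀ i, ∀ p ∈ P i, ξ p = homogGrad γ (ν i p)) (Q : ChartPartition n M)
    (hae : ∀ᵐ z ∂Q.measure, Q.grad ξ z = (-Λ) • Q.grad X z) (p q : M) :
    ξ p + Λ • X p = ξ q + Λ • X q := by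
  have hξl := isLocLip_cahnField hC2 hP hX hξ
  refine eq_of_fderiv_eq_zero (Y := fun p => ξ p + Λ • X p) hP
    (hξl.continuous.add (hX.continuous.const_smul Λ)) (fun e he u hu hue => ?_) p q
  obtain ⟨i, hi⟩ := exists_mem_interior hP hue
  obtain ⟨a, ha, hfr⟩ := Q.exists_frequently_of_ae hae (e.symm u)
  have hX1 : ∀ e' ∈ atlas (E n) M, e.symm u ∈ e'.source →
      ContDiffAt ℝ 1 (X ∘ e'.symm) (e' (e.symm u)) := fun e' he' hu' =>
    (contDiffAt_chart (m := 2) he' hu' (hX.contMDiffOn i) hi).of_le (by norm_num)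
  have hξ1 : ∀ e' ∈ atlas (E n) M, e.symm u ∈ e'.source →
      ContDiffAt ℝ 1 (ξ ∘ e'.symm) (e' (e.symm u)) := fun e' he' hu' => by
    have h1 := contMDiffOn_cahnField hC2 hX hξ i
    simpa using contDiffAt_chart (m := 1) he' hu' (by simpa using h1) hi
  have hc := Q.mem_atlas a
  have heq : fderiv ℝ (ξ ∘ (Q.chart a).symm) (Q.chart a (e.symm u)) =
      (-Λ) • fderiv ℝ (X ∘ (Q.chart a).symm) (Q.chart a (e.symm u)) := by
    have h1 : ContinuousAt (fderiv ℝ (ξ ∘ (Q.chart a).symm)) (Q.chart a (e.symm u)) :=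
      ((hξ1 _ hc ha).fderiv_right (m := 0) (by norm_num)).continuousAt
    have h2 : ContinuousAt (fderiv ℝ (X ∘ (Q.chart a).symm)) (Q.chart a (e.symm u)) :=
      ((hX1 _ hc ha).fderiv_right (m := 0) (by norm_num)).continuousAt
    by_contra hne
    exact hfr ((h1.ne_iff_eventually_ne (h2.const_smul (-Λ))).mp hne)
  have hp := e.map_target hu
  have hXe := (hX1 _ he hp).differentiableAt (by norm_num)
  have hξe := (hξ1 _ he hp).differentiableAt (by norm_num)
  have h3 := hξe.hasFDerivAt.add (hXe.hasFDerivAt.const_smul Λ)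
  rw [e.right_inv hu] at h3
  refine ⟨h3.differentiableAt, h3.fderiv.trans ?_⟩
  have h4 := fderiv_chart he hc ξ hp ha
  have h5 := fderiv_chart he hc X hp ha
  rw [e.right_inv hu] at h4 h5
  rw [h4, h5, heq]
  ext v : 1
  simp

end Stable

/-! ### The Cahn-Hoffman field covers the Wulff shape -/

section Covering

variable {n : ℕ}

/-- All rows of the determinant are orthogonal to the nonzero vector `w`, so the matrix is singular.
-/
theorem inner_crossVec_eq_zero {L : E n →L[ℝ] E (n + 1)} {v w : E (n + 1)} (hw : w ≠ 0)
    (hv : ⟪v, w⟫ = 0) (hL : ∀ x, ⟪L x, w⟫ = 0) : ⟪v, crossVec L⟫ = 0 := by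
  rw [inner_crossVec]
  refine Matrix.exists_mulVec_eq_zero_iff.mp ⟨w.ofLp, fun h => hw ?_, ?_⟩
  · ext i
    exact congrFun h i
  · have hdot : ∀ a : E (n + 1), a.ofLp ⬝ᵥ w.ofLp = ⟪a, w⟫ := fun a => by
      simp [PiLp.inner_apply, dotProduct, mul_comm]
    funext i
    refine Fin.cases ?_ (fun j => ?_) i
    · simpa [Matrix.mulVec, hdot] using hv
    · simpa [Matrix.mulVec, hdot] using hL _

theorem inner_crossVec_smul_add_smulRight (a : ℝ) (L : E n →L[ℝ] E (n + 1)) (l : E n →L[ℝ] ℝ)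
    (v : E (n + 1)) : ⟪v, crossVec (a • L + l.smulRight v)⟫ = a ^ n * ⟪v, crossVec L⟫ := by
  have h : ⟪v, crossVec (a • L + l.smulRight v)⟫ = ⟪v, crossVec (a • L)⟫ := by
    rw [inner_crossVec, inner_crossVec]
    refine Matrix.det_eq_of_forall_row_eq_smul_add_const
      (Fin.cons 0 fun j => l (EuclideanSpace.single j 1)) 0 (by simp) fun i j => ?_
    refine Fin.cases ?_ (fun i => ?_) i <;> simp
  rw [h, crossVec_smul, real_inner_smul_right]

/-- The projected map `Y` stays in the hyperplane `⟪·, v⟫ = -1`. Therefore `Y + v` and the image of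
`DY` lie in `v^⊥`, and `⟪v, crossVec DY⟫ = -⟪Y, crossVec DY⟫`. In the latter, differentiating the
scalar factor only adds multiples of the first row to the other rows. -/
theorem inner_crossVec_centralProjection {f : E n → E (n + 1)} {u : E n}
    (hf : DifferentiableAt ℝ f u) {w v : E (n + 1)} (hv : ‖v‖ = 1)
    (hr : ∀ x, ⟪w - f x, v⟫ ≠ 0) :
    ⟪v, crossVec (fderiv ℝ (fun x => ⟪w - f x, v⟫⁻¹ • (f x - w)) u)⟫ =
      -(⟪w - f u, v⟫⁻¹ ^ (n + 1) * ⟪f u - w, crossVec (fderiv ℝ f u)⟫) := by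
  set Y : E n → E (n + 1) := fun x => ⟪w - f x, v⟫⁻¹ • (f x - w) with hY
  have hc : DifferentiableAt ℝ (fun x => ⟪w - f x, v⟫⁻¹) u :=
    (((differentiableAt_const w).sub hf).inner ℝ (differentiableAt_const v)).inv (hr u)
  have hYd := hc.hasFDerivAt.smul (hf.hasFDerivAt.sub_const w)
  have hYv : ∀ x, ⟪Y x, v⟫ = -1 := fun x => by
    have h1 : ⟪f x - w, v⟫ = -⟪w - f x, v⟫ := by rw [← inner_neg_left, neg_sub]
    rw [hY, real_inner_smul_left, h1, mul_neg, inv_mul_cancel₀ (hr x)]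
  have hDY : ∀ x, ⟪fderiv ℝ Y u x, v⟫ = 0 := by
    intro x
    have h1 := fderiv_inner_apply ℝ hYd.differentiableAt (differentiableAt_const v) x
    have h2 : (fun t => ⟪Y t, v⟫) = fun _ => (-1 : ℝ) := funext hYv
    have h3 : fderiv ℝ (fun t => ⟪Y t, v⟫) u x = 0 := by
      rw [h2, fderiv_const_apply, zero_apply]
    rw [fderiv_const_apply, zero_apply, inner_zero_right, zero_add] at h1
    exact h1.symm.trans h3
  have h1 := inner_crossVec_eq_zero (L := fderiv ℝ Y u) (v := Y u + v) (w := v) (unit_ne_zero hv)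
    (by rw [inner_add_left, hYv, real_inner_self_eq_norm_sq, hv]; norm_num) hDY
  have h2 : fderiv ℝ Y u = ⟪w - f u, v⟫⁻¹ • fderiv ℝ f u +
      (fderiv ℝ (fun x => ⟪w - f x, v⟫⁻¹) u).smulRight (f u - w) := hYd.fderiv
  have h3 : ⟪Y u, crossVec (fderiv ℝ Y u)⟫ =
      ⟪w - f u, v⟫⁻¹ ^ (n + 1) * ⟪f u - w, crossVec (fderiv ℝ f u)⟫ := by
    rw [h2, hY, real_inner_smul_left, inner_crossVec_smul_add_smulRight, pow_succ]
    ring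
  rw [inner_add_left, h3] at h1
  linarith

variable {M : Type*} [TopologicalSpace M] [ChartedSpace (E n) M]

theorem IsLocLip.comp {F G : Type*} [NormedAddCommGroup F] [NormedSpace ℝ F]
    [NormedAddCommGroup G] [NormedSpace ℝ G] {Y : M → F} (hY : IsLocLip n Y) {g : F → G}
    (hg : ∀ p, ContDiffAt ℝ 1 g (Y p)) : IsLocLip n fun p => g (Y p) := by
  intro e he u hu
  obtain ⟨K, t, ht, hK⟩ := (hg (e.symm u)).exists_lipschitzOnWith
  obtain ⟨C, s, hs, hC⟩ := hY e he hu
  refine ⟨K * C, s ∩ (Y ∘ e.symm) ⁻¹' t, inter_mem hs ?_, ?_⟩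
  · exact (hY e he).continuousOn.continuousWithinAt hu |>.preimage_mem_nhdsWithin ht
  · exact hK.comp (hC.mono inter_subset_left) fun x hx => hx.2

/-- A degree argument without degree theory. If `w` is missed, the central projection of `ξ` from
`w` to a hyperplane is defined on all of `M`, and its Jacobian integrates to zero by the Minkowski
formula. But `ξ` supports the Wulff body at its normal `N`, so `⟪ξ - w, N⟫ > 0`, and as `dξ = -Λ dX`
the Jacobian has the sign of `-(-Λ)ⁿ` almost everywhere. -/
theorem range_cahnField_eq_wulffShape [T2Space M] [CompactSpace M] [Nonempty M]
    [IsManifold (𝓡 n) ∞ M] [MeasurableSpace M] [BorelSpace M] {γ : S n → ℝ} {k : ℕ}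
    {P : Fin k → Set M} {X ξ : M → E (n + 1)} {ν : Fin k → M → E (n + 1)} {Λ : ℝ} (hn : 1 ≤ n)
    (hC2 : ContMDiff (𝓡 n) 𝓘(ℝ, ℝ) 2 γ) (hconv : IsConvexIntegrand γ)
    (horient : IsOrientedAtlas n M) (hP : IsDecomposition (n := n) P)
    (hX : IsWeakImmersion P X ν) (hΛ0 : Λ ≠ 0)
    (hΛ : ∀ i, ∀ p ∈ interior (P i), meanCurvature γ X 1 p = Λ)
    (hξ : ∀ i, ∀ p ∈ P i, ξ p = homogGrad γ (ν i p)) (Q : ChartPartition n M)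
    (hae : ∀ᵐ z ∂Q.measure, Q.grad ξ z = (-Λ) • Q.grad X z) : range ξ = wulffShape γ := by
  have hξG : ∀ p, ∃ x, ‖x‖ = 1 ∧ ξ p = homogGrad γ x := fun p => by
    obtain ⟨i, hi⟩ := mem_iUnion.mp (hP.iUnion_eq ▸ mem_univ p)
    exact ⟨ν i p, hX.normal_unit i p hi, hξ i p hi⟩
  refine Subset.antisymm ?_ fun w hw => ?_
  · rintro _ ⟨p, rfl⟩
    obtain ⟨x, hx, hp⟩ := hξG p
    rw [hp]
    exact homogGrad_mem_wulffShape hC2 hconv hx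
  by_contra hne
  have hξw : ∀ p, ξ p ≠ w := fun p hp => hne ⟨p, hp⟩
  obtain ⟨hwH, v, hv, hwv⟩ := exists_normal_of_mem_wulffShape hC2 hw
  have hv0 := unit_ne_zero hv
  -- Equality would make both `w` and `ξ p` supporting vectors at `v`, hence equal; so the
  -- denominator of the projection never vanishes.
  have hr : ∀ p, 0 < ⟪w - ξ p, v⟫ := by
    intro p
    obtain ⟨x, hx, hp⟩ := hξG p
    have h1 : ∀ z, ⟪ξ p, z⟫ ≤ homogExt γ z := fun z => by
      rw [hp]
      exact inner_homogGrad_le hC2 hconv (unit_ne_zero hx) z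
    rw [inner_sub_left, sub_pos, hwv]
    refine (h1 v).lt_of_ne fun h2 => hξw p ?_
    rw [← eq_homogGrad_of_inner_eq hC2 h1 hv0 h2, eq_homogGrad_of_inner_eq hC2 hwH hv0 hwv]
  have hξl := isLocLip_cahnField hC2 hP hX hξ
  have hY : IsLocLip n fun p => ⟪w - ξ p, v⟫⁻¹ • (ξ p - w) := by
    refine hξl.comp (g := fun x => ⟪w - x, v⟫⁻¹ • (x - w)) fun p => ?_
    exact (((contDiffAt_const.sub contDiffAt_id).inner ℝ contDiffAt_const).inv (hr p).ne').smul
      (contDiffAt_id.sub contDiffAt_const)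
  set Y : M → E (n + 1) := fun p => ⟪w - ξ p, v⟫⁻¹ • (ξ p - w) with hYdef
  have h0 : ∫ z, ⟪v, crossVec (Q.grad Y z)⟫ ∂Q.measure = 0 := by
    -- With the constant field `v` as `Z`, one side of the Minkowski formula vanishes.
    have h1 := Q.integral_crossCoeff_one hn horient hY (isLocLip_const v)
    have h2 : ∀ z, Q.grad (fun _ : M => v) z = 0 := fun z => fderiv_const_apply v
    simp only [h2, crossCoeff_one_zero, inner_zero_right, integral_zero] at h1
    have hn0 : (n : ℝ) ≠ 0 := by positivity
    exact (mul_eq_zero.mp h1.symm).resolve_left hn0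
  have hsign : ∀ᵐ z ∂Q.measure, 0 < (-(-Λ) ^ n)⁻¹ * ⟪v, crossVec (Q.grad Y z)⟫ := by
    filter_upwards [Q.ae_differentiableAt hξl,
      ae_principalData hn hC2 hconv horient hP hX hΛ hξ Q, hae] with z hd hpd hz
    have h1 : ⟪v, crossVec (Q.grad Y z)⟫ = -(⟪w - ξ (Q.pt z), v⟫⁻¹ ^ (n + 1) *
        ⟪ξ (Q.pt z) - w, crossVec (Q.grad ξ z)⟫) :=
      inner_crossVec_centralProjection hd hv fun x => (hr _).ne'
    obtain ⟨N, κ, d, hN, hξN, hd0, -, hdet, -⟩ := hpd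
    have h2 : crossVec (Q.grad X z) = d • N := by
      have h := hdet 0
      have hL : Q.grad X z + (0 : ℝ) • Q.grad ξ z = Q.grad X z := by
        ext v : 1
        simp
      rw [hL] at h
      simpa using h
    have h3 : 0 < ⟪ξ (Q.pt z) - w, N⟫ := by
      rw [inner_sub_left, sub_pos, hξN, inner_homogGrad_self hC2 (unit_ne_zero hN)]
      refine (hwH N).lt_of_ne fun h4 => hξw (Q.pt z) ?_
      rw [hξN, eq_homogGrad_of_inner_eq hC2 hwH (unit_ne_zero hN) h4]
    have h4 : (-Λ) ^ n ≠ 0 := pow_ne_zero n (neg_ne_zero.mpr hΛ0)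
    have h5 : (-(-Λ) ^ n)⁻¹ * ⟪v, crossVec (Q.grad Y z)⟫ =
        ⟪w - ξ (Q.pt z), v⟫⁻¹ ^ (n + 1) * (d * ⟪ξ (Q.pt z) - w, N⟫) := by
      rw [h1, hz, crossVec_smul, h2, real_inner_smul_right, real_inner_smul_right]
      field_simp
    rw [h5]
    have := hr (Q.pt z)
    positivity
  have hint : Integrable (fun z => (-(-Λ) ^ n)⁻¹ * ⟪v, crossVec (Q.grad Y z)⟫) Q.measure := by
    refine Integrable.const_mul ?_ _
    exact Q.integrable_comp hY hY (Φ := fun q => ⟪v, crossVec q.2.1⟫)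
      (continuous_const.inner (continuous_crossVec.comp (by fun_prop)))
  have hzero := (integral_eq_zero_iff_of_nonneg_ae (hsign.mono fun z hz => hz.le) hint).mp
    (by rw [integral_const_mul, h0, mul_zero])
  haveI : NeBot (ae Q.measure) := ae_neBot.mpr Q.measure_ne_zero
  obtain ⟨z, hz1, hz2⟩ := (hsign.and hzero).exists
  exact hz1.ne' hz2

end Covering

end AnisoSurface

end


/-! ### The main theorem -/

theorem theorem1p1 (n : ℕ) (hn : 1 ≤ n)
    (γ : AnisoSurface.S n → ℝ) (hpos : ∀ ν, 0 < γ ν)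
    (hC2 : ContMDiff (𝓡 n) 𝓘(ℝ, ℝ) 2 γ) (hconv : AnisoSurface.IsConvexIntegrand γ)
    (M : Type*) [TopologicalSpace M] [T2Space M] [CompactSpace M] [ConnectedSpace M]
    [ChartedSpace (AnisoSurface.E n) M] [IsManifold (𝓡 n) ∞ M]
    [MeasurableSpace M] [BorelSpace M] (horient : AnisoSurface.IsOrientedAtlas n M)
    (k : ℕ) (P : Fin k → Set M) (hP : AnisoSurface.IsDecomposition (n := n) P)
    (X : M → AnisoSurface.E (n + 1)) (ν : Fin k → M → AnisoSurface.E (n + 1))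
    (hX : AnisoSurface.IsWeakImmersion P X ν)
    (hint : ∀ r ∈ Finset.Icc 1 n,
      MeasureTheory.Integrable (AnisoSurface.meanCurvature γ X r) (AnisoSurface.areaMeasure X))
    (hCAMC : AnisoSurface.IsCAMC γ P X ν)
    (hstable : AnisoSurface.IsStable γ P X ν) :
    ∃ (c : AnisoSurface.E (n + 1)) (l : ℝ), l ≠ 0 ∧
      (0 < AnisoSurface.enclosedVolume X → 0 < l) ∧
      Set.range X = (fun w => c + l • w) '' AnisoSurface.wulffShape γ := by
  obtain ⟨Λ, hΛ⟩ := hCAMC.1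
  obtain ⟨ξ, hξ⟩ := AnisoSurface.exists_cahnField hC2 hconv hP hX hCAMC
  obtain ⟨Q⟩ := AnisoSurface.exists_chartPartition (n := n) (M := M)
  obtain ⟨hV, hae⟩ := AnisoSurface.ae_grad_cahnField hn hpos hC2 hconv horient hP hX hΛ hξ
    hstable Q
  -- The inequality `0 < -Λ V(X)` rules out `Λ = 0`, and it also gives `-Λ⁻¹ > 0` when the enclosed
  -- volume is positive.
  have hΛ0 : Λ ≠ 0 := fun h => by simp [h] at hV
  set p₀ : M := Classical.arbitrary M
  -- Solving `ξ + ΛX = const` for `X` exhibits the surface as the image of `ξ`, that is, of the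
  -- Wulff shape, under a homothety of ratio `-Λ⁻¹` and a translation.
  have hXξ : ∀ p, X p = Λ⁻¹ • (ξ p₀ + Λ • X p₀) + (-Λ⁻¹) • ξ p := fun p => by
    rw [← AnisoSurface.cahnField_add_smul_eq hn hC2 hconv horient hP hX hΛ hξ Q hae p p₀,
      smul_add, smul_smul, inv_mul_cancel₀ hΛ0, one_smul, neg_smul]
    abel
  refine ⟨Λ⁻¹ • (ξ p₀ + Λ • X p₀), -Λ⁻¹, neg_ne_zero.mpr (inv_ne_zero hΛ0), fun hpos' => ?_, ?_⟩
  · have h := pos_of_mul_pos_left hV hpos'.le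
    rw [← inv_neg]
    exact inv_pos.mpr h
  · rw [← AnisoSurface.range_cahnField_eq_wulffShape hn hC2 hconv horient hP hX hΛ0 hΛ hξ Q hae,
      ← Set.range_comp]
    exact congrArg Set.range (funext hXξ)
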